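/- Let $r\ge 2$, $q=e^{\pi i/r}$, $q^a=e^{\pi i a/r}$ and $[a]=\frac{q^a-q^{-a}}{q-q^{-1}}$ for $a\in\mathbb C$. Let $\mathcal C$ be the category of weight modules over the unrolled restricted quantum group $\overline U_q^H(\mathfrak{sl}_2)$ (finite-dimensional modules on which $H$ is diagonalizable and $K=q^H$). The algebra has generators $E,F,K^{\pm1},H$ and relations $KE=q^2EK$, $KF=q^{-2}FK$, $HK=KH$, $[H,E]=2E$, $[H,F]=-2F$, $[E,F]=\frac{K-K^{-1}}{q-q^{-1}}$, $E^r=F^r=0$, and the comultiplication is $\Delta E=1\otimes E+E\otimes K$, $\Delta F=K^{-1}\otimes F+F\otimes 1$, $\Delta K=K\otimes K$, $\Delta H=H\otimes 1+1\otimes H$. For $a\in\mathbb C$ let $V_a$ be the $r$-dimensional module with basis $v_0,\dots,v_{r-1}$ and $Hv_k=(a+r-1-2k)v_k$, $Fv_k=v_{k+1}$ (with $v_r=0$), $Ev_k=[k][k-a]v_{k-1}$. For $\ell\in\mathbb Z$ let $\mathbb C^H_{\ell r}$ be the one-dimensional module on which $E,F$ act by $0$ and $H$ by $\ell r$. For $0\le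 i\le r-2$ let $S_i$ be the simple module of dimension $i+1$ and highest weight $i$. A modified trace is a family of linear maps $t_V:\mathrm{End}_{\mathcal C}(V)\to\mathbb C$, $V$ projective in $\mathcal C$, with $t_U(gf)=t_V(fg)$ for $f:U\to V$, $g:V\to U$, and $t_{U\otimes W}(f)=t_U(\mathrm{ptr}_W f)$ for $f\in\mathrm{End}(U\otimes W)$, $U$ projective, $W\in\mathcal C$, where $\mathrm{ptr}_W$ is the right partial trace formed with the evaluation $W\otimes W^*\to\mathbb C$, $w\otimes\varphi\mapsto\varphi(K^{1-r}w)$. There is exactly one modified trace $t$ with $t_{V_0}(c\,\mathrm{Id})=(-1)^{r-1}c$ for all $c\in\mathbb C$; put $\mathbf d(V)=t_V(\mathrm{Id}_V)$ for projective $V$. Fix $i\in\{0,\dots,r-2\}$ and $\ell\in\mathbb Z$. For $\epsilon\in(-\frac12,\frac12)$ let $X_\epsilon$ be the module with basis $w^H_{i-2k},w^S_{i-2k}$ $(0\le k\le i)$, $w^L_{-i-2-2k},w^R_{i+2+2k}$ $(0\le k\le r-2-i)$ and action $Hw^X_m=(m+\ell r+\epsilon)w^X_m$, $Kw^X_m=(-1)^\ell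 q^{m+\epsilon}w^X_m$, \begin{align*} &Fw^X_m=w^X_{m-2}\ (X\in\{L,H,S\}\text{, inside each family}),\quad Fw^H_{-i}=w^L_{-i-2},\quad Fw^S_{-i}=-[1+i][\epsilon]w^L_{-i-2},\quad Fw^L_{i+2-2r}=0,\\ &Fw^R_{i+2}=w^S_i+[1+i][\epsilon]w^H_i,\quad Fw^R_{i+2+2k}=-[1+i+k][k+\epsilon]w^R_{i+2+2(k-1)}\ (k\ge1),\\ &Ew^R_m=(-1)^\ell w^R_{m+2},\quad Ew^R_{2r-2-i}=0,\quad Ew^H_i=(-1)^\ell w^R_{i+2},\quad Ew^S_i=2(-1)^{\ell+1}[1+i][\epsilon]w^R_{i+2},\\ &Ew^L_{-i-2}=2(-1)^\ell[i+1][\epsilon]w^H_{-i}+(-1)^\ell w^S_{-i},\quad Ew^L_{-i-2-2k}=(-1)^{\ell+1}[1+i+k][k-\epsilon]w^L_{-i-2-2(k-1)}\ (k\ge1),\\ &Ew^H_{i-2k}=(-1)^\ell\big(2[1+i-k+\epsilon][k]-[1+i-k][k-\epsilon]\big)w^H_{i-2(k-1)}+(-1)^\ell w^S_{i-2(k-1)}\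 (k\ge1),\\ &Ew^S_{i-2k}=(-1)^\ell\big(2[1+i-k][k-\epsilon]-[1+i-k+\epsilon][k]\big)w^S_{i-2(k-1)}+2(-1)^{\ell+1}[1+i]^2[\epsilon]^2w^H_{i-2(k-1)}\ (k\ge1). \end{align*} Let $P_i$ be the module given by these formulas with $\ell=0$, $\epsilon=0$; it is the projective cover of $S_i$. All $X_\epsilon$ with $\epsilon\in(-\frac12,\frac12)$ and $P_i\otimes\mathbb C^H_{\ell r}$ are projective, and $$\lim_{\epsilon\to0}\mathbf d(X_\epsilon)=\mathbf d(X_0)=\mathbf d(P_i\otimes\mathbb C^H_{\ell r})=(-1)^{\ell(r-1)+i+1}\,(q^{i+1}+q^{-i-1}).$$ -/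

import Mathlib

open scoped TensorProduct

noncomputable section

namespace Unrolled

/-- `q ^ a` for a complex number `a`, where `q = exp (π i / r)`. -/
def qpow (r : ℕ) (a : ℂ) : ℂ := Complex.exp (Real.pi * Complex.I * a / r)

/-- The quantum number `[a] = (q ^ a - q ^ (-a)) / (q - q ^ (-1))`. -/
def qnum (r : ℕ) (a : ℂ) : ℂ := (qpow r a - qpow r (-a)) / (qpow r 1 - qpow r (-1))

theorem qpow_add (r : ℕ) (a b : ℂ) : qpow r (a + b) = qpow r a * qpow r b := by
  rw [qpow, qpow, qpow, ← Complex.exp_add]; congr 1; ring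

theorem qpow_zero (r : ℕ) : qpow r 0 = 1 := by simp [qpow]

theorem qpow_ne_zero (r : ℕ) (a : ℂ) : qpow r a ≠ 0 := Complex.exp_ne_zero _

theorem qpow_neg (r : ℕ) (a : ℂ) : qpow r (-a) = (qpow r a)⁻¹ := by
  rw [qpow, qpow, ← Complex.exp_neg]; congr 1; ring

theorem qpow_sub (r : ℕ) (a b : ℂ) : qpow r (a - b) = qpow r a * (qpow r b)⁻¹ := by
  rw [sub_eq_add_neg, qpow_add, qpow_neg]

theorem qpow_natCast_mul (r n : ℕ) (a : ℂ) : qpow r (n * a) = qpow r a ^ n := by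
  rw [qpow, qpow, ← Complex.exp_nat_mul]; congr 1; ring

theorem qpow_self {r : ℕ} (hr : 2 ≤ r) : qpow r r = -1 := by
  have : (r : ℂ) ≠ 0 := by exact_mod_cast (by omega : r ≠ 0)
  rw [qpow, mul_div_assoc, div_self this, mul_one, Complex.exp_pi_mul_I]

/-- `q ^ 2` is a primitive `r`-th root of unity. -/
theorem qpow_two_primitive {r : ℕ} (hr : 2 ≤ r) : IsPrimitiveRoot (qpow r 2) r := by
  have h := Complex.isPrimitiveRoot_exp r (by omega)
  have e : qpow r 2 = Complex.exp (2 * Real.pi * Complex.I / r) := by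
    rw [qpow]; congr 1; ring
  rwa [e]

theorem qpow_one_sub_ne_zero {r : ℕ} (hr : 2 ≤ r) : qpow r 1 - qpow r (-1) ≠ 0 := by
  intro h
  have h2 : qpow r 2 = 1 := by
    have : (2 : ℂ) = 1 + 1 := by norm_num
    rw [this, qpow_add]
    nth_rewrite 1 [sub_eq_zero.mp h]
    rw [← qpow_add]; simp [qpow_zero]
  have h3 := (qpow_two_primitive hr).pow_eq_one_iff_dvd 1
  rw [pow_one] at h3
  have := Nat.le_of_dvd one_pos (h3.mp h2)
  omega

/-- The five generators of the unrolled restricted quantum group. -/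
inductive Gen : Type
  | E | F | K | Kinv | H

/-- The defining relations of the unrolled restricted quantum group of `sl₂` at `q = exp (π i / r)`,
for five elements of a complex algebra. -/
structure Relations (r : ℕ) {A : Type*} [Ring A] [Algebra ℂ A] (e f k k' h : A) : Prop where
  k_kinv : k * k' = 1
  kinv_k : k' * k = 1
  k_e : k * e = qpow r 2 • (e * k)
  k_f : k * f = qpow r (-2) • (f * k)
  h_k : h * k = k * h
  h_e : h * e - e * h = (2 : ℂ) • e
  h_f : h * f - f * h = (-2 : ℂ) • f
  e_f : e * f - f * e = (qpow r 1 - qpow r (-1))⁻¹ • (k - k')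
  e_pow : e ^ r = 0
  f_pow : f ^ r = 0

open FreeAlgebra in
/-- The same relations as pairs of elements of the free algebra on the generators. -/
inductive Rel (r : ℕ) : FreeAlgebra ℂ Gen → FreeAlgebra ℂ Gen → Prop
  | k_kinv : Rel r (ι ℂ Gen.K * ι ℂ Gen.Kinv) 1
  | kinv_k : Rel r (ι ℂ Gen.Kinv * ι ℂ Gen.K) 1
  | k_e : Rel r (ι ℂ Gen.K * ι ℂ Gen.E) (qpow r 2 • (ι ℂ Gen.E * ι ℂ Gen.K))
  | k_f : Rel r (ι ℂ Gen.K * ι ℂ Gen.F) (qpow r (-2) • (ι ℂ Gen.F * ι ℂ Gen.K))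
  | h_k : Rel r (ι ℂ Gen.H * ι ℂ Gen.K) (ι ℂ Gen.K * ι ℂ Gen.H)
  | h_e : Rel r (ι ℂ Gen.H * ι ℂ Gen.E - ι ℂ Gen.E * ι ℂ Gen.H) ((2 : ℂ) • ι ℂ Gen.E)
  | h_f : Rel r (ι ℂ Gen.H * ι ℂ Gen.F - ι ℂ Gen.F * ι ℂ Gen.H) ((-2 : ℂ) • ι ℂ Gen.F)
  | e_f : Rel r (ι ℂ Gen.E * ι ℂ Gen.F - ι ℂ Gen.F * ι ℂ Gen.E)
      ((qpow r 1 - qpow r (-1))⁻¹ • (ι ℂ Gen.K - ι ℂ Gen.Kinv))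
  | e_pow : Rel r (ι ℂ Gen.E ^ r) 0
  | f_pow : Rel r (ι ℂ Gen.F ^ r) 0

/-- The unrolled restricted quantum group of `sl₂` at `q = exp (π i / r)`, as the unital
associative complex algebra with the above generators and relations. -/
abbrev UqH (r : ℕ) : Type := RingQuot (Rel r)

namespace UqH

/-- The generators of the algebra. -/
def gen (r : ℕ) (g : Gen) : UqH r := RingQuot.mkAlgHom ℂ (Rel r) (FreeAlgebra.ι ℂ g)

theorem relations (r : ℕ) :
    Relations r (gen r .E) (gen r .F) (gen r .K) (gen r .Kinv) (gen r .H) where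
  k_kinv := by simpa [gen] using RingQuot.mkAlgHom_rel ℂ (Rel.k_kinv (r := r))
  kinv_k := by simpa [gen] using RingQuot.mkAlgHom_rel ℂ (Rel.kinv_k (r := r))
  k_e := by simpa [gen] using RingQuot.mkAlgHom_rel ℂ (Rel.k_e (r := r))
  k_f := by simpa [gen] using RingQuot.mkAlgHom_rel ℂ (Rel.k_f (r := r))
  h_k := by simpa [gen] using RingQuot.mkAlgHom_rel ℂ (Rel.h_k (r := r))
  h_e := by simpa [gen] using RingQuot.mkAlgHom_rel ℂ (Rel.h_e (r := r))
  h_f := by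
    simpa only [gen, map_sub, map_mul, map_smul] using RingQuot.mkAlgHom_rel ℂ (Rel.h_f (r := r))
  e_f := by simpa [gen] using RingQuot.mkAlgHom_rel ℂ (Rel.e_f (r := r))
  e_pow := by simpa [gen] using RingQuot.mkAlgHom_rel ℂ (Rel.e_pow (r := r))
  f_pow := by simpa [gen] using RingQuot.mkAlgHom_rel ℂ (Rel.f_pow (r := r))

/-- The assignment of elements to the five generators. -/
def assign {A : Type*} (e f k k' h : A) : Gen → A
  | .E => e
  | .F => f
  | .K => k
  | .Kinv => k'
  | .H => h

/-- The algebra homomorphism determined by five elements that satisfy the relations. -/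
def lift {r : ℕ} {A : Type*} [Ring A] [Algebra ℂ A] {e f k k' h : A}
    (hR : Relations r e f k k' h) : UqH r →ₐ[ℂ] A :=
  RingQuot.liftAlgHom ℂ ⟨FreeAlgebra.lift ℂ (assign e f k k' h), by
    intro x y hxy
    cases hxy
    · simpa [assign] using hR.k_kinv
    · simpa [assign] using hR.kinv_k
    · simpa [assign] using hR.k_e
    · simpa [assign] using hR.k_f
    · simpa [assign] using hR.h_k
    · simpa [assign] using hR.h_e
    · simpa [assign] using hR.h_f
    · simpa [assign] using hR.e_f
    · simpa [assign] using hR.e_pow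
    · simpa [assign] using hR.f_pow⟩

theorem lift_gen {r : ℕ} {A : Type*} [Ring A] [Algebra ℂ A] {e f k k' h : A}
    (hR : Relations r e f k k' h) (g : Gen) : lift hR (gen r g) = assign e f k k' h g := by
  rw [lift, gen, RingQuot.liftAlgHom_mkAlgHom_apply, FreeAlgebra.lift_ι_apply]

/-- A property of elements holds everywhere if it holds for the generators and is preserved by the
algebra operations. -/
theorem induction {r : ℕ} {p : UqH r → Prop} (hg : ∀ g, p (gen r g))
    (hc : ∀ c : ℂ, p (algebraMap ℂ (UqH r) c)) (ha : ∀ x y, p x → p y → p (x + y))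
    (hm : ∀ x y, p x → p y → p (x * y)) (x : UqH r) : p x := by
  obtain ⟨y, rfl⟩ := RingQuot.mkAlgHom_surjective ℂ (Rel r) x
  induction y using FreeAlgebra.induction with
  | grade0 c => rw [AlgHom.commutes]; exact hc c
  | grade1 g => exact hg g
  | mul a b ha hb => rw [map_mul]; exact hm _ _ ha hb
  | add a b h1 h2 => rw [map_add]; exact ha _ _ h1 h2

end UqH

/-- If `b a = z a b` with `z` a primitive `r`-th root of unity, and `a ^ r = b ^ r = 0`, then
`(a + b) ^ r = 0`. -/
theorem add_pow_eq_zero_of_qcommute {r : ℕ} (hr : 2 ≤ r) {A : Type*} [Ring A] [Algebra ℂ A]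
    {z : ℂ} (hz : IsPrimitiveRoot z r) {a b : A} (hab : b * a = z • (a * b))
    (ha : a ^ r = 0) (hb : b ^ r = 0) : (a + b) ^ r = 0 := by
  have hba : ∀ n : ℕ, b * a ^ n = z ^ n • (a ^ n * b) := by
    intro n
    induction n with
    | zero => simp
    | succ n ih =>
      rw [pow_succ, ← mul_assoc, ih, smul_mul_assoc, mul_assoc, hab, mul_smul_comm, smul_smul,
        ← mul_assoc, pow_succ]
  let c : ℕ → ℕ → ℂ := fun n => Nat.rec (fun k => if k = 0 then 1 else 0)
    (fun _ p k => z ^ k * p k + (if k = 0 then 0 else p (k - 1))) n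
  have c0 : ∀ k, c 0 k = if k = 0 then 1 else 0 := fun k => rfl
  have cs : ∀ n k, c (n + 1) k = z ^ k * c n k + (if k = 0 then 0 else c n (k - 1)) :=
    fun n k => rfl
  have cbig : ∀ n k, n < k → c n k = 0 := by
    intro n
    induction n with
    | zero => intro k hk; rw [c0, if_neg (by omega)]
    | succ n ih =>
      intro k hk
      rw [cs, ih k (by omega), if_neg (by omega), ih (k - 1) (by omega)]; simp
  have hsum : ∀ n, (a + b) ^ n = ∑ k ∈ Finset.range (n + 1), c n k • (a ^ k * b ^ (n - k)) := by
    intro n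
    induction n with
    | zero => simp [c0]
    | succ n ih =>
      rw [pow_succ', ih, add_mul, Finset.mul_sum, Finset.mul_sum, Finset.sum_range_succ' _ (n + 1)]
      have e1 : ∀ k ∈ Finset.range (n + 1), a * c n k • (a ^ k * b ^ (n - k)) =
          c n k • (a ^ (k + 1) * b ^ (n + 1 - (k + 1))) := by
        intro k _
        rw [mul_smul_comm, ← mul_assoc, ← pow_succ', Nat.add_sub_add_right]
      have e2 : ∀ k ∈ Finset.range (n + 1), b * c n k • (a ^ k * b ^ (n - k)) =
          (z ^ k * c n k) • (a ^ k * b ^ (n + 1 - k)) := by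
        intro k hk
        have hk' : k ≤ n := by simpa [Nat.lt_succ_iff] using hk
        rw [mul_smul_comm, ← mul_assoc, hba, smul_mul_assoc, smul_smul, mul_assoc, ← pow_succ',
          mul_comm (c n k), Nat.sub_add_comm hk']
      rw [Finset.sum_congr rfl e1, Finset.sum_congr rfl e2]
      have e3 : ∑ k ∈ Finset.range (n + 1), (z ^ k * c n k) • (a ^ k * b ^ (n + 1 - k)) =
          ∑ k ∈ Finset.range (n + 1), (z ^ (k + 1) * c n (k + 1)) •
            (a ^ (k + 1) * b ^ (n + 1 - (k + 1))) + (z ^ 0 * c n 0) • (a ^ 0 * b ^ (n + 1 - 0)) := by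
        rw [← Finset.sum_range_succ' (fun k => (z ^ k * c n k) • (a ^ k * b ^ (n + 1 - k))) (n + 1),
          Finset.sum_range_succ _ (n + 1), cbig n (n + 1) (by omega)]
        simp
      rw [e3, ← add_assoc, ← Finset.sum_add_distrib]
      congr 1
      · refine Finset.sum_congr rfl fun k _ => ?_
        rw [← add_smul, cs, if_neg (by omega), Nat.add_sub_cancel, add_comm]
      · rw [cs]; simp
  have key : ∀ n k, c (n + 1) (k + 1) * (z ^ (k + 1) - 1) = (z ^ (n + 1) - 1) * c n k := by
    intro n
    induction n with
    | zero =>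
      intro k
      rw [cs, c0, c0]
      rcases k with _ | k <;> simp [c0]
    | succ n ih =>
      intro k
      rw [cs (n + 1), if_neg (by omega), Nat.add_sub_cancel]
      rcases k with _ | k
      · have h1 := ih 0
        have h2 : c (n + 1) 0 = c n 0 := by rw [cs]; simp
        rw [h2]
        linear_combination z * h1
      · have h1 := ih (k + 1)
        have h2 := ih k
        have h3 := cs n (k + 1)
        rw [if_neg (by omega), Nat.add_sub_cancel] at h3
        linear_combination z ^ (k + 2) * h1 + z * h2 + (z - z ^ (n + 2)) * h3
  have cr : ∀ k, 0 < k → k < r → c r k = 0 := by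
    intro k hk hkr
    obtain ⟨n, rfl⟩ : ∃ n, r = n + 1 := ⟨r - 1, by omega⟩
    obtain ⟨j, rfl⟩ : ∃ j, k = j + 1 := ⟨k - 1, by omega⟩
    have h := key n j
    rw [hz.pow_eq_one, sub_self, zero_mul] at h
    rcases mul_eq_zero.mp h with h | h
    · exact h
    · exact absurd (sub_eq_zero.mp h) (hz.pow_ne_one_of_pos_of_lt (by omega) hkr)
  rw [hsum]
  refine Finset.sum_eq_zero fun k hk => ?_
  have hk' : k ≤ r := by simpa [Nat.lt_succ_iff] using hk
  rcases Nat.eq_zero_or_pos k with rfl | h0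
  · simp [hb]
  · rcases hk'.lt_or_eq with h1 | rfl
    · rw [cr k h0 h1, zero_smul]
    · simp [ha]

/-- Conjugation lemmas for elements that satisfy the relations. -/
theorem Relations.kinv_e {r : ℕ} {A : Type*} [Ring A] [Algebra ℂ A] {e f k k' h : A}
    (hR : Relations r e f k k' h) : k' * e = qpow r (-2) • (e * k') := by
  have h1 : k' * (k * e) * k' = qpow r 2 • (k' * e) := by
    rw [hR.k_e, mul_smul_comm, smul_mul_assoc]
    congr 1
    rw [mul_assoc, mul_assoc, hR.k_kinv, mul_one]
  rw [← mul_assoc, hR.kinv_k, one_mul] at h1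
  rw [h1, smul_smul, ← qpow_add]; simp [qpow_zero]

theorem Relations.kinv_f {r : ℕ} {A : Type*} [Ring A] [Algebra ℂ A] {e f k k' h : A}
    (hR : Relations r e f k k' h) : k' * f = qpow r 2 • (f * k') := by
  have h1 : k' * (k * f) * k' = qpow r (-2) • (k' * f) := by
    rw [hR.k_f, mul_smul_comm, smul_mul_assoc]
    congr 1
    rw [mul_assoc, mul_assoc, hR.k_kinv, mul_one]
  rw [← mul_assoc, hR.kinv_k, one_mul] at h1
  rw [h1, smul_smul, ← qpow_add]; simp [qpow_zero]

theorem Relations.h_kinv {r : ℕ} {A : Type*} [Ring A] [Algebra ℂ A] {e f k k' h : A}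
    (hR : Relations r e f k k' h) : h * k' = k' * h := by
  calc h * k' = k' * k * (h * k') := by rw [hR.kinv_k, one_mul]
    _ = k' * (k * h) * k' := by simp only [mul_assoc]
    _ = k' * (h * k) * k' := by rw [hR.h_k]
    _ = k' * h * (k * k') := by simp only [mul_assoc]
    _ = k' * h := by rw [hR.k_kinv, mul_one]

theorem pow_qcommute {A : Type*} [Ring A] [Algebra ℂ A] {a b : A} {z : ℂ}
    (h : a * b = z • (b * a)) (n : ℕ) : a ^ n * b = z ^ n • (b * a ^ n) := by
  induction n with
  | zero => simp
  | succ n ih =>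
    rw [pow_succ', mul_assoc, ih, mul_smul_comm, ← mul_assoc, h, smul_mul_assoc, smul_smul,
      mul_assoc, pow_succ]

section Comul

variable (r : ℕ) [hr : Fact (2 ≤ r)]

open UqH in
theorem comul_relations : Relations r
    ((1 : UqH r) ⊗ₜ[ℂ] gen r .E + gen r .E ⊗ₜ[ℂ] gen r .K)
    (gen r .Kinv ⊗ₜ[ℂ] gen r .F + gen r .F ⊗ₜ[ℂ] (1 : UqH r))
    (gen r .K ⊗ₜ[ℂ] gen r .K) (gen r .Kinv ⊗ₜ[ℂ] gen r .Kinv)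
    (gen r .H ⊗ₜ[ℂ] (1 : UqH r) + (1 : UqH r) ⊗ₜ[ℂ] gen r .H) := by
  have R := relations r
  generalize gen r .E = e at *
  generalize gen r .F = f at *
  generalize gen r .K = k at *
  generalize gen r .Kinv = k' at *
  generalize gen r .H = h at *
  have h22 : qpow r 2 * qpow r (-2) = 1 := by rw [← qpow_add]; simp [qpow_zero]
  have hprim : IsPrimitiveRoot (qpow r 2) r := qpow_two_primitive hr.out
  refine ⟨?_, ?_, ?_, ?_, ?_, ?_, ?_, ?_, ?_, ?_⟩
  · simp [R.k_kinv, Algebra.TensorProduct.one_def]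
  · simp [R.kinv_k, Algebra.TensorProduct.one_def]
  · simp only [mul_add, add_mul, Algebra.TensorProduct.tmul_mul_tmul, R.k_e, mul_one, one_mul,
      TensorProduct.tmul_smul, TensorProduct.smul_tmul', smul_add]
  · simp only [mul_add, add_mul, Algebra.TensorProduct.tmul_mul_tmul, R.k_f, mul_one, one_mul,
      TensorProduct.tmul_smul, TensorProduct.smul_tmul', smul_add, R.k_kinv, R.kinv_k]
  · simp only [mul_add, add_mul, Algebra.TensorProduct.tmul_mul_tmul, R.h_k, mul_one, one_mul]
  · have := R.h_e
    have e1 : h * e = e * h + (2 : ℂ) • e := by rw [← this]; abel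
    simp only [mul_add, add_mul, Algebra.TensorProduct.tmul_mul_tmul, R.h_k, mul_one, one_mul, e1,
      TensorProduct.tmul_add, TensorProduct.add_tmul, TensorProduct.tmul_smul,
      TensorProduct.smul_tmul', smul_add]
    abel
  · have := R.h_f
    have e1 : h * f = f * h + (-2 : ℂ) • f := by rw [← this]; abel
    simp only [mul_add, add_mul, Algebra.TensorProduct.tmul_mul_tmul, R.h_kinv, mul_one, one_mul,
      e1, TensorProduct.tmul_add, TensorProduct.add_tmul, TensorProduct.tmul_smul,
      TensorProduct.smul_tmul', smul_add]
    abel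
  · have e1 : e * f = f * e + (qpow r 1 - qpow r (-1))⁻¹ • (k - k') := by rw [← R.e_f]; abel
    have e2 : (k' * e) ⊗ₜ[ℂ] (f * k) = (e * k') ⊗ₜ[ℂ] (k * f) := by
      rw [R.kinv_e, R.k_f, TensorProduct.tmul_smul, TensorProduct.smul_tmul']
    simp only [mul_add, add_mul, Algebra.TensorProduct.tmul_mul_tmul, mul_one, one_mul, e1, e2,
      TensorProduct.tmul_add, TensorProduct.add_tmul, TensorProduct.tmul_smul,
      ← TensorProduct.smul_tmul', smul_sub, TensorProduct.tmul_sub, TensorProduct.sub_tmul]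
    abel
  · refine add_pow_eq_zero_of_qcommute (A := UqH r ⊗[ℂ] UqH r) hr.out hprim ?_ ?_ ?_
    · simp only [Algebra.TensorProduct.tmul_mul_tmul, R.k_e, mul_one, one_mul,
        TensorProduct.tmul_smul]
    · rw [Algebra.TensorProduct.tmul_pow, R.e_pow, TensorProduct.tmul_zero]
    · rw [Algebra.TensorProduct.tmul_pow, R.e_pow, TensorProduct.zero_tmul]
  · rw [add_comm]
    refine add_pow_eq_zero_of_qcommute (A := UqH r ⊗[ℂ] UqH r) hr.out hprim ?_ ?_ ?_
    · simp only [Algebra.TensorProduct.tmul_mul_tmul, R.kinv_f, mul_one, one_mul,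
        TensorProduct.smul_tmul']
    · rw [Algebra.TensorProduct.tmul_pow, R.f_pow, TensorProduct.zero_tmul]
    · rw [Algebra.TensorProduct.tmul_pow, R.f_pow, TensorProduct.tmul_zero]

/-- The comultiplication: `Δ E = 1 ⊗ E + E ⊗ K`, `Δ F = K⁻¹ ⊗ F + F ⊗ 1`, `Δ K = K ⊗ K`,
`Δ H = H ⊗ 1 + 1 ⊗ H`. -/
def comul : UqH r →ₐ[ℂ] UqH r ⊗[ℂ] UqH r := UqH.lift (comul_relations r)

end Comul

/-- A weight module: a finite-dimensional module over the unrolled restricted quantum group on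
which `H` is diagonalizable and `K` acts as `q ^ H`. -/
structure WeightModule (r : ℕ) where
  carrier : Type
  [addCommGroup : AddCommGroup carrier]
  [module : Module ℂ carrier]
  [finite : Module.Finite ℂ carrier]
  /-- The action of the algebra. -/
  ρ : UqH r →ₐ[ℂ] Module.End ℂ carrier
  exists_weight_basis : ∃ (ι : Type) (b : Module.Basis ι ℂ carrier) (wt : ι → ℂ), ∀ j,
    ρ (UqH.gen r .H) (b j) = wt j • b j ∧ ρ (UqH.gen r .K) (b j) = qpow r (wt j) • b j

namespace WeightModule

attribute [instance] WeightModule.addCommGroup WeightModule.module WeightModule.finite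

variable {r : ℕ}

/-- The space of module homomorphisms. -/
def Hom (M N : WeightModule r) : Submodule ℂ (M.carrier →ₗ[ℂ] N.carrier) where
  carrier := {f | ∀ (x : UqH r) (v : M.carrier), f (M.ρ x v) = N.ρ x (f v)}
  add_mem' := by
    intro f g hf hg x v
    simp only [Set.mem_ofPred_eq] at hf hg
    simp [hf, hg]
  zero_mem' := by intro x v; simp
  smul_mem' := by
    intro c f hf x v
    simp only [Set.mem_ofPred_eq] at hf
    simp [hf]

/-- The identity homomorphism. -/
def idHom (M : WeightModule r) : Hom M M := ⟨LinearMap.id, fun _ _ => rfl⟩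

/-- Composition of homomorphisms, `g` after `f`. -/
def compHom {M N P : WeightModule r} (g : Hom N P) (f : Hom M N) : Hom M P :=
  ⟨g.1 ∘ₗ f.1, fun x v => by
    simp only [LinearMap.comp_apply]
    rw [f.2 x v, g.2 x (f.1 v)]⟩

/-- Projective objects of the category of weight modules. -/
def IsProjective (P : WeightModule r) : Prop :=
  ∀ (M N : WeightModule r) (g : Hom M N) (f : Hom P N), Function.Surjective g.1 →
    ∃ h : Hom P M, compHom g h = f

/-- `π : P → S` is a projective cover: `P` is projective, `π` is surjective, and no proper
submodule of `P` is mapped onto `S`. -/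
def IsProjectiveCover {P S : WeightModule r} (π : Hom P S) : Prop :=
  IsProjective P ∧ Function.Surjective π.1 ∧
    ∀ N : Submodule ℂ P.carrier, (∀ (x : UqH r), ∀ v ∈ N, P.ρ x v ∈ N) →
      N.map π.1 = ⊤ → N = ⊤

/-- The right evaluation `W ⊗ W^* → ℂ`, `w ⊗ φ ↦ φ (K ^ (1 - r) w)`. -/
def rightEval (W : WeightModule r) : W.carrier ⊗[ℂ] Module.Dual ℂ W.carrier →ₗ[ℂ] ℂ :=
  contractRight ℂ W.carrier ∘ₗ
    LinearMap.rTensor (Module.Dual ℂ W.carrier) (W.ρ (UqH.gen r .Kinv ^ (r - 1)))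

/-- The right partial trace of a linear endomorphism `f` of `V ⊗ W`:
`(id_V ⊗ rightEval_W) ∘ (f ⊗ id_{W^*}) ∘ (id_V ⊗ coev_W)`. -/
def partialTraceLin (V W : WeightModule r)
    (f : V.carrier ⊗[ℂ] W.carrier →ₗ[ℂ] V.carrier ⊗[ℂ] W.carrier) :
    V.carrier →ₗ[ℂ] V.carrier :=
  (TensorProduct.rid ℂ V.carrier).toLinearMap ∘ₗ
    LinearMap.lTensor V.carrier (rightEval W) ∘ₗ
    (TensorProduct.assoc ℂ V.carrier W.carrier (Module.Dual ℂ W.carrier)).toLinearMap ∘ₗ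
    LinearMap.rTensor (Module.Dual ℂ W.carrier) f ∘ₗ
    (TensorProduct.assoc ℂ V.carrier W.carrier (Module.Dual ℂ W.carrier)).symm.toLinearMap ∘ₗ
    LinearMap.lTensor V.carrier (coevaluation ℂ W.carrier) ∘ₗ
    (TensorProduct.rid ℂ V.carrier).symm.toLinearMap

theorem partialTraceLin_add (V W : WeightModule r)
    (f g : V.carrier ⊗[ℂ] W.carrier →ₗ[ℂ] V.carrier ⊗[ℂ] W.carrier) :
    partialTraceLin V W (f + g) = partialTraceLin V W f + partialTraceLin V W g := by
  ext v
  simp [partialTraceLin, LinearMap.rTensor_add]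

theorem partialTraceLin_map (V W : WeightModule r) (B : Module.End ℂ V.carrier)
    (C : Module.End ℂ W.carrier) :
    partialTraceLin V W (TensorProduct.map B C) =
      LinearMap.trace ℂ W.carrier (W.ρ (UqH.gen r .Kinv ^ (r - 1)) * C) • B := by
  classical
  ext v
  let b := Module.Basis.ofVectorSpace ℂ W.carrier
  rw [LinearMap.trace_eq_matrix_trace ℂ b, Matrix.trace]
  simp [partialTraceLin, rightEval, coevaluation_apply_one, TensorProduct.tmul_sum,
    LinearMap.toMatrix_apply, Finset.sum_smul, b]

/-- Induction over the endomorphisms of a tensor product. -/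
theorem end_tensor_induction (V W : WeightModule r)
    {p : Module.End ℂ (V.carrier ⊗[ℂ] W.carrier) → Prop}
    (h0 : ∀ B C, p (TensorProduct.map B C)) (ha : ∀ f g, p f → p g → p (f + g))
    (f : Module.End ℂ (V.carrier ⊗[ℂ] W.carrier)) : p f := by
  obtain ⟨y, rfl⟩ :=
    (homTensorHomEquiv ℂ V.carrier W.carrier V.carrier W.carrier).surjective f
  induction y using TensorProduct.induction_on with
  | zero =>
    have := h0 0 0
    simpa using this
  | tmul B C => simpa [homTensorHomEquiv_apply] using h0 B C
  | add x y hx hy => rw [map_add]; exact ha _ _ hx hy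

theorem partialTraceLin_mul_left (V W : WeightModule r) (A : Module.End ℂ V.carrier)
    (f : Module.End ℂ (V.carrier ⊗[ℂ] W.carrier)) :
    partialTraceLin V W (TensorProduct.map A (1 : Module.End ℂ W.carrier) * f) =
      A * partialTraceLin V W f := by
  induction f using end_tensor_induction V W with
  | h0 B C => rw [← TensorProduct.map_mul, partialTraceLin_map, partialTraceLin_map, one_mul,
      mul_smul_comm]
  | ha f g hf hg => rw [mul_add, partialTraceLin_add, partialTraceLin_add, hf, hg, mul_add]

theorem partialTraceLin_mul_right (V W : WeightModule r) (A : Module.End ℂ V.carrier)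
    (f : Module.End ℂ (V.carrier ⊗[ℂ] W.carrier)) :
    partialTraceLin V W (f * TensorProduct.map A (1 : Module.End ℂ W.carrier)) =
      partialTraceLin V W f * A := by
  induction f using end_tensor_induction V W with
  | h0 B C => rw [← TensorProduct.map_mul, partialTraceLin_map, partialTraceLin_map, mul_one,
      smul_mul_assoc]
  | ha f g hf hg => rw [add_mul, partialTraceLin_add, partialTraceLin_add, hf, hg, add_mul]

theorem partialTraceLin_cycle (V W : WeightModule r) {A A' : Module.End ℂ W.carrier}
    (hA : A * W.ρ (UqH.gen r .Kinv ^ (r - 1)) = W.ρ (UqH.gen r .Kinv ^ (r - 1)) * A')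
    (f : Module.End ℂ (V.carrier ⊗[ℂ] W.carrier)) :
    partialTraceLin V W (f * TensorProduct.map (1 : Module.End ℂ V.carrier) A) =
      partialTraceLin V W (TensorProduct.map (1 : Module.End ℂ V.carrier) A' * f) := by
  induction f using end_tensor_induction V W with
  | h0 B C =>
    rw [← TensorProduct.map_mul, ← TensorProduct.map_mul, partialTraceLin_map, partialTraceLin_map,
      mul_one, one_mul, ← mul_assoc, LinearMap.trace_mul_comm, ← mul_assoc, hA, mul_assoc]
  | ha f g hf hg => rw [add_mul, mul_add, partialTraceLin_add, partialTraceLin_add, hf, hg]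

section Tensor

variable [hr : Fact (2 ≤ r)]

/-- The action on a tensor product, through the comultiplication. -/
def tensorAction (V W : WeightModule r) :
    UqH r →ₐ[ℂ] Module.End ℂ (V.carrier ⊗[ℂ] W.carrier) :=
  ((Module.endTensorEndAlgHom (R := ℂ) (S := ℂ) (A := ℂ) (M := V.carrier) (N := W.carrier)).comp
    (Algebra.TensorProduct.map V.ρ W.ρ)).comp (comul r)

theorem tensorAction_E (V W : WeightModule r) : tensorAction V W (UqH.gen r .E) =
    TensorProduct.map 1 (W.ρ (UqH.gen r .E)) +
      TensorProduct.map (V.ρ (UqH.gen r .E)) (W.ρ (UqH.gen r .K)) := by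
  simp [tensorAction, comul, UqH.lift_gen, UqH.assign, Module.endTensorEndAlgHom_apply,
    TensorProduct.AlgebraTensorModule.map_eq]

theorem tensorAction_F (V W : WeightModule r) : tensorAction V W (UqH.gen r .F) =
    TensorProduct.map (V.ρ (UqH.gen r .Kinv)) (W.ρ (UqH.gen r .F)) +
      TensorProduct.map (V.ρ (UqH.gen r .F)) 1 := by
  simp [tensorAction, comul, UqH.lift_gen, UqH.assign, Module.endTensorEndAlgHom_apply,
    TensorProduct.AlgebraTensorModule.map_eq]

theorem tensorAction_K (V W : WeightModule r) : tensorAction V W (UqH.gen r .K) =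
    TensorProduct.map (V.ρ (UqH.gen r .K)) (W.ρ (UqH.gen r .K)) := by
  simp [tensorAction, comul, UqH.lift_gen, UqH.assign, Module.endTensorEndAlgHom_apply,
    TensorProduct.AlgebraTensorModule.map_eq]

theorem tensorAction_Kinv (V W : WeightModule r) : tensorAction V W (UqH.gen r .Kinv) =
    TensorProduct.map (V.ρ (UqH.gen r .Kinv)) (W.ρ (UqH.gen r .Kinv)) := by
  simp [tensorAction, comul, UqH.lift_gen, UqH.assign, Module.endTensorEndAlgHom_apply,
    TensorProduct.AlgebraTensorModule.map_eq]

theorem tensorAction_H (V W : WeightModule r) : tensorAction V W (UqH.gen r .H) =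
    TensorProduct.map (V.ρ (UqH.gen r .H)) 1 + TensorProduct.map 1 (W.ρ (UqH.gen r .H)) := by
  simp [tensorAction, comul, UqH.lift_gen, UqH.assign, Module.endTensorEndAlgHom_apply,
    TensorProduct.AlgebraTensorModule.map_eq]

/-- The tensor product of weight modules. -/
def tensor (V W : WeightModule r) : WeightModule r where
  carrier := V.carrier ⊗[ℂ] W.carrier
  ρ := tensorAction V W
  exists_weight_basis := by
    obtain ⟨ι, b, w, hb⟩ := V.exists_weight_basis
    obtain ⟨κ, c, u, hc⟩ := W.exists_weight_basis
    refine ⟨ι × κ, b.tensorProduct c, fun p => w p.1 + u p.2, fun p => ⟨?_, ?_⟩⟩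
    · rw [tensorAction_H, Module.Basis.tensorProduct_apply']
      simp [(hb p.1).1, (hc p.2).1, add_smul, TensorProduct.smul_tmul']
    · rw [tensorAction_K, Module.Basis.tensorProduct_apply']
      simp [(hb p.1).2, (hc p.2).2, qpow_add, TensorProduct.smul_tmul', smul_smul, mul_comm]

theorem kinv_pow_central {r : ℕ} (hr : 2 ≤ r) {A : Type*} [Ring A] [Algebra ℂ A] {e f k k' h : A}
    (hR : Relations r e f k k' h) : k' ^ r * e = e * k' ^ r ∧ k' ^ r * f = f * k' ^ r := by
  have h1 := pow_qcommute hR.kinv_e r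
  have h2 := pow_qcommute hR.kinv_f r
  have z : qpow r 2 ^ r = 1 := (qpow_two_primitive hr).pow_eq_one
  rw [qpow_neg, inv_pow, z, inv_one, one_smul] at h1
  rw [z, one_smul] at h2
  exact ⟨h1, h2⟩

/-- The right partial trace of a module endomorphism commutes with the action. -/
theorem partialTraceLin_commute (V W : WeightModule r)
    (f : Module.End ℂ (V.carrier ⊗[ℂ] W.carrier))
    (hc : ∀ x : UqH r, f * tensorAction V W x = tensorAction V W x * f)
    (x : UqH r) : partialTraceLin V W f * V.ρ x = V.ρ x * partialTraceLin V W f := by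
  have R := UqH.relations r
  have hs : r - 1 + 1 = r := by have := hr.out; omega
  have cen := kinv_pow_central hr.out R
  have kkW : W.ρ (UqH.gen r .K) * W.ρ (UqH.gen r .Kinv) = 1 := by
    rw [← map_mul, R.k_kinv, map_one]
  have kkW' : W.ρ (UqH.gen r .Kinv) * W.ρ (UqH.gen r .K) = 1 := by
    rw [← map_mul, R.kinv_k, map_one]
  have comm : ∀ a : UqH r, a * UqH.gen r .Kinv = UqH.gen r .Kinv * a →
      a * UqH.gen r .Kinv ^ (r - 1) = UqH.gen r .Kinv ^ (r - 1) * a := fun a ha =>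
    (Commute.pow_right (show Commute a (UqH.gen r .Kinv) from ha) (r - 1))
  induction x using UqH.induction with
  | hc c => rw [AlgHom.commutes]; exact (Algebra.commutes c _).symm
  | ha x y hx hy => rw [map_add, mul_add, add_mul, hx, hy]
  | hm x y hx hy => rw [map_mul, ← mul_assoc, hx, mul_assoc, hy, mul_assoc]
  | hg g =>
    cases g with
    | E =>
      have h1 := hc (UqH.gen r .E)
      rw [tensorAction_E] at h1
      have h2 := congrArg (fun y => partialTraceLin V W
        (y * TensorProduct.map (1 : Module.End ℂ V.carrier) (W.ρ (UqH.gen r .Kinv)))) h1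
      rw [partialTraceLin_cycle V W (A := W.ρ (UqH.gen r .Kinv)) (A' := W.ρ (UqH.gen r .Kinv))
        (by rw [← map_mul, comm _ rfl, map_mul])
        ((TensorProduct.map 1 (W.ρ (UqH.gen r .E)) +
          TensorProduct.map (V.ρ (UqH.gen r .E)) (W.ρ (UqH.gen r .K))) * f)] at h2
      rw [mul_add, add_mul, ← mul_assoc, mul_add, add_mul, mul_assoc f, mul_assoc f,
        ← TensorProduct.map_mul, ← TensorProduct.map_mul, ← TensorProduct.map_mul,
        ← TensorProduct.map_mul, partialTraceLin_add, partialTraceLin_add, kkW, kkW'] at h2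
      simp only [one_mul, mul_one] at h2
      rw [partialTraceLin_cycle V W (A := W.ρ (UqH.gen r .E) * W.ρ (UqH.gen r .Kinv))
        (A' := W.ρ (UqH.gen r .Kinv) * W.ρ (UqH.gen r .E)), partialTraceLin_mul_left,
        partialTraceLin_mul_right] at h2
      · exact add_left_cancel h2
      · simp only [← map_mul]
        rw [mul_assoc, ← pow_succ', ← mul_assoc, ← pow_succ, hs, cen.1]
    | F =>
      have h1 := hc (UqH.gen r .F)
      have h2 := hc (UqH.gen r .Kinv)
      rw [tensorAction_F, mul_add, add_mul] at h1
      rw [tensorAction_Kinv] at h2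
      have h3 := congrArg (partialTraceLin V W) h1
      rw [partialTraceLin_add, partialTraceLin_add, partialTraceLin_mul_left,
        partialTraceLin_mul_right] at h3
      have h4 : partialTraceLin V W
          (f * TensorProduct.map (V.ρ (UqH.gen r .Kinv)) (W.ρ (UqH.gen r .F))) =
          partialTraceLin V W
          (TensorProduct.map (V.ρ (UqH.gen r .Kinv)) (W.ρ (UqH.gen r .F)) * f) := by
        have e1 : TensorProduct.map (V.ρ (UqH.gen r .Kinv)) (W.ρ (UqH.gen r .F)) =
            TensorProduct.map (V.ρ (UqH.gen r .Kinv)) (W.ρ (UqH.gen r .Kinv)) *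
            TensorProduct.map 1 (W.ρ (UqH.gen r .K) * W.ρ (UqH.gen r .F)) := by
          rw [← TensorProduct.map_mul, ← mul_assoc, kkW', one_mul, mul_one]
        have e2 : TensorProduct.map (V.ρ (UqH.gen r .Kinv)) (W.ρ (UqH.gen r .F)) =
            TensorProduct.map (1 : Module.End ℂ V.carrier)
              (W.ρ (UqH.gen r .F) * W.ρ (UqH.gen r .K)) *
            TensorProduct.map (V.ρ (UqH.gen r .Kinv)) (W.ρ (UqH.gen r .Kinv)) := by
          rw [← TensorProduct.map_mul, mul_assoc, kkW, one_mul, mul_one]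
        rw [e1, ← mul_assoc, h2, partialTraceLin_cycle V W (A' := W.ρ (UqH.gen r .F) *
          W.ρ (UqH.gen r .K)), ← mul_assoc, ← e2, ← e1]
        simp only [← map_mul]
        congr 1
        have e3 : UqH.gen r .F * UqH.gen r .Kinv ^ (r - 1) =
            UqH.gen r .Kinv * (UqH.gen r .Kinv ^ (r - 1) * UqH.gen r .F * UqH.gen r .K) := by
          have e4 : UqH.gen r .Kinv ^ r * UqH.gen r .K = UqH.gen r .Kinv ^ (r - 1) := by
            calc UqH.gen r .Kinv ^ r * UqH.gen r .K
                = UqH.gen r .Kinv ^ (r - 1 + 1) * UqH.gen r .K := by rw [hs]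
              _ = UqH.gen r .Kinv ^ (r - 1) := by rw [pow_succ, mul_assoc, R.kinv_k, mul_one]
          rw [← mul_assoc, ← mul_assoc, ← pow_succ', hs, cen.2, mul_assoc, e4]
        rw [mul_assoc, e3, ← mul_assoc, R.k_kinv, one_mul, mul_assoc]
      rw [h4] at h3
      exact add_left_cancel h3
    | K =>
      have h1 := hc (UqH.gen r .K)
      rw [tensorAction_K] at h1
      have e1 : TensorProduct.map (V.ρ (UqH.gen r .K)) (1 : Module.End ℂ W.carrier) =
          TensorProduct.map (V.ρ (UqH.gen r .K)) (W.ρ (UqH.gen r .K)) *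
          TensorProduct.map 1 (W.ρ (UqH.gen r .Kinv)) := by
        rw [← TensorProduct.map_mul, kkW, mul_one]
      rw [← partialTraceLin_mul_right, e1, ← mul_assoc, h1,
        partialTraceLin_cycle V W (A' := W.ρ (UqH.gen r .Kinv)), ← mul_assoc,
        ← TensorProduct.map_mul, kkW', one_mul, partialTraceLin_mul_left]
      rw [← map_mul, comm _ rfl, map_mul]
    | Kinv =>
      have h1 := hc (UqH.gen r .Kinv)
      rw [tensorAction_Kinv] at h1
      have e1 : TensorProduct.map (V.ρ (UqH.gen r .Kinv)) (1 : Module.End ℂ W.carrier) =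
          TensorProduct.map (V.ρ (UqH.gen r .Kinv)) (W.ρ (UqH.gen r .Kinv)) *
          TensorProduct.map 1 (W.ρ (UqH.gen r .K)) := by
        rw [← TensorProduct.map_mul, kkW', mul_one]
      rw [← partialTraceLin_mul_right, e1, ← mul_assoc, h1,
        partialTraceLin_cycle V W (A' := W.ρ (UqH.gen r .K)), ← mul_assoc,
        ← TensorProduct.map_mul, kkW, one_mul, partialTraceLin_mul_left]
      rw [← map_mul, comm _ (by rw [R.k_kinv, R.kinv_k]), map_mul]
    | H =>
      have h1 := hc (UqH.gen r .H)
      rw [tensorAction_H, mul_add, add_mul] at h1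
      have h2 := congrArg (partialTraceLin V W) h1
      rw [partialTraceLin_add, partialTraceLin_add, partialTraceLin_mul_left,
        partialTraceLin_mul_right, partialTraceLin_cycle V W (A' := W.ρ (UqH.gen r .H))] at h2
      · exact add_right_cancel h2
      · rw [← map_mul, comm _ R.h_kinv, map_mul]

/-- The right partial trace `End (V ⊗ W) → End V`. -/
def partialTrace (V W : WeightModule r) (f : Hom (V.tensor W) (V.tensor W)) : Hom V V :=
  ⟨partialTraceLin V W f.1, fun x v => LinearMap.congr_fun
    (partialTraceLin_commute V W f.1 (fun y => LinearMap.ext fun w => f.2 y w) x) v⟩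

end Tensor

section Construction

variable {ι : Type}

/-- A diagonal operator acts on its eigenvectors through a function of the eigenvalue. -/
theorem mulLeft_eigen {w : ι → ℂ} {g : ℂ → ℂ} {c : ℂ} {v : ι → ℂ}
    (h : LinearMap.mulLeft ℂ w v = c • v) :
    LinearMap.mulLeft ℂ (fun j => g (w j)) v = g c • v := by
  funext j
  have hj := congrFun h j
  simp only [LinearMap.mulLeft_apply, Pi.mul_apply, Pi.smul_apply, smul_eq_mul] at hj ⊢
  by_cases h0 : v j = 0
  · simp [h0]
  · rw [mul_right_cancel₀ h0 hj]

variable [DecidableEq ι]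

theorem mulLeft_single (w : ι → ℂ) (j : ι) :
    LinearMap.mulLeft ℂ w (Pi.single j 1) = w j • Pi.single j (1 : ℂ) := by
  funext k
  by_cases h : k = j
  · subst h; simp
  · simp [h]

theorem end_ext [Finite ι] {A B : Module.End ℂ (ι → ℂ)}
    (h : ∀ j, A (Pi.single j 1) = B (Pi.single j 1)) : A = B :=
  (Pi.basisFun ℂ ι).ext fun j => by simpa using h j

/-- Weight operators with the commutator relation on a basis satisfy all relations that do not
involve powers. -/
theorem relations_of_weights [Finite ι] {r : ℕ} {wt : ι → ℂ} {e f : Module.End ℂ (ι → ℂ)}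
    (he : ∀ j, LinearMap.mulLeft ℂ wt (e (Pi.single j 1)) = (wt j + 2) • e (Pi.single j 1))
    (hf : ∀ j, LinearMap.mulLeft ℂ wt (f (Pi.single j 1)) = (wt j - 2) • f (Pi.single j 1))
    (hef : ∀ j, e (f (Pi.single j 1)) - f (e (Pi.single j 1)) =
      qnum r (wt j) • Pi.single j (1 : ℂ))
    (her : e ^ r = 0) (hfr : f ^ r = 0) :
    Relations r e f (LinearMap.mulLeft ℂ fun j => qpow r (wt j))
      (LinearMap.mulLeft ℂ fun j => qpow r (-wt j)) (LinearMap.mulLeft ℂ wt) where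
  k_kinv := by
    refine end_ext fun j => ?_
    rw [Module.End.mul_apply, mulLeft_single, map_smul, mulLeft_single, smul_smul, ← qpow_add]
    simp [qpow_zero]
  kinv_k := by
    refine end_ext fun j => ?_
    rw [Module.End.mul_apply, mulLeft_single, map_smul, mulLeft_single, smul_smul, ← qpow_add]
    simp [qpow_zero]
  k_e := by
    refine end_ext fun j => ?_
    rw [Module.End.mul_apply, mulLeft_eigen (g := qpow r) (he j), LinearMap.smul_apply,
      Module.End.mul_apply, mulLeft_single, map_smul, smul_smul, ← qpow_add, add_comm]
  k_f := by
    refine end_ext fun j => ?_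
    rw [Module.End.mul_apply, mulLeft_eigen (g := qpow r) (hf j), LinearMap.smul_apply,
      Module.End.mul_apply, mulLeft_single, map_smul, smul_smul, ← qpow_add, add_comm,
      sub_eq_add_neg]
  h_k := by
    refine end_ext fun j => ?_
    rw [Module.End.mul_apply, Module.End.mul_apply, mulLeft_single, mulLeft_single, map_smul,
      map_smul, mulLeft_single, mulLeft_single, smul_comm]
  h_e := by
    refine end_ext fun j => ?_
    rw [LinearMap.sub_apply, Module.End.mul_apply, Module.End.mul_apply, he, mulLeft_single,
      map_smul, ← sub_smul, LinearMap.smul_apply]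
    congr 1; ring
  h_f := by
    refine end_ext fun j => ?_
    rw [LinearMap.sub_apply, Module.End.mul_apply, Module.End.mul_apply, hf, mulLeft_single,
      map_smul, ← sub_smul, LinearMap.smul_apply]
    congr 1; ring
  e_f := by
    refine end_ext fun j => ?_
    rw [LinearMap.sub_apply, Module.End.mul_apply, Module.End.mul_apply, hef, LinearMap.smul_apply,
      LinearMap.sub_apply, mulLeft_single, mulLeft_single, ← sub_smul, smul_smul, qnum]
    congr 1; rw [div_eq_inv_mul]
  e_pow := her
  f_pow := hfr

/-- The weight module on `ι → ℂ` whose standard basis vectors have `H`-weights `wt j`, and on which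
`E`, `F` act by the operators `e`, `f`. -/
def ofWeights [Finite ι] (r : ℕ) (wt : ι → ℂ) (e f : Module.End ℂ (ι → ℂ))
    (he : ∀ j, LinearMap.mulLeft ℂ wt (e (Pi.single j 1)) = (wt j + 2) • e (Pi.single j 1))
    (hf : ∀ j, LinearMap.mulLeft ℂ wt (f (Pi.single j 1)) = (wt j - 2) • f (Pi.single j 1))
    (hef : ∀ j, e (f (Pi.single j 1)) - f (e (Pi.single j 1)) =
      qnum r (wt j) • Pi.single j (1 : ℂ))
    (her : e ^ r = 0) (hfr : f ^ r = 0) : WeightModule r where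
  carrier := ι → ℂ
  ρ := UqH.lift (relations_of_weights he hf hef her hfr)
  exists_weight_basis := by
    refine ⟨ι, Pi.basisFun ℂ ι, wt, fun j => ⟨?_, ?_⟩⟩
    · rw [UqH.lift_gen, Pi.basisFun_apply]; exact mulLeft_single wt j
    · rw [UqH.lift_gen, Pi.basisFun_apply]; exact mulLeft_single _ j

/-- A family of vectors indexed by the natural numbers: basis vectors of `ι → ℂ` for `k < n`, and
zero for `n ≤ k`. -/
def chainVec {n : ℕ} (emb : Fin n → ι) (k : ℕ) : ι → ℂ :=
  if h : k < n then Pi.single (emb ⟨k, h⟩) 1 else 0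

theorem chainVec_coe {n : ℕ} (emb : Fin n → ι) (k : Fin n) :
    chainVec emb k = Pi.single (emb k) 1 := by
  simp [chainVec]

theorem chainVec_of_le {n : ℕ} (emb : Fin n → ι) {k : ℕ} (h : n ≤ k) : chainVec emb k = 0 := by
  rw [chainVec, dif_neg (by omega)]

/-- The linear operator with prescribed values on the standard basis. -/
def opOfBasis [Finite ι] (g : ι → ι → ℂ) : Module.End ℂ (ι → ℂ) := (Pi.basisFun ℂ ι).constr ℂ g

theorem opOfBasis_single [Finite ι] (g : ι → ι → ℂ) (j : ι) : opOfBasis g (Pi.single j 1) = g j := by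
  have := (Pi.basisFun ℂ ι).constr_basis ℂ g j
  rwa [Pi.basisFun_apply] at this

theorem chainVec_of_lt {n : ℕ} (emb : Fin n → ι) {k : ℕ} (h : k < n) :
    chainVec emb k = Pi.single (emb ⟨k, h⟩) 1 := by
  rw [chainVec, dif_pos h]

theorem opOfBasis_chainVec [Finite ι] (g : ι → ι → ℂ) {n : ℕ} (emb : Fin n → ι) {k : ℕ}
    (h : k < n) : opOfBasis g (chainVec emb k) = g (emb ⟨k, h⟩) := by
  rw [chainVec_of_lt emb h, opOfBasis_single]

end Construction

/-- Brackets as Laurent polynomials. -/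
theorem qnum_identity (r : ℕ) (a b c d e f : ℂ)
    (h : (qpow r a - (qpow r a)⁻¹) * (qpow r b - (qpow r b)⁻¹) -
      (qpow r c - (qpow r c)⁻¹) * (qpow r d - (qpow r d)⁻¹) =
      (qpow r e - (qpow r e)⁻¹) * (qpow r f - (qpow r f)⁻¹)) :
    qnum r a * qnum r b - qnum r c * qnum r d = qnum r e * qnum r f := by
  simp only [qnum, qpow_neg]
  rw [div_mul_div_comm, div_mul_div_comm, div_mul_div_comm, ← sub_div, h]

theorem qnum_one {r : ℕ} (hr : 2 ≤ r) : qnum r 1 = 1 := div_self (qpow_one_sub_ne_zero hr)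

theorem qnum_zero (r : ℕ) : qnum r 0 = 0 := by simp [qnum]

theorem qnum_neg (r : ℕ) (a : ℂ) : qnum r (-a) = -qnum r a := by
  simp only [qnum, neg_neg]; rw [← neg_div, neg_sub]

theorem qpow_two (r : ℕ) (a : ℂ) : qpow r (2 * a) = qpow r a ^ 2 := by
  have := qpow_natCast_mul r 2 a
  simpa using this

/-- `[k + 1] [l - k] - [k] [l + 1 - k] = [l - 2 k]`. -/
theorem qnum_chain {r : ℕ} (hr : 2 ≤ r) (k l : ℂ) :
    qnum r (k + 1) * qnum r (l - k) - qnum r k * qnum r (l + 1 - k) = qnum r (l - 2 * k) := by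
  have h := qnum_identity r (k + 1) (l - k) k (l + 1 - k) 1 (l - 2 * k) ?_
  · rw [h, qnum_one hr, one_mul]
  have h1 := qpow_ne_zero r k
  have h2 := qpow_ne_zero r l
  have h3 := qpow_ne_zero r 1
  simp only [qpow_add, qpow_sub, qpow_two]
  field_simp
  ring

/-- The highest weight module of highest weight `l` and dimension `n ≤ r`, with basis
`v_0, …, v_{n-1}` and action `H v_k = (l - 2 k) v_k`, `F v_k = v_{k+1}` (`v_n = 0`),
`E v_k = [k] [l + 1 - k] v_{k-1}`; this is a module if `[n] [l + 1 - n] = 0`. -/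
def highestWeight (r : ℕ) [hr : Fact (2 ≤ r)] (n : ℕ) (hn : n ≤ r) (l : ℂ)
    (h : qnum r n * qnum r (l + 1 - n) = 0) : WeightModule r :=
  ofWeights r (fun k : Fin n => l - 2 * (k : ℕ))
    (opOfBasis fun k => (qnum r (k : ℕ) * qnum r (l + 1 - (k : ℕ))) • chainVec id ((k : ℕ) - 1))
    (opOfBasis fun k => chainVec id ((k : ℕ) + 1))
    (by
      intro ⟨k, hk⟩
      rw [opOfBasis_single]
      rcases k with _ | k
      · simp [qnum_zero]
      · rw [Nat.add_sub_cancel, map_smul, chainVec, dif_pos (by omega), mulLeft_single, smul_comm]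
        congr 1
        simp only [id]; push_cast; ring)
    (by
      intro ⟨k, hk⟩
      rw [opOfBasis_single, chainVec]
      split_ifs
      · rw [mulLeft_single]
        congr 1
        simp only [id]; push_cast; ring
      · simp)
    (by
      intro ⟨k, hk⟩
      rw [opOfBasis_single, opOfBasis_single, map_smul]
      have h1 : (qnum r k * qnum r (l + 1 - k)) • opOfBasis
          (fun k : Fin n => chainVec (ι := Fin n) id ((k : ℕ) + 1)) (chainVec id (k - 1)) =
          (qnum r k * qnum r (l + 1 - k)) • Pi.single (⟨k, hk⟩ : Fin n) (1 : ℂ) := by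
        rcases k with _ | k
        · simp [qnum_zero]
        · rw [Nat.add_sub_cancel, opOfBasis_chainVec _ _ (by omega)]
          simp only [id]
          rw [chainVec_of_lt _ hk]
          rfl
      rw [h1, ← qnum_chain hr.out, sub_smul]
      congr 1
      by_cases hk' : k + 1 < n
      · rw [chainVec, dif_pos hk', opOfBasis_single]
        simp only [Nat.add_sub_cancel, id]
        rw [chainVec, dif_pos hk]
        push_cast
        rw [show l + 1 - ((k : ℂ) + 1) = l - k by ring]
        rfl
      · rw [chainVec, dif_neg hk', map_zero]
        have e : n = k + 1 := by omega
        subst e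
        push_cast at h
        rw [show l + 1 - ((k : ℂ) + 1) = l - k by ring] at h
        rw [h, zero_smul])
    (by
      have key : ∀ m k : ℕ, k < m → ((opOfBasis fun k : Fin n => (qnum r (k : ℕ) *
          qnum r (l + 1 - (k : ℕ))) • chainVec id ((k : ℕ) - 1)) ^ m)
          (chainVec (ι := Fin n) id k) = 0 := by
        intro m
        induction m with
        | zero => intro k hk; omega
        | succ m ih =>
          intro k hk
          by_cases hkn : k < n
          · rw [pow_succ, Module.End.mul_apply]
            rw [opOfBasis_chainVec _ _ hkn, map_smul]
            rcases k with _ | k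
            · simp [qnum_zero]
            · simp only [id, Nat.add_sub_cancel]
              rw [ih k (by omega), smul_zero]
          · rw [chainVec_of_le id (by omega), map_zero]
      refine end_ext fun j => ?_
      rw [show (Pi.single j 1 : Fin n → ℂ) = chainVec id j from (chainVec_coe id j).symm,
        key r j (by omega)]
      rfl)
    (by
      have key : ∀ m k : ℕ, ((opOfBasis fun k : Fin n => chainVec (ι := Fin n) id
          ((k : ℕ) + 1)) ^ m) (chainVec id k) = chainVec id (k + m) := by
        intro m
        induction m with
        | zero => intro k; simp
        | succ m ih =>
          intro k
          by_cases hkn : k < n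
          · rw [pow_succ, Module.End.mul_apply]
            rw [opOfBasis_chainVec _ _ hkn]
            simp only [id]
            rw [ih]; congr 1; ring
          · rw [chainVec_of_le id (by omega), chainVec_of_le id (by omega), map_zero]
      refine end_ext fun j => ?_
      rw [show (Pi.single j 1 : Fin n → ℂ) = chainVec id j from (chainVec_coe id j).symm,
        key, chainVec_of_le id (by omega)]
      rfl)

theorem qnum_self {r : ℕ} (hr : 2 ≤ r) : qnum r r = 0 := by
  rw [qnum, qpow_neg, qpow_self hr]; norm_num

/-- The `r`-dimensional module `V_a` of highest weight `a + r - 1`; here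
`E v_k = [k] [a + r - k] v_{k-1} = [k] [k - a] v_{k-1}`. -/
def typical (r : ℕ) [hr : Fact (2 ≤ r)] (a : ℂ) : WeightModule r :=
  highestWeight r r le_rfl (a + r - 1) (by rw [qnum_self hr.out, zero_mul])

/-- The simple module `S_i` of highest weight `i` and dimension `i + 1`. -/
def simple (r : ℕ) [hr : Fact (2 ≤ r)] (i : ℕ) (hi : i + 1 ≤ r) : WeightModule r :=
  highestWeight r (i + 1) hi i (by push_cast; rw [sub_self, qnum_zero, mul_zero])

theorem qpow_int_mul_self {r : ℕ} (hr : 2 ≤ r) (l : ℤ) : qpow r (l * r) = (-1) ^ l := by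
  have : (r : ℂ) ≠ 0 := by exact_mod_cast (by omega : r ≠ 0)
  rw [qpow, ← Complex.exp_pi_mul_I, ← Complex.exp_int_mul]
  congr 1
  field_simp

theorem qnum_int_mul_self_add {r : ℕ} (hr : 2 ≤ r) (l : ℤ) (a : ℂ) :
    qnum r (l * r + a) = (-1) ^ l * qnum r a := by
  have h : ((-1 : ℂ) ^ l)⁻¹ = (-1) ^ l := by
    rw [← inv_zpow]; norm_num
  rw [qnum, qnum, qpow_neg r (l * r + a), qpow_add, qpow_int_mul_self hr, mul_inv, h, qpow_neg r a]
  ring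

/-- The one-dimensional module `ℂ^H_{l r}` on which `E`, `F` act by zero and `H` by `l r`. -/
def character (r : ℕ) [hr : Fact (2 ≤ r)] (l : ℤ) : WeightModule r :=
  highestWeight r 1 (by have := hr.out; omega) (l * r) (by
    have := qnum_int_mul_self_add hr.out l 0
    rw [qnum_zero, mul_zero, add_zero] at this
    simp [this])

theorem qnum_int_mul_self_add' {r : ℕ} (hr : 2 ≤ r) (l : ℤ) (a : ℂ) :
    qnum r (a + l * r) = (-1) ^ l * qnum r a := by
  rw [add_comm, qnum_int_mul_self_add hr]

theorem pow_e_mul_f {r : ℕ} (hr : 2 ≤ r) {A : Type*} [Ring A] [Algebra ℂ A] {e f k k' : A} {c : ℂ}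
    (hk : k * e = qpow r 2 • (e * k)) (hk' : k' * e = qpow r (-2) • (e * k'))
    (h : e * f - f * e = c • (k - k')) : e ^ r * f = f * e ^ r := by
  have hgeom : ∀ z : ℂ, IsPrimitiveRoot z r → ∑ j ∈ Finset.range r, z ^ j = 0 :=
    fun z hz => hz.geom_sum_eq_zero (by omega)
  have hk2 : ∀ n : ℕ, k * e ^ n = qpow r 2 ^ n • (e ^ n * k) := by
    intro n
    induction n with
    | zero => simp
    | succ n ih => rw [pow_succ, ← mul_assoc, ih, smul_mul_assoc, mul_assoc, hk, mul_smul_comm,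
        smul_smul, ← mul_assoc, pow_succ]
  have hk2' : ∀ n : ℕ, k' * e ^ n = qpow r (-2) ^ n • (e ^ n * k') := by
    intro n
    induction n with
    | zero => simp
    | succ n ih => rw [pow_succ, ← mul_assoc, ih, smul_mul_assoc, mul_assoc, hk', mul_smul_comm,
        smul_smul, ← mul_assoc, pow_succ]
  have key : ∀ n : ℕ, e ^ (n + 1) * f = f * e ^ (n + 1) +
      c • ((∑ j ∈ Finset.range (n + 1), qpow r 2 ^ j) • (e ^ n * k) -
        (∑ j ∈ Finset.range (n + 1), qpow r (-2) ^ j) • (e ^ n * k')) := by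
    have h' : e * f = f * e + c • (k - k') := by rw [← h]; abel
    intro n
    induction n with
    | zero => simp [h']
    | succ n ih =>
      rw [pow_succ', mul_assoc, ih, mul_add, ← mul_assoc, h', add_mul, mul_assoc f, ← pow_succ',
        add_assoc]
      congr 1
      rw [Finset.sum_range_succ _ (n + 1), Finset.sum_range_succ _ (n + 1), mul_smul_comm,
        smul_mul_assoc, ← smul_add, sub_mul, hk2, hk2', mul_sub, mul_smul_comm, mul_smul_comm,
        ← mul_assoc, ← mul_assoc, ← pow_succ', add_smul, add_smul]
      congr 1
      abel
  obtain ⟨n, rfl⟩ : ∃ n, r = n + 1 := ⟨r - 1, by omega⟩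
  have hp := qpow_two_primitive hr
  rw [key n, hgeom _ hp, hgeom _ (by rw [qpow_neg]; exact hp.inv)]
  simp

section Deformable

/-- The index set of the basis of the deformable module: two families of `i + 1` vectors and two
families of `r - 1 - i` vectors. -/
abbrev DefIndex (r i : ℕ) : Type :=
  (Fin (i + 1) ⊕ Fin (i + 1)) ⊕ (Fin (r - 1 - i) ⊕ Fin (r - 1 - i))

/-- The basis vector `w^H_{i - 2 k}`, for `0 ≤ k ≤ i`. -/
def wH (r i k : ℕ) : DefIndex r i → ℂ := chainVec (fun j => Sum.inl (Sum.inl j)) k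

/-- The basis vector `w^S_{i - 2 k}`, for `0 ≤ k ≤ i`. -/
def wS (r i k : ℕ) : DefIndex r i → ℂ := chainVec (fun j => Sum.inl (Sum.inr j)) k

/-- The basis vector `w^L_{-i - 2 - 2 k}`, for `0 ≤ k ≤ r - 2 - i`, and zero for larger `k`. -/
def wL (r i k : ℕ) : DefIndex r i → ℂ := chainVec (fun j => Sum.inr (Sum.inl j)) k

/-- The basis vector `w^R_{i + 2 + 2 k}`, for `0 ≤ k ≤ r - 2 - i`, and zero for larger `k`. -/
def wR (r i k : ℕ) : DefIndex r i → ℂ := chainVec (fun j => Sum.inr (Sum.inr j)) k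

/-- The `H`-weight of a basis vector of `X_ε`: `H w^X_m = (m + l r + ε) w^X_m`. -/
def defWeight (r i : ℕ) (l : ℤ) (ε : ℂ) : DefIndex r i → ℂ
  | .inl (.inl k) => (i - 2 * (k : ℕ)) + l * r + ε
  | .inl (.inr k) => (i - 2 * (k : ℕ)) + l * r + ε
  | .inr (.inl k) => (-i - 2 - 2 * (k : ℕ)) + l * r + ε
  | .inr (.inr k) => (i + 2 + 2 * (k : ℕ)) + l * r + ε

/-- The images of the basis vectors of `X_ε` under `E`. -/
def defE (r i : ℕ) (l : ℤ) (ε : ℂ) : DefIndex r i → DefIndex r i → ℂ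
  | .inl (.inl ⟨0, _⟩) => (-1 : ℂ) ^ l • wR r i 0
  | .inl (.inl ⟨k + 1, _⟩) =>
      ((-1) ^ l * (2 * qnum r (1 + i - (k + 1) + ε) * qnum r (k + 1)
        - qnum r (1 + i - (k + 1)) * qnum r (k + 1 - ε))) • wH r i k
      + (-1 : ℂ) ^ l • wS r i k
  | .inl (.inr ⟨0, _⟩) => (2 * (-1) ^ (l + 1) * qnum r (1 + i) * qnum r ε) • wR r i 0
  | .inl (.inr ⟨k + 1, _⟩) =>
      ((-1) ^ l * (2 * qnum r (1 + i - (k + 1)) * qnum r (k + 1 - ε)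
        - qnum r (1 + i - (k + 1) + ε) * qnum r (k + 1))) • wS r i k
      + (2 * (-1) ^ (l + 1) * qnum r (1 + i) ^ 2 * qnum r ε ^ 2) • wH r i k
  | .inr (.inl ⟨0, _⟩) =>
      (2 * (-1) ^ l * qnum r (i + 1) * qnum r ε) • wH r i i + (-1 : ℂ) ^ l • wS r i i
  | .inr (.inl ⟨k + 1, _⟩) =>
      ((-1) ^ (l + 1) * qnum r (1 + i + (k + 1)) * qnum r (k + 1 - ε)) • wL r i k
  | .inr (.inr k) => (-1 : ℂ) ^ l • wR r i (k + 1)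

/-- The images of the basis vectors of `X_ε` under `F`. -/
def defF (r i : ℕ) (ε : ℂ) : DefIndex r i → DefIndex r i → ℂ
  | .inl (.inl k) => if (k : ℕ) = i then wL r i 0 else wH r i (k + 1)
  | .inl (.inr k) =>
      if (k : ℕ) = i then (-(qnum r (1 + i) * qnum r ε)) • wL r i 0 else wS r i (k + 1)
  | .inr (.inl k) => wL r i (k + 1)
  | .inr (.inr ⟨0, _⟩) => wS r i 0 + (qnum r (1 + i) * qnum r ε) • wH r i 0
  | .inr (.inr ⟨k + 1, _⟩) =>
      (-(qnum r (1 + i + (k + 1)) * qnum r (k + 1 + ε))) • wR r i k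

variable {r i : ℕ} {l : ℤ} {ε : ℂ}

theorem wL_of_le {k : ℕ} (h : r - 1 - i ≤ k) : wL r i k = 0 := chainVec_of_le _ h
theorem wR_of_le {k : ℕ} (h : r - 1 - i ≤ k) : wR r i k = 0 := chainVec_of_le _ h

theorem defE_H_zero : opOfBasis (defE r i l ε) (wH r i 0) = (-1 : ℂ) ^ l • wR r i 0 := by
  rw [wH, opOfBasis_chainVec _ _ (by omega), defE]

theorem defE_H_succ {k : ℕ} (hk : k < i) : opOfBasis (defE r i l ε) (wH r i (k + 1)) =
    ((-1) ^ l * (2 * qnum r (1 + i - (k + 1) + ε) * qnum r (k + 1)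
        - qnum r (1 + i - (k + 1)) * qnum r (k + 1 - ε))) • wH r i k
      + (-1 : ℂ) ^ l • wS r i k := by
  rw [wH, opOfBasis_chainVec _ _ (by omega), defE]

theorem defE_S_zero : opOfBasis (defE r i l ε) (wS r i 0) =
    (2 * (-1) ^ (l + 1) * qnum r (1 + i) * qnum r ε) • wR r i 0 := by
  rw [wS, opOfBasis_chainVec _ _ (by omega), defE]

theorem defE_S_succ {k : ℕ} (hk : k < i) : opOfBasis (defE r i l ε) (wS r i (k + 1)) =
    ((-1) ^ l * (2 * qnum r (1 + i - (k + 1)) * qnum r (k + 1 - ε)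
        - qnum r (1 + i - (k + 1) + ε) * qnum r (k + 1))) • wS r i k
      + (2 * (-1) ^ (l + 1) * qnum r (1 + i) ^ 2 * qnum r ε ^ 2) • wH r i k := by
  rw [wS, opOfBasis_chainVec _ _ (by omega), defE]

theorem defE_L_zero (hi : i + 2 ≤ r) : opOfBasis (defE r i l ε) (wL r i 0) =
    (2 * (-1) ^ l * qnum r (i + 1) * qnum r ε) • wH r i i + (-1 : ℂ) ^ l • wS r i i := by
  rw [wL, opOfBasis_chainVec _ _ (by omega), defE]

theorem defE_L_succ {k : ℕ} (hk : k + 1 < r - 1 - i) : opOfBasis (defE r i l ε) (wL r i (k + 1)) =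
    ((-1) ^ (l + 1) * qnum r (1 + i + (k + 1)) * qnum r (k + 1 - ε)) • wL r i k := by
  rw [wL, opOfBasis_chainVec _ _ (by omega), defE]

theorem defE_R (k : ℕ) : opOfBasis (defE r i l ε) (wR r i k) =
    (-1 : ℂ) ^ l • wR r i (k + 1) := by
  by_cases h : k < r - 1 - i
  · nth_rewrite 1 [wR]
    rw [opOfBasis_chainVec _ _ h, defE]
  · rw [wR_of_le (by omega), wR_of_le (by omega), map_zero, smul_zero]

theorem defF_H {k : ℕ} (hk : k < i) : opOfBasis (defF r i ε) (wH r i k) = wH r i (k + 1) := by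
  nth_rewrite 1 [wH]
  rw [opOfBasis_chainVec _ _ (by omega), defF, if_neg (by simp; omega)]

theorem defF_H_last : opOfBasis (defF r i ε) (wH r i i) = wL r i 0 := by
  nth_rewrite 1 [wH]
  rw [opOfBasis_chainVec _ _ (by omega), defF, if_pos rfl]

theorem defF_S {k : ℕ} (hk : k < i) : opOfBasis (defF r i ε) (wS r i k) = wS r i (k + 1) := by
  nth_rewrite 1 [wS]
  rw [opOfBasis_chainVec _ _ (by omega), defF, if_neg (by simp; omega)]

theorem defF_S_last : opOfBasis (defF r i ε) (wS r i i) =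
    (-(qnum r (1 + i) * qnum r ε)) • wL r i 0 := by
  nth_rewrite 1 [wS]
  rw [opOfBasis_chainVec _ _ (by omega), defF, if_pos rfl]

theorem defF_L (k : ℕ) : opOfBasis (defF r i ε) (wL r i k) = wL r i (k + 1) := by
  by_cases h : k < r - 1 - i
  · nth_rewrite 1 [wL]
    rw [opOfBasis_chainVec _ _ h, defF]
  · rw [wL_of_le (by omega), wL_of_le (by omega), map_zero]

theorem defF_R_zero (hi : i + 2 ≤ r) : opOfBasis (defF r i ε) (wR r i 0) =
    wS r i 0 + (qnum r (1 + i) * qnum r ε) • wH r i 0 := by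
  rw [wR, opOfBasis_chainVec _ _ (by omega), defF]

theorem defF_R_succ {k : ℕ} (hk : k + 1 < r - 1 - i) : opOfBasis (defF r i ε) (wR r i (k + 1)) =
    (-(qnum r (1 + i + (k + 1)) * qnum r (k + 1 + ε))) • wR r i k := by
  rw [wR, opOfBasis_chainVec _ _ (by omega), defF]

/-- A property of all basis vectors. -/
theorem def_cases {p : (DefIndex r i → ℂ) → ℂ → Prop}
    (hH : ∀ k, k ≤ i → p (wH r i k) ((i - 2 * k) + l * r + ε))
    (hS : ∀ k, k ≤ i → p (wS r i k) ((i - 2 * k) + l * r + ε))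
    (hL : ∀ k, k < r - 1 - i → p (wL r i k) ((-i - 2 - 2 * k) + l * r + ε))
    (hR : ∀ k, k < r - 1 - i → p (wR r i k) ((i + 2 + 2 * k) + l * r + ε)) (j : DefIndex r i) :
    p (Pi.single j 1) (defWeight r i l ε j) := by
  rcases j with (k | k) | (k | k)
  · have := hH k (by omega)
    rwa [wH, chainVec_coe] at this
  · have := hS k (by omega)
    rwa [wS, chainVec_coe] at this
  · have := hL k (by omega)
    rwa [wL, chainVec_coe] at this
  · have := hR k (by omega)
    rwa [wR, chainVec_coe] at this

theorem weight_H (k : ℕ) : LinearMap.mulLeft ℂ (defWeight r i l ε) (wH r i k) =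
    ((i - 2 * k) + l * r + ε : ℂ) • wH r i k := by
  rw [wH]
  by_cases h : k < i + 1
  · rw [chainVec_of_lt _ h, mulLeft_single]; rfl
  · rw [chainVec_of_le _ (by omega)]; simp

theorem weight_S (k : ℕ) : LinearMap.mulLeft ℂ (defWeight r i l ε) (wS r i k) =
    ((i - 2 * k) + l * r + ε : ℂ) • wS r i k := by
  rw [wS]
  by_cases h : k < i + 1
  · rw [chainVec_of_lt _ h, mulLeft_single]; rfl
  · rw [chainVec_of_le _ (by omega)]; simp

theorem weight_L (k : ℕ) : LinearMap.mulLeft ℂ (defWeight r i l ε) (wL r i k) =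
    ((-i - 2 - 2 * k) + l * r + ε : ℂ) • wL r i k := by
  rw [wL]
  by_cases h : k < r - 1 - i
  · rw [chainVec_of_lt _ h, mulLeft_single]; rfl
  · rw [chainVec_of_le _ (by omega)]; simp

theorem weight_R (k : ℕ) : LinearMap.mulLeft ℂ (defWeight r i l ε) (wR r i k) =
    ((i + 2 + 2 * k) + l * r + ε : ℂ) • wR r i k := by
  rw [wR]
  by_cases h : k < r - 1 - i
  · rw [chainVec_of_lt _ h, mulLeft_single]; rfl
  · rw [chainVec_of_le _ (by omega)]; simp

theorem defE_weight (hi : i + 2 ≤ r) (j : DefIndex r i) :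
    LinearMap.mulLeft ℂ (defWeight r i l ε) (opOfBasis (defE r i l ε) (Pi.single j 1)) =
      (defWeight r i l ε j + 2) • opOfBasis (defE r i l ε) (Pi.single j 1) := by
  refine def_cases (p := fun v m => LinearMap.mulLeft ℂ (defWeight r i l ε)
    (opOfBasis (defE r i l ε) v) = (m + 2) • opOfBasis (defE r i l ε) v) ?_ ?_ ?_ ?_ j
  · rintro (_ | k) hk
    · rw [defE_H_zero, map_smul, weight_R]
      push_cast; module
    · rw [defE_H_succ (by omega), map_add, map_smul, map_smul, weight_H, weight_S]
      push_cast; module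
  · rintro (_ | k) hk
    · rw [defE_S_zero, map_smul, weight_R]
      push_cast; module
    · rw [defE_S_succ (by omega), map_add, map_smul, map_smul, weight_H, weight_S]
      push_cast; module
  · rintro (_ | k) hk
    · rw [defE_L_zero hi, map_add, map_smul, map_smul, weight_H, weight_S]
      push_cast; module
    · rw [defE_L_succ hk, map_smul, weight_L]
      push_cast; module
  · intro k hk
    rw [defE_R, map_smul, weight_R]
    push_cast; module

theorem defF_weight (hi : i + 2 ≤ r) (j : DefIndex r i) :
    LinearMap.mulLeft ℂ (defWeight r i l ε) (opOfBasis (defF r i ε) (Pi.single j 1)) =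
      (defWeight r i l ε j - 2) • opOfBasis (defF r i ε) (Pi.single j 1) := by
  refine def_cases (p := fun v m => LinearMap.mulLeft ℂ (defWeight r i l ε)
    (opOfBasis (defF r i ε) v) = (m - 2) • opOfBasis (defF r i ε) v) ?_ ?_ ?_ ?_ j
  · intro k hk
    rcases hk.lt_or_eq with h | rfl
    · rw [defF_H h, weight_H]
      push_cast; module
    · rw [defF_H_last, weight_L]
      push_cast; module
  · intro k hk
    rcases hk.lt_or_eq with h | rfl
    · rw [defF_S h, weight_S]
      push_cast; module
    · rw [defF_S_last, map_smul, weight_L]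
      push_cast; module
  · intro k hk
    rw [defF_L, weight_L]
    push_cast; module
  · rintro (_ | k) hk
    · rw [defF_R_zero hi, map_add, map_smul, weight_S, weight_H]
      push_cast; module
    · rw [defF_R_succ hk, map_smul, weight_R]
      push_cast; module

/-- `[1 + i - k + ε] [k] - [1 + i - k] [k - ε] = [1 + i] [ε]`. -/
theorem qnum_split (r : ℕ) (a k ε : ℂ) :
    qnum r (a - k + ε) * qnum r k - qnum r (a - k) * qnum r (k - ε) = qnum r a * qnum r ε := by
  apply qnum_identity
  have h1 := qpow_ne_zero r k
  have h2 := qpow_ne_zero r a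
  have h3 := qpow_ne_zero r ε
  simp only [qpow_add, qpow_sub]
  field_simp
  ring

theorem neg_one_zpow_mul_self (l : ℤ) : (-1 : ℂ) ^ l * (-1) ^ l = 1 := by
  rw [← mul_zpow]; norm_num

theorem neg_one_zpow_succ (l : ℤ) : (-1 : ℂ) ^ (l + 1) = -(-1) ^ l := by
  rw [zpow_add₀ (by norm_num)]; simp

theorem def_FE_H (hi : i + 2 ≤ r) {k : ℕ} (hk : k ≤ i) :
    opOfBasis (defF r i ε) (opOfBasis (defE r i l ε) (wH r i k)) =
      ((-1) ^ l * (qnum r (1 + i - k + ε) * qnum r k + qnum r (1 + i) * qnum r ε)) • wH r i k +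
        (-1 : ℂ) ^ l • wS r i k := by
  rcases k with _ | k
  · rw [defE_H_zero, map_smul, defF_R_zero hi, Nat.cast_zero, qnum_zero]
    module
  · rw [defE_H_succ (by omega), map_add, map_smul, map_smul, defF_H (by omega), defF_S (by omega),
      ← qnum_split r (1 + i) (k + 1) ε]
    push_cast
    module

theorem def_EF_H (hi : i + 2 ≤ r) {k : ℕ} (hk : k ≤ i) :
    opOfBasis (defE r i l ε) (opOfBasis (defF r i ε) (wH r i k)) =
      ((-1) ^ l * (qnum r (i - k + ε) * qnum r (k + 1) + qnum r (1 + i) * qnum r ε)) • wH r i k +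
        (-1 : ℂ) ^ l • wS r i k := by
  rcases hk.lt_or_eq with h | rfl
  · rw [defF_H h, defE_H_succ h, ← qnum_split r (1 + i) (k + 1) ε,
      show (1 + i - (k + 1) : ℂ) = i - k by ring]
    module
  · rw [defF_H_last, defE_L_zero hi, sub_self, zero_add, add_comm (1 : ℂ)]
    module

theorem def_FE_S (hi : i + 2 ≤ r) {k : ℕ} (hk : k ≤ i) :
    opOfBasis (defF r i ε) (opOfBasis (defE r i l ε) (wS r i k)) =
      ((-1) ^ l * (qnum r (1 + i - k) * qnum r (k - ε) - qnum r (1 + i) * qnum r ε)) • wS r i k +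
        (2 * (-1) ^ (l + 1) * qnum r (1 + i) ^ 2 * qnum r ε ^ 2) • wH r i k := by
  rcases k with _ | k
  · rw [defE_S_zero, map_smul, defF_R_zero hi, Nat.cast_zero, zero_sub, qnum_neg, sub_zero,
      neg_one_zpow_succ]
    module
  · rw [defE_S_succ (by omega), map_add, map_smul, map_smul, defF_H (by omega), defF_S (by omega)]
    congr 2
    push_cast
    linear_combination -(-1) ^ l * qnum_split r (1 + i) (k + 1) ε

theorem def_EF_S (hi : i + 2 ≤ r) {k : ℕ} (hk : k ≤ i) :
    opOfBasis (defE r i l ε) (opOfBasis (defF r i ε) (wS r i k)) =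
      ((-1) ^ l * (qnum r (i - k) * qnum r (k + 1 - ε) - qnum r (1 + i) * qnum r ε)) • wS r i k +
        (2 * (-1) ^ (l + 1) * qnum r (1 + i) ^ 2 * qnum r ε ^ 2) • wH r i k := by
  rcases hk.lt_or_eq with h | rfl
  · rw [defF_S h, defE_S_succ h]
    congr 2
    have := qnum_split r (1 + i) (k + 1) ε
    rw [show (1 + i - (k + 1) : ℂ) = i - k by ring] at this ⊢
    linear_combination -(-1) ^ l * this
  · rw [defF_S_last, map_smul, defE_L_zero hi, sub_self, qnum_zero, neg_one_zpow_succ,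
      add_comm (1 : ℂ)]
    module

theorem qnum_top (hr : 2 ≤ r) {k : ℕ} (h : k < r - 1 - i) (h' : ¬ k + 1 < r - 1 - i) :
    qnum r (1 + i + (k + 1)) = 0 := by
  have e : (1 + i + (k + 1) : ℂ) = r := by
    exact_mod_cast (by omega : 1 + i + (k + 1) = r)
  rw [e, qnum_self hr]

theorem def_FE_L (hi : i + 2 ≤ r) {k : ℕ} (hk : k < r - 1 - i) :
    opOfBasis (defF r i ε) (opOfBasis (defE r i l ε) (wL r i k)) =
      (-(-1) ^ l * (qnum r (1 + i + k) * qnum r (k - ε))) • wL r i k := by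
  rcases k with _ | k
  · rw [defE_L_zero hi, map_add, map_smul, map_smul, defF_H_last, defF_S_last, Nat.cast_zero,
      zero_sub, qnum_neg, add_zero, add_comm (1 : ℂ)]
    module
  · rw [defE_L_succ hk, map_smul, defF_L, neg_one_zpow_succ]
    push_cast
    module

theorem def_EF_L (hr : 2 ≤ r) {k : ℕ} (hk : k < r - 1 - i) :
    opOfBasis (defE r i l ε) (opOfBasis (defF r i ε) (wL r i k)) =
      (-(-1) ^ l * (qnum r (1 + i + (k + 1)) * qnum r (k + 1 - ε))) • wL r i k := by
  rw [defF_L]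
  by_cases h : k + 1 < r - 1 - i
  · rw [defE_L_succ h, neg_one_zpow_succ]
    module
  · rw [wL_of_le (by omega), qnum_top hr hk h, map_zero]
    simp

theorem def_FE_R (hr : 2 ≤ r) {k : ℕ} (hk : k < r - 1 - i) :
    opOfBasis (defF r i ε) (opOfBasis (defE r i l ε) (wR r i k)) =
      (-(-1) ^ l * (qnum r (1 + i + (k + 1)) * qnum r (k + 1 + ε))) • wR r i k := by
  rw [defE_R]
  by_cases h : k + 1 < r - 1 - i
  · rw [map_smul, defF_R_succ h]
    module
  · rw [wR_of_le (by omega : r - 1 - i ≤ k + 1), qnum_top hr hk h, smul_zero, map_zero]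
    simp

theorem def_EF_R (hi : i + 2 ≤ r) {k : ℕ} (hk : k < r - 1 - i) :
    opOfBasis (defE r i l ε) (opOfBasis (defF r i ε) (wR r i k)) =
      (-(-1) ^ l * (qnum r (1 + i + k) * qnum r (k + ε))) • wR r i k := by
  rcases k with _ | k
  · rw [defF_R_zero hi, map_add, map_smul, defE_S_zero, defE_H_zero, neg_one_zpow_succ,
      Nat.cast_zero, zero_add, add_zero]
    module
  · rw [defF_R_succ hk, map_smul, defE_R]
    push_cast
    module

/-- `[x + 1] [y + 1] - [x] [y] = [x + y + 1]`. -/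
theorem qnum_shift {r : ℕ} (hr : 2 ≤ r) (x y : ℂ) :
    qnum r (x + 1) * qnum r (y + 1) - qnum r x * qnum r y = qnum r (x + y + 1) := by
  have h := qnum_identity r (x + 1) (y + 1) x y 1 (x + y + 1) ?_
  · rw [h, qnum_one hr, one_mul]
  have h1 := qpow_ne_zero r x
  have h2 := qpow_ne_zero r y
  have h3 := qpow_ne_zero r 1
  simp only [qpow_add]
  field_simp
  ring

theorem def_commutator (hr : 2 ≤ r) (hi : i + 2 ≤ r) (j : DefIndex r i) :
    opOfBasis (defE r i l ε) (opOfBasis (defF r i ε) (Pi.single j 1)) -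
      opOfBasis (defF r i ε) (opOfBasis (defE r i l ε) (Pi.single j 1)) =
      qnum r (defWeight r i l ε j) • Pi.single j (1 : ℂ) := by
  refine def_cases (p := fun v m => opOfBasis (defE r i l ε) (opOfBasis (defF r i ε) v) -
      opOfBasis (defF r i ε) (opOfBasis (defE r i l ε) v) = qnum r m • v) ?_ ?_ ?_ ?_ j
  · intro k hk
    have h := qnum_chain hr k (i + ε)
    rw [def_EF_H hi hk, def_FE_H hi hk,
      show ((i - 2 * k) + l * r + ε : ℂ) = l * r + (i + ε - 2 * k) by ring,
      qnum_int_mul_self_add hr, ← h, show (i + ε - k : ℂ) = i - k + ε by ring,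
      show (i + ε + 1 - k : ℂ) = 1 + i - k + ε by ring]
    module
  · intro k hk
    have h := qnum_chain hr k (i + ε)
    have h1 := qnum_split r (1 + i) k ε
    have h2 := qnum_split r (1 + i) (k + 1) ε
    rw [show (1 + i - (k + 1) : ℂ) = i - k by ring] at h2
    rw [def_EF_S hi hk, def_FE_S hi hk,
      show ((i - 2 * k) + l * r + ε : ℂ) = l * r + (i + ε - 2 * k) by ring,
      qnum_int_mul_self_add hr, ← h, show (i + ε - k : ℂ) = i - k + ε by ring,
      show (i + ε + 1 - k : ℂ) = 1 + i - k + ε by ring, add_sub_add_right_eq_sub, ← sub_smul]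
    congr 1
    linear_combination (-1) ^ l * h1 - (-1) ^ l * h2
  · intro k hk
    have h := qnum_shift hr (1 + i + k) (k - ε)
    rw [def_EF_L hr hk, def_FE_L hi hk,
      show ((-i - 2 - 2 * k) + l * r + ε : ℂ) = l * r + -(1 + i + k + (k - ε) + 1) by ring,
      qnum_int_mul_self_add hr, qnum_neg, ← h, show (1 + i + k + 1 : ℂ) = 1 + i + (k + 1) by ring,
      show (k - ε + 1 : ℂ) = k + 1 - ε by ring]
    module
  · intro k hk
    have h := qnum_shift hr (1 + i + k) (k + ε)
    rw [def_EF_R hi hk, def_FE_R hr hk,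
      show ((i + 2 + 2 * k) + l * r + ε : ℂ) = l * r + (1 + i + k + (k + ε) + 1) by ring,
      qnum_int_mul_self_add hr, ← h, show (1 + i + k + 1 : ℂ) = 1 + i + (k + 1) by ring,
      show (k + ε + 1 : ℂ) = k + 1 + ε by ring]
    module

theorem defF_pow_L (n k : ℕ) : (opOfBasis (defF r i ε) ^ n) (wL r i k) = wL r i (k + n) := by
  induction n generalizing k with
  | zero => simp
  | succ n ih => rw [pow_succ, Module.End.mul_apply, defF_L, ih]; congr 1; ring

/-- If `x ^ m` kills a vector then so do the larger powers. -/
theorem pow_apply_eq_zero {M : Type*} [AddCommGroup M] [Module ℂ M] {x : Module.End ℂ M} {v : M}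
    {m n : ℕ} (h : (x ^ m) v = 0) (hmn : m ≤ n) : (x ^ n) v = 0 := by
  rw [← Nat.sub_add_cancel hmn, pow_add, Module.End.mul_apply, h, map_zero]

theorem defF_pow_H {n k : ℕ} (h : k + n = i) :
    (opOfBasis (defF r i ε) ^ (n + 1 + (r - 1 - i))) (wH r i k) = 0 := by
  induction n generalizing k with
  | zero =>
    obtain rfl : k = i := by omega
    rw [show 0 + 1 + (r - 1 - k) = (r - 1 - k) + 1 by ring, pow_succ, Module.End.mul_apply,
      defF_H_last, defF_pow_L, wL_of_le (by omega)]
  | succ n ih =>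
    rw [show n + 1 + 1 + (r - 1 - i) = n + 1 + (r - 1 - i) + 1 by ring, pow_succ,
      Module.End.mul_apply, defF_H (by omega), ih (by omega)]

theorem defF_pow_S_add {n k : ℕ} (h : k + n = i) : (opOfBasis (defF r i ε) ^ (n + 1))
    (wS r i k + (qnum r (1 + i) * qnum r ε) • wH r i k) = 0 := by
  induction n generalizing k with
  | zero =>
    obtain rfl : k = i := by omega
    rw [zero_add, pow_one, map_add, map_smul, defF_S_last, defF_H_last]
    module
  | succ n ih =>
    rw [pow_succ, Module.End.mul_apply, map_add, map_smul, defF_S (by omega), defF_H (by omega),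
      ih (by omega)]

theorem defF_pow_R (hi : i + 2 ≤ r) {k : ℕ} (h : k < r - 1 - i) :
    (opOfBasis (defF r i ε) ^ (k + 1 + (i + 1))) (wR r i k) = 0 := by
  induction k with
  | zero =>
    rw [show 0 + 1 + (i + 1) = i + 1 + 1 by ring, pow_succ, Module.End.mul_apply, defF_R_zero hi,
      defF_pow_S_add (by omega)]
  | succ k ih =>
    rw [show k + 1 + 1 + (i + 1) = k + 1 + (i + 1) + 1 by ring, pow_succ, Module.End.mul_apply,
      defF_R_succ h, map_smul, ih (by omega), smul_zero]

theorem defF_pow (hi : i + 2 ≤ r) : opOfBasis (defF r i ε) ^ r = 0 := by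
  have hH : ∀ k, k ≤ i → (opOfBasis (defF r i ε) ^ r) (wH r i k) = 0 := fun k hk =>
    pow_apply_eq_zero (defF_pow_H (r := r) (ε := ε) (n := i - k) (k := k) (by omega)) (by omega)
  refine end_ext (def_cases (l := 0) (ε := ε) (p := fun v _ => (opOfBasis (defF r i ε) ^ r) v =
    (0 : Module.End ℂ (DefIndex r i → ℂ)) v) ?_ ?_ ?_ ?_)
  · intro k hk
    exact hH k hk
  · intro k hk
    have h1 := pow_apply_eq_zero (defF_pow_S_add (r := r) (i := i) (ε := ε) (n := i - k) (k := k)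
      (by omega)) (by omega : i - k + 1 ≤ r)
    rw [map_add, map_smul, hH k hk, smul_zero, add_zero] at h1
    exact h1
  · intro k hk
    rw [defF_pow_L, wL_of_le (by omega)]; rfl
  · intro k hk
    exact pow_apply_eq_zero (defF_pow_R hi hk) (by omega)

theorem defE_pow_R {n k : ℕ} (h : r - 1 - i ≤ k + n) :
    (opOfBasis (defE r i l ε) ^ n) (wR r i k) = 0 := by
  induction n generalizing k with
  | zero => rw [wR_of_le (by omega), map_zero]
  | succ n ih =>
    rw [pow_succ, Module.End.mul_apply, defE_R, map_smul, ih (by omega), smul_zero]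

theorem defE_pow (hr : 2 ≤ r) (hi : i + 2 ≤ r)
    (hc : opOfBasis (defE r i l ε) ^ r * opOfBasis (defF r i ε) =
      opOfBasis (defF r i ε) * opOfBasis (defE r i l ε) ^ r) :
    opOfBasis (defE r i l ε) ^ r = 0 := by
  have hF : ∀ v, (opOfBasis (defE r i l ε) ^ r) v = 0 →
      (opOfBasis (defE r i l ε) ^ r) (opOfBasis (defF r i ε) v) = 0 := by
    intro v hv
    rw [← Module.End.mul_apply, hc, Module.End.mul_apply, hv, map_zero]
  have hR : ∀ k, (opOfBasis (defE r i l ε) ^ r) (wR r i k) = 0 := fun k =>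
    defE_pow_R (by omega)
  have hH : ∀ k, k ≤ i → (opOfBasis (defE r i l ε) ^ r) (wH r i k) = 0 := by
    intro k
    induction k with
    | zero =>
      intro _
      have h1 : (opOfBasis (defE r i l ε) ^ (r - 1 + 1)) (wH r i 0) = 0 := by
        rw [pow_succ, Module.End.mul_apply, defE_H_zero, map_smul, defE_pow_R (by omega),
          smul_zero]
      rwa [Nat.sub_add_cancel (by omega)] at h1
    | succ k ih =>
      intro hk
      have := hF _ (ih (by omega))
      rwa [defF_H (by omega)] at this
  have hS : ∀ k, k ≤ i → (opOfBasis (defE r i l ε) ^ r) (wS r i k) = 0 := by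
    intro k
    induction k with
    | zero =>
      intro _
      have h1 := hF _ (hR 0)
      rwa [defF_R_zero hi, map_add, map_smul, hH 0 (by omega), smul_zero, add_zero] at h1
    | succ k ih =>
      intro hk
      have := hF _ (ih (by omega))
      rwa [defF_S (by omega)] at this
  have hL : ∀ k, (opOfBasis (defE r i l ε) ^ r) (wL r i k) = 0 := by
    intro k
    induction k with
    | zero =>
      have := hF _ (hH i le_rfl)
      rwa [defF_H_last] at this
    | succ k ih =>
      have := hF _ ih
      rwa [defF_L] at this
  exact end_ext (def_cases (l := 0) (ε := ε) (p := fun v _ => (opOfBasis (defE r i l ε) ^ r) v =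
    (0 : Module.End ℂ (DefIndex r i → ℂ)) v) hH hS (fun k _ => hL k) (fun k _ => hR k))

theorem defE_pow_comm (hr : 2 ≤ r) (hi : i + 2 ≤ r) :
    opOfBasis (defE r i l ε) ^ r * opOfBasis (defF r i ε) =
      opOfBasis (defF r i ε) * opOfBasis (defE r i l ε) ^ r := by
  refine pow_e_mul_f hr (k := LinearMap.mulLeft ℂ fun j => qpow r (defWeight r i l ε j))
    (k' := LinearMap.mulLeft ℂ fun j => qpow r (-defWeight r i l ε j))
    (c := (qpow r 1 - qpow r (-1))⁻¹) ?_ ?_ ?_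
  · refine end_ext fun j => ?_
    rw [Module.End.mul_apply, mulLeft_eigen (g := qpow r) (defE_weight hi j), LinearMap.smul_apply,
      Module.End.mul_apply, mulLeft_single, map_smul, smul_smul, ← qpow_add, add_comm]
  · refine end_ext fun j => ?_
    rw [Module.End.mul_apply, mulLeft_eigen (g := fun x => qpow r (-x)) (defE_weight hi j),
      LinearMap.smul_apply, Module.End.mul_apply, mulLeft_single, map_smul, smul_smul, ← qpow_add]
    congr 2; ring
  · refine end_ext fun j => ?_
    rw [LinearMap.sub_apply, Module.End.mul_apply, Module.End.mul_apply, def_commutator hr hi,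
      LinearMap.smul_apply, LinearMap.sub_apply, mulLeft_single, mulLeft_single, ← sub_smul,
      smul_smul, qnum]
    congr 1; rw [div_eq_inv_mul]

/-- The deformable family `X_ε`: the module with basis
`w^H_{i-2k}`, `w^S_{i-2k}` (`0 ≤ k ≤ i`), `w^L_{-i-2-2k}`, `w^R_{i+2+2k}` (`0 ≤ k ≤ r-2-i`),
on which `E`, `F` act by `defE`, `defF`, and `H w^X_m = (m + l r + ε) w^X_m`. -/
def deformed (r : ℕ) [hr : Fact (2 ≤ r)] (i : ℕ) (hi : i + 2 ≤ r) (l : ℤ) (ε : ℂ) :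
    WeightModule r :=
  ofWeights r (defWeight r i l ε) (opOfBasis (defE r i l ε)) (opOfBasis (defF r i ε))
    (defE_weight hi) (defF_weight hi) (def_commutator hr.out hi)
    (defE_pow hr.out hi (defE_pow_comm hr.out hi)) (defF_pow hi)

end Deformable

/-- The indecomposable projective module `P_i`: its basis vectors `w^H`, `w^S`, `w^L`, `w^R` are as
for the deformable family, with `H w^X_m = m w^X_m`, and for `ε = 0`, `l = 0` the action becomes
`E w^H_{i-2k} = [k] [1+i-k] w^H_{i-2(k-1)} + w^S_{i-2(k-1)}`,
`E w^S_{i-2k} = [k] [1+i-k] w^S_{i-2(k-1)}`, `E w^H_i = w^R_{i+2}`, `E w^S_i = 0`,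
`E w^R_m = w^R_{m+2}`, `E w^L_{-i-2} = w^S_{-i}`,
`E w^L_{-i-2-2k} = -[1+i+k] [k] w^L_{-i-2-2(k-1)}`, `F w^X_m = w^X_{m-2}` for `X = H, S, L` inside
each family, `F w^H_{-i} = w^L_{-i-2}`, `F w^S_{-i} = 0`, `F w^R_{i+2} = w^S_i`,
`F w^R_{i+2+2k} = -[1+i+k] [k] w^R_{i+2+2(k-1)}`. It is the projective cover of `S_i`. -/
def projP (r : ℕ) [Fact (2 ≤ r)] (i : ℕ) (hi : i + 2 ≤ r) : WeightModule r :=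
  deformed r i hi 0 0

section ModifiedTrace

variable (r : ℕ) [Fact (2 ≤ r)]

/-- A family of linear forms `t_V : End V → ℂ`, one for each projective weight module `V`. -/
abbrev TraceFamily : Type 1 :=
  ∀ V : WeightModule r, IsProjective V → (Hom V V →ₗ[ℂ] ℂ)

/-- A (right) trace on the ideal of projective objects: it is cyclic and compatible with right
partial traces. -/
structure IsModifiedTrace (t : TraceFamily r) : Prop where
  cyclic : ∀ (U V : WeightModule r) (hU : IsProjective U) (hV : IsProjective V)
    (f : Hom U V) (g : Hom V U), t U hU (compHom g f) = t V hV (compHom f g)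
  partial_trace : ∀ (U W : WeightModule r) (hU : IsProjective U)
    (hUW : IsProjective (U.tensor W)) (f : Hom (U.tensor W) (U.tensor W)),
    t (U.tensor W) hUW f = t U hU (partialTrace U W f)

/-- A modified trace normalized by `t_{V_0}(c • id) = (-1) ^ (r - 1) c`. -/
def IsNormalizedModifiedTrace (t : TraceFamily r) : Prop :=
  IsModifiedTrace r t ∧ ∃ h : IsProjective (typical r 0),
    ∀ c : ℂ, t (typical r 0) h (c • idHom (typical r 0)) = (-1) ^ (r - 1) * c

variable {r}

open Classical in
/-- The modified dimension `d(V) = t_V(id_V)` of a projective weight module, where `t` is the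
normalized modified trace (with value `0` for modules that are not projective). -/
def modifiedDim (V : WeightModule r) : ℂ :=
  if h : IsProjective V ∧ ∃ t, IsNormalizedModifiedTrace r t then
    h.2.choose V h.1 (idHom V) else 0

end ModifiedTrace

end WeightModule

end Unrolled

end

/-!
# Modified dimensions of the deformable projective modules

The argument rests on an averaging operator. The adjoint action makes `Hom_ℂ(U, V)` a module over
the unrolled quantum group, and a vector of weight zero becomes invariant under `F ^ (r-1) E ^ (r-1)`
(`average_mem_hom`). So `average U V` turns weight preserving linear maps into homomorphisms, as the
sum over a finite group does, and it is compatible with composition and with tensor products. Hence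
a module whose identity is an average is projective, and so are its tensor products
(`IsAveraged.isProjective`, `IsAveraged.tensor`). The identity of `V₀` is an average
(`isAveraged_steinberg`), every module is a quotient of some `(V₀ ⊗ V₀) ⊗ V`, and therefore the
projective modules are exactly those whose identity is an average (`isProjective_iff_isAveraged`).

For the form `qtrace A = tr (K ^ (1-r) A)` averaging is self-adjoint (`qtrace_comp_average`); this
reduces to `E ^ m F ^ m = F ^ m E ^ m` on vectors of weight zero. If `average θ = 1`, the linear form
`f ↦ qtrace (θ f)` is thus independent of `θ`, cyclic, and compatible with partial traces: it is the
modified trace up to a constant. In other words, the modified trace of `average η` is a constant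
times `qtrace η` (`modTrace_averageHom`). Uniqueness holds since every endomorphism of a projective
module is, up to cyclicity and partial traces, an endomorphism of `V₀`, which is a scalar.

The algebra `End X_ε` has dimension at most two: `w^H_i` generates `X_ε`, and its weight space is
spanned by `w^H_i` and `w^S_i`. For `ε` not an integer, the identity is a combination of the averages
of the projections to the two highest weight vectors `w^R_{2r-2-i}` and
`w^S_i + 2 [1 + i] [ε] w^H_i`, which gives projectivity and
`d(X_ε) = N (1 / κ(μ₁) + 1 / κ(μ₂))` with the weights `μ₁`, `μ₂` of these vectors
(`modifiedDim_deformed_generic`), where `κ(μ)` is the scalar of `E ^ (r-1) F ^ (r-1)` on a highest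
weight vector. At `ε = 0` this degenerates, but the average of the map `w^S_i ↦ w^H_i` is invertible
(`isAveraged_deformed_zero`). The averages of this map and of the projection to `w^R_{2r-2-i}` give a
linear equation for `d(X_ε)` whose coefficients are continuous in `ε` and whose leading coefficient
does not vanish at `0`; so `d(X_ε)` is continuous there (`tendsto_modifiedDim_deformed`), and `d(X_0)`
is the limit of the explicit expression.

Finally `P_i ⊗ ℂ^H_{l r}` is treated by the partial trace, which contributes the quantum dimension
`(-1) ^ (l (r-1))` of `ℂ^H_{l r}` (`modifiedDim_tensor`, `qtrace_character_one`).
-/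

noncomputable section

namespace Unrolled

open WeightModule

/-! ### Powers of the raising and lowering operators -/

section WeightVectors

variable {r : ℕ} {M : Type*} [AddCommGroup M] [Module ℂ M] {e f k k' h : Module.End ℂ M}

theorem Relations.kinv_eigen (R : Relations r e f k k' h) {x : M} {z : ℂ}
    (hx : k x = qpow r z • x) :
    k' x = qpow r (-z) • x := by
  have h1 : k' (k x) = x := by rw [← Module.End.mul_apply, R.kinv_k, Module.End.one_apply]
  rw [hx, map_smul] at h1
  rw [← h1, smul_smul, ← qpow_add]
  simp [h1, qpow_zero]

theorem Relations.k_e_pow (R : Relations r e f k k' h) {x : M} {z : ℂ} (hx : k x = qpow r z • x)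
    (m : ℕ) : k ((e ^ m) x) = qpow r (z + 2 * m) • (e ^ m) x := by
  induction m with
  | zero => simp [hx]
  | succ m ih =>
    rw [pow_succ', Module.End.mul_apply, ← Module.End.mul_apply k, R.k_e, LinearMap.smul_apply,
      Module.End.mul_apply, ih, map_smul, smul_smul, ← qpow_add]
    congr 2; push_cast; ring

theorem Relations.k_f_pow (R : Relations r e f k k' h) {x : M} {z : ℂ} (hx : k x = qpow r z • x)
    (m : ℕ) : k ((f ^ m) x) = qpow r (z - 2 * m) • (f ^ m) x := by
  induction m with
  | zero => simp [hx]
  | succ m ih =>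
    rw [pow_succ', Module.End.mul_apply, ← Module.End.mul_apply k, R.k_f, LinearMap.smul_apply,
      Module.End.mul_apply, ih, map_smul, smul_smul, ← qpow_add]
    congr 2; push_cast; ring

theorem Relations.h_e_pow (R : Relations r e f k k' h) {x : M} {z : ℂ} (hx : h x = z • x)
    (m : ℕ) : h ((e ^ m) x) = (z + 2 * m) • (e ^ m) x := by
  induction m with
  | zero => simp [hx]
  | succ m ih =>
    have h1 : h * e = e * h + (2 : ℂ) • e := by rw [← R.h_e]; abel
    rw [pow_succ', Module.End.mul_apply, ← Module.End.mul_apply h, h1, LinearMap.add_apply,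
      Module.End.mul_apply, ih, map_smul, LinearMap.smul_apply, ← add_smul]
    congr 1; push_cast; ring

theorem Relations.h_f_pow (R : Relations r e f k k' h) {x : M} {z : ℂ} (hx : h x = z • x)
    (m : ℕ) : h ((f ^ m) x) = (z - 2 * m) • (f ^ m) x := by
  induction m with
  | zero => simp [hx]
  | succ m ih =>
    have h1 : h * f = f * h + (-2 : ℂ) • f := by rw [← R.h_f]; abel
    rw [pow_succ', Module.End.mul_apply, ← Module.End.mul_apply h, h1, LinearMap.add_apply,
      Module.End.mul_apply, ih, map_smul, LinearMap.smul_apply, ← add_smul]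
    congr 1; push_cast; ring

theorem Relations.e_f_apply (R : Relations r e f k k' h) {x : M} {z : ℂ}
    (hx : k x = qpow r z • x) : e (f x) = f (e x) + qnum r z • x := by
  have h1 : e * f = f * e + (qpow r 1 - qpow r (-1))⁻¹ • (k - k') := by rw [← R.e_f]; abel
  rw [← Module.End.mul_apply, h1, LinearMap.add_apply, Module.End.mul_apply, LinearMap.smul_apply,
    LinearMap.sub_apply, hx, R.kinv_eigen hx, ← sub_smul, smul_smul, qnum, div_eq_inv_mul]

theorem qnum_add_qnum_mul {r : ℕ} (hr : 2 ≤ r) (m z : ℂ) :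
    qnum r m * qnum r (z + 1 - m) + qnum r (z - 2 * m) =
      qnum r (m + 1) * qnum r (z + 1 - (m + 1)) := by
  have := qnum_chain hr m z
  rw [show z + 1 - (m + 1) = z - m by ring]
  linear_combination -this

/-- Moving one raising operator past a power of the lowering operator. -/
theorem Relations.e_f_pow_apply (hr : 2 ≤ r) (R : Relations r e f k k' h) {x : M} {z : ℂ}
    (hx : k x = qpow r z • x) (m : ℕ) : e ((f ^ (m + 1)) x) =
      (f ^ (m + 1)) (e x) + (qnum r (m + 1) * qnum r (z + 1 - (m + 1))) • (f ^ m) x := by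
  induction m with
  | zero =>
    simp only [zero_add, pow_one, Nat.cast_zero, pow_zero, Module.End.one_apply]
    rw [R.e_f_apply hx, qnum_one hr, one_mul, add_sub_cancel_right]
  | succ m ih =>
    rw [pow_succ', Module.End.mul_apply, R.e_f_apply (R.k_f_pow hx (m + 1)), ih, map_add, map_smul,
      ← Module.End.mul_apply f, ← pow_succ', ← Module.End.mul_apply f, ← pow_succ', add_assoc,
      ← add_smul]
    push_cast
    rw [qnum_add_qnum_mul hr]

/-- On a highest weight vector of weight `z`, `E ^ m F ^ m` is the scalar
`∏_{j = 1}^m [j] [z + 1 - j]`. -/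
theorem Relations.e_pow_f_pow_highest (hr : 2 ≤ r) (R : Relations r e f k k' h) {x : M} {z : ℂ}
    (hx : k x = qpow r z • x) (h0 : e x = 0) (m : ℕ) : (e ^ m) ((f ^ m) x) =
      (∏ j ∈ Finset.range m, qnum r (j + 1) * qnum r (z + 1 - (j + 1))) • x := by
  induction m with
  | zero => simp
  | succ m ih =>
    rw [pow_succ, Module.End.mul_apply, R.e_f_pow_apply hr hx, h0, map_zero, zero_add, map_smul, ih,
      smul_smul, Finset.prod_range_succ, mul_comm]

/-- On vectors of weight zero `E ^ m F ^ m = F ^ m E ^ m`: by means of the Casimir element both sides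
are the same polynomial in it. -/
theorem Relations.e_pow_f_pow_comm (hr : 2 ≤ r) (R : Relations r e f k k' h) {x : M}
    (hx : k x = x) (m : ℕ) : (e ^ m) ((f ^ m) x) = (f ^ m) ((e ^ m) x) := by
  have hd := qpow_one_sub_ne_zero hr
  have q1 : qpow r 1 * qpow r (-1) = 1 := by rw [← qpow_add]; simp [qpow_zero]
  have q2 : qpow r 2 = qpow r 1 * qpow r 1 := by rw [← qpow_add]; norm_num
  have q3 : qpow r (-2) = qpow r (-1) * qpow r (-1) := by rw [← qpow_add]; norm_num
  set d := qpow r 1 - qpow r (-1) with hdd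
  have q0 := qpow_ne_zero r 1
  have q4 : qpow r (-1) = (qpow r 1)⁻¹ := by rw [qpow_neg]
  -- the Casimir element, and its expression through `ef`
  let C : Module.End ℂ M := f * e + (d ^ 2)⁻¹ • (qpow r 1 • k + qpow r (-1) • k')
  have hef : e * f = f * e + d⁻¹ • (k - k') := by rw [← R.e_f]; abel
  have hCe : C * e = e * C := by
    simp only [C, mul_add, add_mul, mul_smul_comm, smul_mul_assoc, R.k_e, R.kinv_e, ← mul_assoc,
      hef, sub_mul, smul_smul]
    rw [mul_assoc f e e]
    simp only [smul_sub, smul_add, smul_smul]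
    match_scalars <;> field_simp <;> rw [q2] at * <;> simp only [q3, q4, hdd] <;> field_simp <;>
      ring
  have hCf : C * f = f * C := by
    have h1 : k * f = qpow r (-2) • (f * k) := R.k_f
    have h2 : k' * f = qpow r 2 • (f * k') := R.kinv_f
    simp only [C, mul_add, add_mul, mul_smul_comm, smul_mul_assoc, h1, h2]
    rw [mul_assoc f e f, hef]
    simp only [mul_add, mul_sub, mul_smul_comm, smul_sub, smul_add, smul_smul]
    match_scalars <;> field_simp <;> simp only [q2, q3, q4, hdd] <;> field_simp <;> ring
  have hCem : ∀ m : ℕ, ∀ y, (e ^ m) (C y) = C ((e ^ m) y) := fun m y => by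
    rw [← Module.End.mul_apply, ← Module.End.mul_apply,
      (show Commute C e from hCe).pow_right m |>.eq]
  have hCfm : ∀ m : ℕ, ∀ y, (f ^ m) (C y) = C ((f ^ m) y) := fun m y => by
    rw [← Module.End.mul_apply, ← Module.End.mul_apply,
      (show Commute C f from hCf).pow_right m |>.eq]
  let c : ℂ → ℂ := fun z => (d ^ 2)⁻¹ * (qpow r (1 + z) + qpow r (-(1 + z)))
  have hfe : ∀ y z, k y = qpow r z • y → f (e y) = C y - c z • y := by
    intro y z hy
    simp only [C, c, LinearMap.add_apply, Module.End.mul_apply, LinearMap.smul_apply, hy,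
      R.kinv_eigen hy, smul_smul, qpow_add, neg_add]
    module
  have hefc : ∀ y z, k y = qpow r z • y → e (f y) = C y - c (z - 2) • y := by
    intro y z hy
    rw [R.e_f_apply hy, hfe y z hy, sub_add, ← sub_smul]
    congr 2
    simp only [c, qnum, ← hdd]
    rw [show 1 + (z - 2) = z + (-1 : ℂ) by ring, show -(1 + z) = -z + -1 by ring,
      show -(z + -1) = -z + 1 by ring, add_comm 1 z]
    simp only [qpow_add, q4]
    field_simp
    simp only [hdd, q4]
    field_simp
    ring
  have hx0 : k x = qpow r 0 • x := by rw [hx, qpow_zero, one_smul]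
  induction m with
  | zero => simp
  | succ m ih =>
    have h1 := hefc _ _ (R.k_f_pow hx0 m)
    have h2 := hfe _ _ (R.k_e_pow hx0 m)
    have h3 : (e ^ (m + 1)) ((f ^ (m + 1)) x) = (e ^ m) (e (f ((f ^ m) x))) := by
      rw [pow_succ e, pow_succ' f, Module.End.mul_apply, Module.End.mul_apply]
    have h4 : (f ^ (m + 1)) ((e ^ (m + 1)) x) = (f ^ m) (f (e ((e ^ m) x))) := by
      rw [pow_succ f, pow_succ' e, Module.End.mul_apply, Module.End.mul_apply]
    rw [h3, h4, h1, h2, map_sub, map_smul, map_sub, map_smul, hCem, hCfm, ih]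
    congr 2
    simp only [c]
    rw [show (1 + (0 - 2 * (m : ℂ) - 2)) = -(1 + (0 + 2 * (m : ℂ))) by ring, neg_neg, add_comm]

/-- The vector `F ^ (r-1) E ^ (r-1) x` is invariant if `x` has weight zero: it is killed by `F` since
`F ^ r = 0`, and by `E` since `E ^ r = 0` and `[r] = 0`. -/
theorem Relations.e_f_pow_e_pow (hr : 2 ≤ r) (R : Relations r e f k k' h) {x : M}
    (hx : k x = x) : e ((f ^ (r - 1)) ((e ^ (r - 1)) x)) = 0 := by
  have hx0 : k x = qpow r 0 • x := by rw [hx, qpow_zero, one_smul]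
  obtain ⟨n, rfl⟩ : ∃ n, r = n + 2 := ⟨r - 2, by omega⟩
  have h1 := R.e_f_pow_apply hr (R.k_e_pow hx0 (n + 1)) n
  rw [show n + 2 - 1 = n + 1 by omega, h1, ← Module.End.mul_apply e, ← pow_succ', R.e_pow,
    LinearMap.zero_apply, map_zero, zero_add]
  have h2 : qnum (n + 2) (0 + 2 * ((n + 1 : ℕ) : ℂ) + 1 - (n + 1)) = 0 := by
    rw [show 0 + 2 * ((n + 1 : ℕ) : ℂ) + 1 - (n + 1) = ((n + 2 : ℕ) : ℂ) by push_cast; ring,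
      qnum_self hr]
  rw [h2, mul_zero, zero_smul]

end WeightVectors

/-! ### The adjoint action on linear maps and the averaging operator -/

namespace WeightModule

variable {r : ℕ} {U V W : WeightModule r}

/-- The linear operator `θ ↦ A θ B` on linear maps. -/
def sandwich (A : Module.End ℂ V.carrier) (B : Module.End ℂ U.carrier) :
    Module.End ℂ (U.carrier →ₗ[ℂ] V.carrier) where
  toFun θ := A ∘ₗ θ ∘ₗ B
  map_add' θ η := by ext v; simp
  map_smul' c θ := by ext v; simp

theorem sandwich_apply (A : Module.End ℂ V.carrier) (B : Module.End ℂ U.carrier)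
    (θ : U.carrier →ₗ[ℂ] V.carrier) : sandwich A B θ = A ∘ₗ θ ∘ₗ B := rfl

theorem sandwich_mul (A C : Module.End ℂ V.carrier) (B D : Module.End ℂ U.carrier) :
    sandwich A B * sandwich C D = sandwich (A * C) (D * B) := rfl

theorem sandwich_one : sandwich (1 : Module.End ℂ V.carrier) (1 : Module.End ℂ U.carrier) = 1 := rfl

theorem sandwich_pow (A : Module.End ℂ V.carrier) (B : Module.End ℂ U.carrier) (m : ℕ) :
    sandwich A B ^ m = sandwich (A ^ m) (B ^ m) := by
  induction m with
  | zero => rfl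
  | succ m ih => rw [pow_succ, ih, sandwich_mul, ← pow_succ, ← pow_succ']

theorem sandwich_smul_left (c : ℂ) (A : Module.End ℂ V.carrier) (B : Module.End ℂ U.carrier) :
    sandwich (c • A) B = c • sandwich A B := by
  ext θ v; simp [sandwich_apply]

theorem sandwich_smul_right (c : ℂ) (A : Module.End ℂ V.carrier) (B : Module.End ℂ U.carrier) :
    sandwich A (c • B) = c • sandwich A B := by
  ext θ v; simp [sandwich_apply]

theorem sandwich_sub_left (A C : Module.End ℂ V.carrier) (B : Module.End ℂ U.carrier) :
    sandwich (A - C) B = sandwich A B - sandwich C B := by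
  ext θ v; simp [sandwich_apply]

theorem sandwich_sub_right (A : Module.End ℂ V.carrier) (B D : Module.End ℂ U.carrier) :
    sandwich A (B - D) = sandwich A B - sandwich A D := by
  ext θ v; simp [sandwich_apply]

theorem sandwich_add_left (A C : Module.End ℂ V.carrier) (B : Module.End ℂ U.carrier) :
    sandwich (A + C) B = sandwich A B + sandwich C B := by
  ext θ v; simp [sandwich_apply]

theorem sandwich_add_right (A : Module.End ℂ V.carrier) (B D : Module.End ℂ U.carrier) :
    sandwich A (B + D) = sandwich A B + sandwich A D := by
  ext θ v; simp [sandwich_apply]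

theorem sandwich_zero_left (B : Module.End ℂ U.carrier) :
    sandwich (0 : Module.End ℂ V.carrier) B = 0 := by
  ext θ v; simp [sandwich_apply]

theorem sandwich_zero_right (A : Module.End ℂ V.carrier) :
    sandwich A (0 : Module.End ℂ U.carrier) = 0 := by
  ext θ v; simp [sandwich_apply]

/-- The action of a generator on a weight module. -/
abbrev act (V : WeightModule r) (g : Gen) : Module.End ℂ V.carrier := V.ρ (UqH.gen r g)

theorem act_relations (V : WeightModule r) :
    Relations r (V.act .E) (V.act .F) (V.act .K) (V.act .Kinv) (V.act .H) where
  k_kinv := by rw [← map_mul, (UqH.relations r).k_kinv, map_one]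
  kinv_k := by rw [← map_mul, (UqH.relations r).kinv_k, map_one]
  k_e := by rw [← map_mul, (UqH.relations r).k_e, map_smul, map_mul]
  k_f := by rw [← map_mul, (UqH.relations r).k_f, map_smul, map_mul]
  h_k := by rw [← map_mul, (UqH.relations r).h_k, map_mul]
  h_e := by rw [← map_mul, ← map_mul, ← map_sub, (UqH.relations r).h_e, map_smul]
  h_f := by rw [← map_mul, ← map_mul, ← map_sub, (UqH.relations r).h_f, map_smul]
  e_f := by rw [← map_mul, ← map_mul, ← map_sub, (UqH.relations r).e_f, map_smul, map_sub]
  e_pow := by rw [← map_pow, (UqH.relations r).e_pow, map_zero]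
  f_pow := by rw [← map_pow, (UqH.relations r).f_pow, map_zero]

variable (U V)

/-- The adjoint action of `E` on linear maps `U → V`: `θ ↦ (E θ - θ E) K⁻¹`, which is
`x ▷ θ = x₍₁₎ θ S(x₍₂₎)` for `x = E`. -/
def adE : Module.End ℂ (U.carrier →ₗ[ℂ] V.carrier) :=
  sandwich (V.act .E) (U.act .Kinv) - sandwich 1 (U.act .E * U.act .Kinv)

/-- The adjoint action of `F` on linear maps `U → V`: `θ ↦ F θ - K⁻¹ θ K F`. -/
def adF : Module.End ℂ (U.carrier →ₗ[ℂ] V.carrier) :=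
  sandwich (V.act .F) 1 - sandwich (V.act .Kinv) (U.act .K * U.act .F)

/-- The adjoint action of `H` on linear maps `U → V`: `θ ↦ H θ - θ H`. -/
def adH : Module.End ℂ (U.carrier →ₗ[ℂ] V.carrier) :=
  sandwich (V.act .H) 1 - sandwich 1 (U.act .H)

variable {U V}

theorem _root_.Unrolled.Relations.k_f_kinv {A : Type*} [Ring A] [Algebra ℂ A] {e f k k' h : A}
    (R : Relations r e f k k' h) : k * f * k' = qpow r (-2) • f := by
  rw [R.k_f, smul_mul_assoc, mul_assoc, R.k_kinv, mul_one]

/-- If `b` commutes with `a` up to a scalar then `(a b) ^ m` vanishes with `a ^ m`. -/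
theorem mul_pow_eq_zero_of_qcommute {A : Type*} [Ring A] [Algebra ℂ A] {a b : A} {z : ℂ}
    (h : b * a = z • (a * b)) {m : ℕ} (ha : a ^ m = 0) : (a * b) ^ m = 0 := by
  have key : ∀ n : ℕ, ∃ c : ℂ, (a * b) ^ n = c • (a ^ n * b ^ n) := by
    intro n
    induction n with
    | zero => exact ⟨1, by simp⟩
    | succ n ih =>
      obtain ⟨c, hc⟩ := ih
      refine ⟨c * z ^ n, ?_⟩
      have h1 : b ^ n * a = z ^ n • (a * b ^ n) := pow_qcommute h n
      calc (a * b) ^ (n + 1) = c • (a ^ n * (b ^ n * a) * b) := by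
            rw [pow_succ, hc, smul_mul_assoc]; simp only [mul_assoc]
        _ = _ := by
            rw [h1, mul_smul_comm, smul_mul_assoc, smul_smul]; simp only [pow_succ, mul_assoc]
  obtain ⟨c, hc⟩ := key m
  rw [hc, ha, zero_mul, smul_zero]

theorem sub_pow_eq_zero_of_qcommute {r : ℕ} (hr : 2 ≤ r) {A : Type*} [Ring A] [Algebra ℂ A]
    {z : ℂ} (hz : IsPrimitiveRoot z r) {a b : A}
    (hab : a * b = z • (b * a) ∨ b * a = z • (a * b)) (ha : a ^ r = 0) (hb : b ^ r = 0) :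
    (a - b) ^ r = 0 := by
  have hb' : (-b) ^ r = 0 := by rw [neg_pow, hb, mul_zero]
  rcases hab with h | h
  · rw [sub_eq_neg_add]
    exact add_pow_eq_zero_of_qcommute hr hz (by simp [h]) hb' ha
  · rw [sub_eq_add_neg]
    exact add_pow_eq_zero_of_qcommute hr hz (by simp [h]) ha hb'

/-- The adjoint operators satisfy the relations of the algebra. -/
theorem ad_relations [hr : Fact (2 ≤ r)] (U V : WeightModule r) :
    Relations r (adE U V) (adF U V) (sandwich (V.act .K) (U.act .Kinv))
      (sandwich (V.act .Kinv) (U.act .K)) (adH U V) := by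
  have RU := U.act_relations
  have RV := V.act_relations
  rw [adE, adF, adH]
  generalize U.act .E = e at *
  generalize U.act .F = f at *
  generalize U.act .K = k at *
  generalize U.act .Kinv = k' at *
  generalize U.act .H = h at *
  generalize V.act .E = e₁ at *
  generalize V.act .F = f₁ at *
  generalize V.act .K = k₁ at *
  generalize V.act .Kinv = k₁' at *
  generalize V.act .H = h₁ at *
  have hprim : IsPrimitiveRoot (qpow r 2) r := qpow_two_primitive hr.out
  have q22 : qpow r 2 * qpow r (-2) = 1 := by rw [← qpow_add]; simp [qpow_zero]
  have q22' : qpow r (-2) * qpow r 2 = 1 := by rw [← qpow_add]; simp [qpow_zero]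
  have hek : e * k' * k' = qpow r 2 • (k' * (e * k')) := by
    rw [← mul_assoc, RU.kinv_e, smul_mul_assoc, smul_smul, q22, one_smul]
  have hkf : k' * (k * f) = f := by rw [← mul_assoc, RU.kinv_k, one_mul]
  have hkfr : (k * f) ^ r = 0 := by
    rw [RU.k_f, smul_pow, mul_pow_eq_zero_of_qcommute RU.k_f RU.f_pow, smul_zero]
  have hkfk : k * f * k = qpow r 2 • (k * (k * f)) := by
    rw [RU.k_f, mul_smul_comm, smul_smul, q22, one_smul, ← mul_assoc, RU.k_f]
  refine ⟨?_, ?_, ?_, ?_, ?_, ?_, ?_, ?_, ?_, ?_⟩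
  · rw [sandwich_mul, RV.k_kinv, RU.k_kinv, sandwich_one]
  · rw [sandwich_mul, RV.kinv_k, RU.kinv_k, sandwich_one]
  · simp only [mul_sub, sub_mul, sandwich_mul, RV.k_e, sandwich_smul_left, one_mul, mul_one, hek,
      sandwich_smul_right, smul_sub]
  · simp only [mul_sub, sub_mul, sandwich_mul, RV.k_f, sandwich_smul_left, one_mul, mul_one,
      hkf, RV.k_kinv, RV.kinv_k, RU.k_f_kinv, sandwich_smul_right, smul_sub]
  · simp only [mul_sub, sub_mul, sandwich_mul, RV.h_k, one_mul, mul_one, RU.h_kinv]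
  · have h1 : h * e = e * h + (2 : ℂ) • e := by rw [← RU.h_e]; abel
    have h2 : h₁ * e₁ = e₁ * h₁ + (2 : ℂ) • e₁ := by rw [← RV.h_e]; abel
    have h3 : h * (e * k') = e * k' * h + (2 : ℂ) • (e * k') := by
      rw [← mul_assoc, h1, add_mul, mul_assoc, RU.h_kinv, smul_mul_assoc, mul_assoc]
    simp only [mul_sub, sub_mul, sandwich_mul, one_mul, mul_one, h2, h3, RU.h_kinv,
      sandwich_add_left, sandwich_add_right, sandwich_smul_left, sandwich_smul_right, smul_sub]
    abel
  · have h1 : h * f = f * h + (-2 : ℂ) • f := by rw [← RU.h_f]; abel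
    have h2 : h₁ * f₁ = f₁ * h₁ + (-2 : ℂ) • f₁ := by rw [← RV.h_f]; abel
    have h3 : h * (k * f) = k * f * h + (-2 : ℂ) • (k * f) := by
      rw [← mul_assoc, RU.h_k, mul_assoc, h1, mul_add, mul_smul_comm, mul_assoc]
    simp only [mul_sub, sub_mul, sandwich_mul, one_mul, mul_one, h2, h3, RV.h_kinv,
      sandwich_add_left, sandwich_add_right, sandwich_smul_left, sandwich_smul_right, smul_sub]
    abel
  · have h2 : e₁ * f₁ = f₁ * e₁ + (qpow r 1 - qpow r (-1))⁻¹ • (k₁ - k₁') := by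
      rw [← RV.e_f]; abel
    have h3 : e * k' * (k * f) = f * e + (qpow r 1 - qpow r (-1))⁻¹ • (k - k') := by
      rw [← RU.e_f, mul_assoc, hkf]; abel
    have h4 : k * f * (e * k') = f * e := by
      calc k * f * (e * k') = qpow r (-2) • (f * (k * e) * k') := by
            rw [RU.k_f, smul_mul_assoc]; simp only [mul_assoc]
        _ = f * e * (k * k') := by
            rw [RU.k_e, mul_smul_comm, smul_mul_assoc, smul_smul, q22', one_smul]
            simp only [mul_assoc]
        _ = f * e := by rw [RU.k_kinv, mul_one]
    simp only [mul_sub, sub_mul, sandwich_mul, one_mul, mul_one, h2, h3, h4, RV.kinv_e,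
      RU.k_f_kinv, hkf,
      sandwich_add_left, sandwich_add_right, sandwich_smul_left, sandwich_smul_right, smul_sub,
      sandwich_sub_left, sandwich_sub_right]
    abel
  · refine sub_pow_eq_zero_of_qcommute hr.out hprim (Or.inl ?_) ?_ ?_
    · simp only [sandwich_mul, one_mul, mul_one, hek, sandwich_smul_right]
    · rw [sandwich_pow, RV.e_pow, sandwich_zero_left]
    · rw [sandwich_pow, mul_pow_eq_zero_of_qcommute RU.kinv_e RU.e_pow, sandwich_zero_right]
  · refine sub_pow_eq_zero_of_qcommute hr.out hprim (Or.inr ?_) ?_ ?_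
    · simp only [sandwich_mul, one_mul, mul_one, RV.kinv_f, sandwich_smul_left]
    · rw [sandwich_pow, RV.f_pow, sandwich_zero_left]
    · rw [sandwich_pow, hkfr, sandwich_zero_right]

variable {r : ℕ} {U V W : WeightModule r}

/-! ### Weight preserving maps and averages -/

/-- `K` acts on the `H`-weight space of weight `μ` as `q ^ μ`. -/
theorem act_K_of_weight (V : WeightModule r) {v : V.carrier} {μ : ℂ} (hv : V.act .H v = μ • v) :
    V.act .K v = qpow r μ • v := by
  obtain ⟨ι, b, wt, hb⟩ := V.exists_weight_basis
  have h1 : ∀ j, wt j * b.repr v j = μ * b.repr v j := by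
    intro j
    have key : (b.coord j) ∘ₗ V.act .H = wt j • b.coord j := by
      refine b.ext fun k => ?_
      rw [LinearMap.comp_apply, (hb k).1, map_smul, LinearMap.smul_apply, Module.Basis.coord_apply,
        Module.Basis.repr_self]
      by_cases h : k = j
      · subst h; rfl
      · simp [Finsupp.single_eq_of_ne (Ne.symm h)]
    have h2 := LinearMap.congr_fun key v
    rw [LinearMap.comp_apply, hv, map_smul] at h2
    simpa using h2.symm
  refine b.repr.injective ?_
  ext j
  have key : (b.coord j) ∘ₗ V.act .K = qpow r (wt j) • b.coord j := by
    refine b.ext fun k => ?_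
    rw [LinearMap.comp_apply, (hb k).2, map_smul, LinearMap.smul_apply, Module.Basis.coord_apply,
      Module.Basis.repr_self]
    by_cases h : k = j
    · subst h; rfl
    · simp [Finsupp.single_eq_of_ne (Ne.symm h)]
  have h2 := LinearMap.congr_fun key v
  rw [LinearMap.comp_apply, Module.Basis.coord_apply, LinearMap.smul_apply,
    Module.Basis.coord_apply] at h2
  rw [h2, map_smul, Finsupp.smul_apply]
  by_cases h0 : b.repr v j = 0
  · rw [h0, smul_zero, smul_zero]
  · rw [mul_right_cancel₀ h0 (h1 j)]

theorem kinv_k_apply (V : WeightModule r) (v : V.carrier) : V.act .Kinv (V.act .K v) = v := by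
  rw [← Module.End.mul_apply, V.act_relations.kinv_k, Module.End.one_apply]

theorem k_kinv_apply (V : WeightModule r) (v : V.carrier) : V.act .K (V.act .Kinv v) = v := by
  rw [← Module.End.mul_apply, V.act_relations.k_kinv, Module.End.one_apply]

/-- A linear map that commutes with `H`, that is, preserves the weight spaces. -/
def PreservesWeight (θ : U.carrier →ₗ[ℂ] V.carrier) : Prop := V.act .H ∘ₗ θ = θ ∘ₗ U.act .H

theorem PreservesWeight.apply {θ : U.carrier →ₗ[ℂ] V.carrier} (h : PreservesWeight θ)
    (v : U.carrier) : V.act .H (θ v) = θ (U.act .H v) := LinearMap.congr_fun h v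

theorem PreservesWeight.act_K {θ : U.carrier →ₗ[ℂ] V.carrier} (h : PreservesWeight θ)
    (v : U.carrier) : V.act .K (θ v) = θ (U.act .K v) := by
  obtain ⟨ι, b, wt, hb⟩ := U.exists_weight_basis
  refine LinearMap.congr_fun (f := V.act .K ∘ₗ θ) (g := θ ∘ₗ U.act .K) (b.ext fun j => ?_) v
  rw [LinearMap.comp_apply, LinearMap.comp_apply, (hb j).2, map_smul]
  refine V.act_K_of_weight ?_
  rw [h.apply, (hb j).1, map_smul]

theorem PreservesWeight.sandwich_K {θ : U.carrier →ₗ[ℂ] V.carrier} (h : PreservesWeight θ) :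
    sandwich (V.act .K) (U.act .Kinv) θ = θ := by
  ext v
  rw [sandwich_apply, LinearMap.comp_apply, LinearMap.comp_apply, h.act_K, ← Module.End.mul_apply,
    U.act_relations.k_kinv, Module.End.one_apply]

theorem preservesWeight_iff_adH {θ : U.carrier →ₗ[ℂ] V.carrier} :
    PreservesWeight θ ↔ adH U V θ = 0 := by
  rw [PreservesWeight, ← sub_eq_zero]; rfl

theorem PreservesWeight.add {θ η : U.carrier →ₗ[ℂ] V.carrier} (h : PreservesWeight θ)
    (h' : PreservesWeight η) : PreservesWeight (θ + η) := by
  rw [preservesWeight_iff_adH] at *; rw [map_add, h, h', add_zero]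

theorem PreservesWeight.smul {θ : U.carrier →ₗ[ℂ] V.carrier} (h : PreservesWeight θ) (c : ℂ) :
    PreservesWeight (c • θ) := by
  rw [preservesWeight_iff_adH] at *; rw [map_smul, h, smul_zero]

theorem PreservesWeight.comp {θ : U.carrier →ₗ[ℂ] V.carrier} {η : V.carrier →ₗ[ℂ] W.carrier}
    (h : PreservesWeight η) (h' : PreservesWeight θ) : PreservesWeight (η ∘ₗ θ) := by
  ext v
  simp only [LinearMap.comp_apply]
  rw [h.apply, h'.apply]

theorem hom_act (f : Hom U V) (g : Gen) (v : U.carrier) :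
    f.1 (U.act g v) = V.act g (f.1 v) := f.2 _ v

theorem hom_act_pow (f : Hom U V) (g : Gen) (m : ℕ) (v : U.carrier) :
    f.1 ((U.act g ^ m) v) = (V.act g ^ m) (f.1 v) := by
  rw [← map_pow, ← map_pow, f.2]

theorem hom_preservesWeight (f : Hom U V) : PreservesWeight f.1 :=
  LinearMap.ext fun v => (hom_act f .H v).symm

theorem hom_kinv_of_hom_k (f : U.carrier →ₗ[ℂ] V.carrier)
    (hK : ∀ v, f (U.act .K v) = V.act .K (f v)) (v : U.carrier) :
    f (U.act .Kinv v) = V.act .Kinv (f v) := by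
  have h1 := hK (U.act .Kinv v)
  rw [← Module.End.mul_apply, U.act_relations.k_kinv, Module.End.one_apply] at h1
  rw [h1, ← Module.End.mul_apply, V.act_relations.kinv_k, Module.End.one_apply]

/-- A linear map that commutes with `E`, `F` and `H` is a module homomorphism. -/
theorem mem_hom_of_generators {f : U.carrier →ₗ[ℂ] V.carrier}
    (hE : ∀ v, f (U.act .E v) = V.act .E (f v)) (hF : ∀ v, f (U.act .F v) = V.act .F (f v))
    (hH : ∀ v, f (U.act .H v) = V.act .H (f v)) : f ∈ Hom U V := by
  have hw : PreservesWeight f := LinearMap.ext fun v => (hH v).symm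
  have hK : ∀ v, f (U.act .K v) = V.act .K (f v) := fun v => (hw.act_K v).symm
  intro x
  induction x using UqH.induction with
  | hg g =>
    cases g
    · exact hE
    · exact hF
    · exact hK
    · exact hom_kinv_of_hom_k f hK
    · exact hH
  | hc c => intro v; simp
  | ha x y hx hy => intro v; simp [hx, hy]
  | hm x y hx hy => intro v; simp [hx, hy]

variable (U V) in
/-- The averaging operator on linear maps `U → V`: the adjoint action of `F ^ (r-1) E ^ (r-1)`. -/
def average : Module.End ℂ (U.carrier →ₗ[ℂ] V.carrier) := adF U V ^ (r - 1) * adE U V ^ (r - 1)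

theorem adE_comp_hom (θ : U.carrier →ₗ[ℂ] V.carrier) (g : Hom W U) :
    adE W V (θ ∘ₗ g.1) = adE U V θ ∘ₗ g.1 := by
  ext v
  simp [adE, sandwich_apply, hom_act g]

theorem adF_comp_hom (θ : U.carrier →ₗ[ℂ] V.carrier) (g : Hom W U) :
    adF W V (θ ∘ₗ g.1) = adF U V θ ∘ₗ g.1 := by
  ext v
  simp [adF, sandwich_apply, hom_act g]

theorem adE_hom_comp (θ : U.carrier →ₗ[ℂ] V.carrier) (g : Hom V W) :
    adE U W (g.1 ∘ₗ θ) = g.1 ∘ₗ adE U V θ := by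
  ext v
  simp [adE, sandwich_apply, hom_act g]

theorem adF_hom_comp (θ : U.carrier →ₗ[ℂ] V.carrier) (g : Hom V W) :
    adF U W (g.1 ∘ₗ θ) = g.1 ∘ₗ adF U V θ := by
  ext v
  simp [adF, sandwich_apply, hom_act g]

theorem average_comp_hom (θ : U.carrier →ₗ[ℂ] V.carrier) (g : Hom W U) :
    average W V (θ ∘ₗ g.1) = average U V θ ∘ₗ g.1 := by
  have hE : ∀ m, (adE W V ^ m) (θ ∘ₗ g.1) = (adE U V ^ m) θ ∘ₗ g.1 := by
    intro m
    induction m with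
    | zero => rfl
    | succ m ih => rw [pow_succ', Module.End.mul_apply, ih, adE_comp_hom, pow_succ']; rfl
  have hF : ∀ m η, (adF W V ^ m) (η ∘ₗ g.1) = (adF U V ^ m) η ∘ₗ g.1 := by
    intro m η
    induction m with
    | zero => rfl
    | succ m ih => rw [pow_succ', Module.End.mul_apply, ih, adF_comp_hom, pow_succ']; rfl
  rw [average, Module.End.mul_apply, hE, hF]; rfl

theorem average_hom_comp (θ : U.carrier →ₗ[ℂ] V.carrier) (g : Hom V W) :
    average U W (g.1 ∘ₗ θ) = g.1 ∘ₗ average U V θ := by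
  have hE : ∀ m, (adE U W ^ m) (g.1 ∘ₗ θ) = g.1 ∘ₗ (adE U V ^ m) θ := by
    intro m
    induction m with
    | zero => rfl
    | succ m ih => rw [pow_succ', Module.End.mul_apply, ih, adE_hom_comp, pow_succ']; rfl
  have hF : ∀ m η, (adF U W ^ m) (g.1 ∘ₗ η) = g.1 ∘ₗ (adF U V ^ m) η := by
    intro m η
    induction m with
    | zero => rfl
    | succ m ih => rw [pow_succ', Module.End.mul_apply, ih, adF_hom_comp, pow_succ']; rfl
  rw [average, Module.End.mul_apply, hE, hF]; rfl

variable [hr : Fact (2 ≤ r)]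

theorem average_preservesWeight {θ : U.carrier →ₗ[ℂ] V.carrier} (h : PreservesWeight θ) :
    PreservesWeight (average U V θ) := by
  have R := ad_relations U V
  rw [preservesWeight_iff_adH] at *
  have h0 : adH U V θ = (0 : ℂ) • θ := by rw [h, zero_smul]
  rw [average, Module.End.mul_apply, R.h_f_pow (R.h_e_pow h0 _)]
  simp

/-- The averaging operator turns weight preserving linear maps into homomorphisms. -/
theorem average_mem_hom {θ : U.carrier →ₗ[ℂ] V.carrier} (h : PreservesWeight θ) :
    average U V θ ∈ Hom U V := by
  have R := ad_relations U V
  have hw := average_preservesWeight h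
  have hE : adE U V (average U V θ) = 0 := R.e_f_pow_e_pow hr.out h.sandwich_K
  have hF : adF U V (average U V θ) = 0 := by
    have h1 : adF U V ^ (r - 1 + 1) = 0 := by
      rw [Nat.sub_add_cancel (by have := hr.out; omega), R.f_pow]
    rw [average, Module.End.mul_apply, ← Module.End.mul_apply, ← pow_succ', h1,
      LinearMap.zero_apply]
  generalize average U V θ = η at *
  have kk : ∀ v, U.act .Kinv (U.act .K v) = v := fun v => by
    rw [← Module.End.mul_apply, U.act_relations.kinv_k, Module.End.one_apply]
  have kk' : ∀ v, V.act .Kinv (V.act .K v) = v := fun v => by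
    rw [← Module.End.mul_apply, V.act_relations.kinv_k, Module.End.one_apply]
  refine mem_hom_of_generators (fun v => ?_) (fun v => ?_) fun v => (hw.apply v).symm
  · have h1 := LinearMap.congr_fun hE (U.act .K v)
    simp only [adE, LinearMap.sub_apply, sandwich_apply, LinearMap.comp_apply,
      Module.End.mul_apply, Module.End.one_apply, LinearMap.zero_apply, kk] at h1
    exact (sub_eq_zero.mp h1).symm
  · have h1 := LinearMap.congr_fun hF v
    simp only [adF, LinearMap.sub_apply, sandwich_apply, LinearMap.comp_apply,
      Module.End.mul_apply, Module.End.one_apply, LinearMap.zero_apply, ← hw.act_K, kk'] at h1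
    exact (sub_eq_zero.mp h1).symm

/-- Averaging as a map to the space of homomorphisms. -/
def averageHom {θ : U.carrier →ₗ[ℂ] V.carrier} (h : PreservesWeight θ) : Hom U V :=
  ⟨average U V θ, average_mem_hom h⟩

/-! ### The quantum trace and the adjointness of averaging -/

variable {r : ℕ} {U V W : WeightModule r}

/-- The quantum trace `A ↦ tr (K ^ (1 - r) A)` of linear endomorphisms. -/
def qtrace (U : WeightModule r) : Module.End ℂ U.carrier →ₗ[ℂ] ℂ :=
  LinearMap.trace ℂ U.carrier ∘ₗ LinearMap.mulLeft ℂ (U.ρ (UqH.gen r .Kinv ^ (r - 1)))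

theorem qtrace_apply (A : Module.End ℂ U.carrier) :
    qtrace U A = LinearMap.trace ℂ U.carrier (U.ρ (UqH.gen r .Kinv ^ (r - 1)) * A) := rfl

/-- Cyclicity of the quantum trace against homomorphisms. -/
theorem qtrace_comp_hom (f : Hom U V) (A : V.carrier →ₗ[ℂ] U.carrier) :
    qtrace U (A ∘ₗ f.1) = qtrace V (f.1 ∘ₗ A) := by
  have h : V.ρ (UqH.gen r .Kinv ^ (r - 1)) ∘ₗ f.1 = f.1 ∘ₗ U.ρ (UqH.gen r .Kinv ^ (r - 1)) :=
    LinearMap.ext fun v => (f.2 _ v).symm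
  rw [qtrace_apply, qtrace_apply, Module.End.mul_eq_comp, Module.End.mul_eq_comp,
    ← LinearMap.comp_assoc, ← LinearMap.comp_assoc, LinearMap.trace_comp_comm', h,
    LinearMap.comp_assoc]

variable [hr : Fact (2 ≤ r)]

/-- The quantum trace vanishes on the adjoint action of `E`, in bilinear form. -/
theorem qtrace_comp_adE (A : V.carrier →ₗ[ℂ] U.carrier) (B : U.carrier →ₗ[ℂ] V.carrier) :
    qtrace U (A ∘ₗ adE U V B) =
      -qtrace U (adE V U A ∘ₗ sandwich (V.act .K) (U.act .Kinv) B) := by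
  have hs : r - 1 + 1 = r := by have := hr.out; omega
  have cen := (kinv_pow_central hr.out U.act_relations).1
  have h1 : A ∘ₗ adE U V B = A ∘ₗ V.act .E ∘ₗ B ∘ₗ U.act .Kinv -
      (A ∘ₗ B) * (U.act .E * U.act .Kinv) := by
    ext v; simp [adE, sandwich_apply]
  have h2 : adE V U A ∘ₗ sandwich (V.act .K) (U.act .Kinv) B =
      U.act .E * (A ∘ₗ B) * U.act .Kinv - A ∘ₗ V.act .E ∘ₗ B ∘ₗ U.act .Kinv := by
    ext v
    have : ∀ w, V.act .Kinv (V.act .K w) = w := fun w => by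
      rw [← Module.End.mul_apply, V.act_relations.kinv_k, Module.End.one_apply]
    simp [adE, sandwich_apply, this]
  rw [h1, h2, map_sub, map_sub, neg_sub]
  congr 1
  generalize A ∘ₗ B = X
  rw [qtrace_apply, qtrace_apply, map_pow, ← mul_assoc _ X, LinearMap.trace_mul_comm,
    ← mul_assoc _ (U.act .E * X), LinearMap.trace_mul_comm _ _ (U.act .Kinv), ← mul_assoc,
    ← mul_assoc, ← mul_assoc, ← pow_succ', hs, cen, mul_assoc, mul_assoc, mul_assoc, ← mul_assoc
    (U.act .Kinv), ← pow_succ', hs]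

theorem qtrace_comp_adF (A : V.carrier →ₗ[ℂ] U.carrier) (B : U.carrier →ₗ[ℂ] V.carrier) :
    qtrace U (sandwich (U.act .Kinv) (V.act .K) A ∘ₗ adF U V B) =
      -qtrace U (adF V U A ∘ₗ B) := by
  have hs : r - 1 + 1 = r := by have := hr.out; omega
  have cen := (kinv_pow_central hr.out U.act_relations).2
  have h1 : sandwich (U.act .Kinv) (V.act .K) A ∘ₗ adF U V B =
      U.act .Kinv ∘ₗ A ∘ₗ V.act .K ∘ₗ V.act .F ∘ₗ B -
      U.act .Kinv * (A ∘ₗ B) * (U.act .K * U.act .F) := by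
    ext v
    have : ∀ w, V.act .K (V.act .Kinv w) = w := fun w => by
      rw [← Module.End.mul_apply, V.act_relations.k_kinv, Module.End.one_apply]
    simp [adF, sandwich_apply, this]
  have h2 : adF V U A ∘ₗ B = U.act .F * (A ∘ₗ B) -
      U.act .Kinv ∘ₗ A ∘ₗ V.act .K ∘ₗ V.act .F ∘ₗ B := by
    ext v
    simp [adF, sandwich_apply]
  rw [h1, h2, map_sub, map_sub, neg_sub]
  congr 1
  generalize A ∘ₗ B = X
  have h3 : U.act .K * U.act .F * U.act .Kinv ^ (r - 1) * U.act .Kinv =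
      U.act .Kinv ^ (r - 1) * U.act .F := by
    have h4 : U.act .Kinv ^ r = U.act .Kinv * U.act .Kinv ^ (r - 1) := by rw [← pow_succ', hs]
    rw [mul_assoc, ← pow_succ, hs, mul_assoc, ← cen, ← mul_assoc, h4, ← mul_assoc,
      U.act_relations.k_kinv, one_mul]
  rw [qtrace_apply, qtrace_apply, map_pow, ← mul_assoc _ (U.act .Kinv * X),
    LinearMap.trace_mul_comm, ← mul_assoc, ← mul_assoc, h3, mul_assoc]

theorem sandwich_K_adE_pow {B : U.carrier →ₗ[ℂ] V.carrier} {z : ℂ}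
    (hB : sandwich (V.act .K) (U.act .Kinv) B = qpow r z • B) (m : ℕ) :
    sandwich (V.act .K) (U.act .Kinv) ((adE U V ^ m) B) = qpow r (z + 2 * m) • (adE U V ^ m) B :=
  (ad_relations U V).k_e_pow hB m

theorem qtrace_comp_adE_pow (A : V.carrier →ₗ[ℂ] U.carrier) {B : U.carrier →ₗ[ℂ] V.carrier}
    {z : ℂ} (hB : sandwich (V.act .K) (U.act .Kinv) B = qpow r z • B) (m : ℕ) :
    qtrace U (A ∘ₗ (adE U V ^ m) B) =
      (-1) ^ m * qpow r (m * z + m * (m - 1)) * qtrace U ((adE V U ^ m) A ∘ₗ B) := by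
  induction m generalizing A with
  | zero => simp [qpow_zero]
  | succ m ih =>
    rw [pow_succ', Module.End.mul_apply, qtrace_comp_adE, sandwich_K_adE_pow hB,
      LinearMap.comp_smul, map_smul, ih, smul_eq_mul, pow_succ (adE V U), Module.End.mul_apply,
      show ((m + 1 : ℕ) : ℂ) * z + ((m + 1 : ℕ) : ℂ) * (((m + 1 : ℕ) : ℂ) - 1) =
        (z + 2 * m) + (m * z + m * (m - 1)) by push_cast; ring, qpow_add r (z + 2 * m), pow_succ]
    ring

theorem qtrace_comp_adF_pow {A : V.carrier →ₗ[ℂ] U.carrier} (B : U.carrier →ₗ[ℂ] V.carrier)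
    {z : ℂ} (hA : sandwich (U.act .K) (V.act .Kinv) A = qpow r z • A) (m : ℕ) :
    qtrace U (A ∘ₗ (adF U V ^ m) B) =
      (-1) ^ m * qpow r (m * z - m * (m - 1)) * qtrace U ((adF V U ^ m) A ∘ₗ B) := by
  induction m generalizing B with
  | zero => simp [qpow_zero]
  | succ m ih =>
    rw [pow_succ, Module.End.mul_apply, ih]
    have R := ad_relations V U
    have h1 := qtrace_comp_adF ((adF V U ^ m) A) B
    rw [R.kinv_eigen (R.k_f_pow hA m), LinearMap.smul_comp, map_smul, smul_eq_mul] at h1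
    have h2 : qtrace U ((adF V U ^ m) A ∘ₗ adF U V B) =
        -qpow r (z - 2 * m) * qtrace U ((adF V U ^ (m + 1)) A ∘ₗ B) := by
      rw [pow_succ', Module.End.mul_apply, neg_mul, ← mul_neg, ← h1, ← mul_assoc, ← qpow_add,
        add_neg_cancel, qpow_zero, one_mul]
    rw [h2, show ((m + 1 : ℕ) : ℂ) * z - ((m + 1 : ℕ) : ℂ) * (((m + 1 : ℕ) : ℂ) - 1) =
        (m * z - m * (m - 1)) + (z - 2 * m) by push_cast; ring, qpow_add r (m * z - m * (m - 1)),
      pow_succ]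
    ring

/-- Averaging is self-adjoint for the pairing `(A, B) ↦ qtrace (A B)`. -/
theorem qtrace_comp_average {A : V.carrier →ₗ[ℂ] U.carrier} {B : U.carrier →ₗ[ℂ] V.carrier}
    (hA : PreservesWeight A) (hB : PreservesWeight B) :
    qtrace U (A ∘ₗ average U V B) = qtrace U (average V U A ∘ₗ B) := by
  have hA0 : sandwich (U.act .K) (V.act .Kinv) A = qpow r 0 • A := by
    rw [hA.sandwich_K, qpow_zero, one_smul]
  have hB0 : sandwich (V.act .K) (U.act .Kinv) B = qpow r 0 • B := by
    rw [hB.sandwich_K, qpow_zero, one_smul]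
  rw [average, Module.End.mul_apply, qtrace_comp_adF_pow _ hA0, qtrace_comp_adE_pow _ hB0,
    (ad_relations V U).e_pow_f_pow_comm hr.out hA.sandwich_K, average, Module.End.mul_apply,
    ← mul_assoc]
  have h1 : ((-1 : ℂ) ^ (r - 1)) * (-1) ^ (r - 1) = 1 := by rw [← mul_pow]; simp
  have h2 : qpow r (((r - 1 : ℕ) : ℂ) * 0 - ((r - 1 : ℕ) : ℂ) * (((r - 1 : ℕ) : ℂ) - 1)) *
      qpow r (((r - 1 : ℕ) : ℂ) * 0 + ((r - 1 : ℕ) : ℂ) * (((r - 1 : ℕ) : ℂ) - 1)) = 1 := by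
    rw [← qpow_add, ← qpow_zero r]; congr 1; ring
  rw [mul_mul_mul_comm, h1, h2, one_mul, one_mul]

/-! ### Averaging on tensor products -/

/-- The pure tensor `v ⊗ w` as an element of the tensor product module. -/
def tmul (v : V.carrier) (w : W.carrier) : (V.tensor W).carrier := v ⊗ₜ[ℂ] w

theorem tensor_ext {M : Type*} [AddCommMonoid M] [Module ℂ M] {f g : (V.tensor W).carrier →ₗ[ℂ] M}
    (h : ∀ v w, f (tmul v w) = g (tmul v w)) : f = g := TensorProduct.ext' h

theorem sub_tmul (v v' : V.carrier) (w : W.carrier) :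
    tmul (v - v') w = tmul v w - tmul v' w := TensorProduct.sub_tmul v v' w

theorem act_tensor_E (v : V.carrier) (w : W.carrier) : (V.tensor W).act .E (tmul v w) =
    tmul v (W.act .E w) + tmul (V.act .E v) (W.act .K w) :=
  LinearMap.congr_fun (tensorAction_E V W) (v ⊗ₜ[ℂ] w)

theorem act_tensor_F (v : V.carrier) (w : W.carrier) : (V.tensor W).act .F (tmul v w) =
    tmul (V.act .Kinv v) (W.act .F w) + tmul (V.act .F v) w :=
  LinearMap.congr_fun (tensorAction_F V W) (v ⊗ₜ[ℂ] w)

theorem act_tensor_K (v : V.carrier) (w : W.carrier) : (V.tensor W).act .K (tmul v w) =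
    tmul (V.act .K v) (W.act .K w) :=
  LinearMap.congr_fun (tensorAction_K V W) (v ⊗ₜ[ℂ] w)

theorem act_tensor_Kinv (v : V.carrier) (w : W.carrier) : (V.tensor W).act .Kinv (tmul v w) =
    tmul (V.act .Kinv v) (W.act .Kinv w) :=
  LinearMap.congr_fun (tensorAction_Kinv V W) (v ⊗ₜ[ℂ] w)

theorem act_tensor_H (v : V.carrier) (w : W.carrier) : (V.tensor W).act .H (tmul v w) =
    tmul (V.act .H v) w + tmul v (W.act .H w) :=
  LinearMap.congr_fun (tensorAction_H V W) (v ⊗ₜ[ℂ] w)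

/-- The endomorphism `θ ⊗ id` of a tensor product. -/
def tensorLeft (W : WeightModule r) (θ : Module.End ℂ V.carrier) :
    Module.End ℂ (V.tensor W).carrier := TensorProduct.map θ (1 : Module.End ℂ W.carrier)

theorem tensorLeft_tmul (θ : Module.End ℂ V.carrier) (v : V.carrier) (w : W.carrier) :
    tensorLeft W θ (tmul v w) = tmul (θ v) w := rfl

theorem adE_tensorLeft (θ : Module.End ℂ V.carrier) :
    adE (V.tensor W) (V.tensor W) (tensorLeft W θ) = tensorLeft W (adE V V θ) := by
  refine tensor_ext fun v w => ?_
  simp only [adE, LinearMap.sub_apply, sandwich_apply, LinearMap.comp_apply, act_tensor_E,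
    act_tensor_Kinv, Module.End.mul_apply, Module.End.one_apply, tensorLeft_tmul, map_add,
    k_kinv_apply, sub_tmul]
  abel

theorem adF_tensorLeft (θ : Module.End ℂ V.carrier) :
    adF (V.tensor W) (V.tensor W) (tensorLeft W θ) = tensorLeft W (adF V V θ) := by
  refine tensor_ext fun v w => ?_
  simp only [adF, LinearMap.sub_apply, sandwich_apply, LinearMap.comp_apply, act_tensor_F,
    act_tensor_Kinv, act_tensor_K, Module.End.mul_apply, Module.End.one_apply, tensorLeft_tmul,
    map_add, k_kinv_apply, kinv_k_apply, sub_tmul]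
  abel

theorem average_tensorLeft (θ : Module.End ℂ V.carrier) :
    average (V.tensor W) (V.tensor W) (tensorLeft W θ) = tensorLeft W (average V V θ) := by
  have hE : ∀ m, (adE (V.tensor W) (V.tensor W) ^ m) (tensorLeft W θ) =
      tensorLeft W ((adE V V ^ m) θ) := by
    intro m
    induction m with
    | zero => rfl
    | succ m ih => rw [pow_succ', Module.End.mul_apply, ih, adE_tensorLeft, pow_succ']; rfl
  have hF : ∀ m (η : Module.End ℂ V.carrier), (adF (V.tensor W) (V.tensor W) ^ m) (tensorLeft W η) =
      tensorLeft W ((adF V V ^ m) η) := by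
    intro m η
    induction m with
    | zero => rfl
    | succ m ih => rw [pow_succ', Module.End.mul_apply, ih, adF_tensorLeft, pow_succ']; rfl
  rw [average, Module.End.mul_apply, hE, hF]; rfl

theorem PreservesWeight.tensorLeft {θ : Module.End ℂ V.carrier} (h : PreservesWeight θ) :
    PreservesWeight (tensorLeft W θ) := by
  refine tensor_ext fun v w => ?_
  simp only [LinearMap.comp_apply, tensorLeft_tmul, act_tensor_H, map_add, h.apply]

/-- The quantum trace of `(θ ⊗ id) f` is that of `θ` times the partial trace of `f`. -/
theorem qtrace_tensorLeft_comp (θ : Module.End ℂ V.carrier)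
    (f : Hom (V.tensor W) (V.tensor W)) :
    qtrace (V.tensor W) (tensorLeft W θ * f.1) = qtrace V (θ * (partialTrace V W f).1) := by
  have hK : (V.tensor W).ρ (UqH.gen r .Kinv ^ (r - 1)) =
      TensorProduct.map (V.ρ (UqH.gen r .Kinv ^ (r - 1))) (W.ρ (UqH.gen r .Kinv ^ (r - 1))) := by
    rw [map_pow, map_pow, map_pow, ← TensorProduct.map_pow]
    congr 1
    exact tensorAction_Kinv V W
  have key : ∀ g : Module.End ℂ (V.carrier ⊗[ℂ] W.carrier),
      LinearMap.trace ℂ (V.carrier ⊗[ℂ] W.carrier) (TensorProduct.map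
        (V.ρ (UqH.gen r .Kinv ^ (r - 1))) (W.ρ (UqH.gen r .Kinv ^ (r - 1))) *
          (TensorProduct.map θ (1 : Module.End ℂ W.carrier) * g)) =
      qtrace V (θ * partialTraceLin V W g) := by
    intro g
    induction g using end_tensor_induction V W with
    | h0 B C =>
      rw [partialTraceLin_map, ← TensorProduct.map_mul, ← TensorProduct.map_mul,
        LinearMap.trace_tensorProduct', mul_smul_comm, map_smul, qtrace_apply, one_mul, smul_eq_mul,
        mul_comm]
    | ha f g hf hg =>
      rw [partialTraceLin_add, mul_add, mul_add, mul_add, map_add, map_add, hf, hg]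
  rw [qtrace_apply, hK]
  exact key f.1

/-! ### Projectivity through averaging -/

variable {r : ℕ} {U V W : WeightModule r}

/-- The projection to a weight space is given by an element of the algebra, a polynomial in `H`. -/
theorem exists_weight_projection (M : WeightModule r) (μ : ℂ) : ∃ x : UqH r,
    (∀ v, M.act .H (M.ρ x v) = μ • M.ρ x v) ∧
    ∀ (N : WeightModule r) (w : N.carrier), N.act .H w = μ • w → N.ρ x w = w := by
  classical
  obtain ⟨ι, b, wt, hb⟩ := M.exists_weight_basis
  have : Finite ι := Module.Finite.finite_basis b
  have : Fintype ι := Fintype.ofFinite ι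
  let S : Finset ℂ := (Finset.univ.image wt).erase μ
  let p : Polynomial ℂ := ∏ ν ∈ S, Polynomial.C (μ - ν)⁻¹ * (Polynomial.X - Polynomial.C ν)
  have hp : p.eval μ = 1 := by
    rw [Polynomial.eval_prod]
    refine Finset.prod_eq_one fun ν hν => ?_
    have : μ - ν ≠ 0 := sub_ne_zero.mpr (Ne.symm (Finset.ne_of_mem_erase hν))
    simp [this]
  have hp0 : ∀ j, wt j ≠ μ → p.eval (wt j) = 0 := by
    intro j hj
    rw [Polynomial.eval_prod]
    exact Finset.prod_eq_zero (i := wt j) (by simp [S, hj]) (by simp)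
  have hev : ∀ (N : WeightModule r) (w : N.carrier) (ν : ℂ), N.act .H w = ν • w →
      N.ρ (Polynomial.aeval (UqH.gen r .H) p) w = p.eval ν • w := by
    intro N w ν hw
    rw [← Polynomial.aeval_algHom_apply]
    by_cases h0 : w = 0
    · rw [h0, map_zero, smul_zero]
    · exact Module.End.aeval_apply_of_hasEigenvector
        ⟨Module.End.mem_eigenspace_iff.mpr hw, h0⟩
  refine ⟨Polynomial.aeval (UqH.gen r .H) p, fun v => ?_, fun N w hw => ?_⟩
  · refine LinearMap.congr_fun (f := M.act .H ∘ₗ M.ρ (Polynomial.aeval (UqH.gen r .H) p))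
      (g := μ • M.ρ (Polynomial.aeval (UqH.gen r .H) p)) (b.ext fun j => ?_) v
    rw [LinearMap.comp_apply, LinearMap.smul_apply, hev M _ _ (hb j).1, map_smul, (hb j).1,
      smul_comm]
    by_cases h : wt j = μ
    · rw [h]
    · rw [hp0 j h, zero_smul, smul_zero, smul_zero]
  · rw [hev N w μ hw, hp, one_smul]

/-- Along a surjective homomorphism, linear maps that preserve weights can be lifted. -/
theorem exists_preservesWeight_lift {P M N : WeightModule r} (g : Hom M N)
    (f : P.carrier →ₗ[ℂ] N.carrier) (hf : PreservesWeight f) (hg : Function.Surjective g.1) :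
    ∃ s : P.carrier →ₗ[ℂ] M.carrier, PreservesWeight s ∧ g.1 ∘ₗ s = f := by
  obtain ⟨ι, b, wt, hb⟩ := P.exists_weight_basis
  have key : ∀ j, ∃ m : M.carrier, M.act .H m = wt j • m ∧ g.1 m = f (b j) := by
    intro j
    obtain ⟨m, hm⟩ := hg (f (b j))
    obtain ⟨x, hx1, hx2⟩ := M.exists_weight_projection (wt j)
    refine ⟨M.ρ x m, hx1 m, ?_⟩
    rw [g.2 x m, hm]
    refine hx2 N _ ?_
    rw [hf.apply, (hb j).1, map_smul]
  choose m hm1 hm2 using key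
  refine ⟨b.constr ℂ m, b.ext fun j => ?_, b.ext fun j => ?_⟩
  · rw [LinearMap.comp_apply, LinearMap.comp_apply, (hb j).1, map_smul, b.constr_basis, hm1]
  · rw [LinearMap.comp_apply, b.constr_basis, hm2]

theorem IsProjective.exists_section {V Q : WeightModule r} (hV : IsProjective V) (p : Hom Q V)
    (hp : Function.Surjective p.1) : ∃ s : Hom V Q, compHom p s = idHom V := hV Q V p _ hp

/-- A module whose identity is an average of a weight preserving map. -/
def IsAveraged (P : WeightModule r) : Prop :=
  ∃ θ : Module.End ℂ P.carrier, PreservesWeight θ ∧ average P P θ = 1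

theorem IsProjective.isAveraged_of_surjective {V Q : WeightModule r} (hV : IsProjective V)
    (hQ : IsAveraged Q) (p : Hom Q V) (hp : Function.Surjective p.1) : IsAveraged V := by
  obtain ⟨s, hs⟩ := hV.exists_section p hp
  obtain ⟨θ, hθ, h1⟩ := hQ
  refine ⟨p.1 ∘ₗ θ ∘ₗ s.1, (hom_preservesWeight p).comp (hθ.comp (hom_preservesWeight s)), ?_⟩
  rw [average_hom_comp, average_comp_hom, h1]
  exact congrArg Subtype.val hs

/-! ### Averages of maps of rank one -/

/-- Evaluation of the average of `θ` on a vector killed by `F`. -/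
theorem average_apply_of_act_F_eq_zero {θ : U.carrier →ₗ[ℂ] V.carrier} {w : U.carrier} {ν : ℂ}
    (hF : U.act .F w = 0) (hH : U.act .H w = ν • w)
    (h0 : ∀ j, j < r - 1 → θ ((U.act .E ^ j) w) = 0) :
    average U V θ w = ((-1) ^ (r - 1) *
      qpow r (-(((r - 1 : ℕ) : ℂ) * ν + ((r - 1 : ℕ) : ℂ) * (((r - 1 : ℕ) : ℂ) - 1)))) •
        (V.act .F ^ (r - 1)) (θ ((U.act .E ^ (r - 1)) w)) := by
  generalize hn : r - 1 = n at *
  have hK := U.act_K_of_weight hH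
  have R := U.act_relations
  have hstep : ∀ (η : U.carrier →ₗ[ℂ] V.carrier) (j : ℕ), adE U V η ((U.act .E ^ j) w) =
      qpow r (-(ν + 2 * j)) • (V.act .E (η ((U.act .E ^ j) w)) - η ((U.act .E ^ (j + 1)) w)) := by
    intro η j
    have h1 := R.kinv_eigen (R.k_e_pow hK j)
    simp only [adE, LinearMap.sub_apply, sandwich_apply, LinearMap.comp_apply,
      Module.End.mul_apply, Module.End.one_apply, h1, map_smul, smul_sub, pow_succ']
  -- `E ^ j w` is killed by `θ` for `j < r - 1`, so only one term of `adE ^ (r-1) θ` survives on `w`.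
  have hE0 : ∀ m j, m + j < n → (adE U V ^ m) θ ((U.act .E ^ j) w) = 0 := by
    intro m
    induction m with
    | zero => intro j hj; exact h0 j (by omega)
    | succ m ih =>
      intro j hj
      rw [pow_succ', Module.End.mul_apply, hstep, ih j (by omega), ih (j + 1) (by omega), map_zero,
        sub_zero, smul_zero]
  have hE : ∀ m j, m + j = n → (adE U V ^ m) θ ((U.act .E ^ j) w) =
      ((-1) ^ m * qpow r (-(m * ν + 2 * m * n - m * (m + 1)))) • θ ((U.act .E ^ n) w) := by
    intro m
    induction m with
    | zero => intro j hj; simp [qpow_zero, ← hj]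
    | succ m ih =>
      intro j hj
      rw [pow_succ', Module.End.mul_apply, hstep, hE0 m j (by omega), ih (j + 1) (by omega),
        map_zero, zero_sub, smul_neg, smul_smul, ← neg_smul]
      congr 1
      rw [← hj, show -(((m + 1 : ℕ) : ℂ) * ν + 2 * ((m + 1 : ℕ) : ℂ) * ((m + 1 + j : ℕ) : ℂ) -
        ((m + 1 : ℕ) : ℂ) * (((m + 1 : ℕ) : ℂ) + 1)) = -(ν + 2 * j) +
        -(m * ν + 2 * m * ((m + 1 + j : ℕ) : ℂ) - m * (m + 1)) by push_cast; ring,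
        qpow_add r (-(ν + 2 * j)), pow_succ]
      ring
  -- The second term of `adF` does not contribute since `F w = 0`.
  have hFm : ∀ (η : U.carrier →ₗ[ℂ] V.carrier) (m : ℕ), (adF U V ^ m) η w =
      (V.act .F ^ m) (η w) := by
    intro η m
    induction m with
    | zero => rfl
    | succ m ih =>
      rw [pow_succ', Module.End.mul_apply, pow_succ', Module.End.mul_apply, ← ih]
      simp [adF, sandwich_apply, hF]
  have h1 := hE n 0 (by omega)
  rw [pow_zero, Module.End.one_apply] at h1
  rw [average, hn, Module.End.mul_apply, hFm, h1, map_smul]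
  congr 3
  ring

/-- A linear form that vanishes off the weight space of weight `μ`. -/
def IsWeightForm (μ : ℂ) (φ : V.carrier →ₗ[ℂ] ℂ) : Prop := ∀ v, φ (V.act .H v) = μ * φ v

theorem IsWeightForm.eq_zero {μ ν : ℂ} {φ : V.carrier →ₗ[ℂ] ℂ} (hφ : IsWeightForm μ φ)
    {v : V.carrier} (hv : V.act .H v = ν • v) (h : ν ≠ μ) : φ v = 0 := by
  have h1 := hφ v
  rw [hv, map_smul, smul_eq_mul] at h1
  by_contra h0
  exact h (mul_right_cancel₀ h0 h1)

theorem IsWeightForm.preservesWeight {μ : ℂ} {φ : U.carrier →ₗ[ℂ] ℂ} (hφ : IsWeightForm μ φ)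
    {v : V.carrier} (hv : V.act .H v = μ • v) : PreservesWeight (φ.smulRight v) := by
  ext u
  simp only [LinearMap.comp_apply, LinearMap.smulRight_apply, map_smul, hv, hφ u, smul_smul]
  rw [mul_comm]

/-- The quantum trace of a weight preserving map of rank one. -/
theorem qtrace_smulRight (φ : V.carrier →ₗ[ℂ] ℂ) {v : V.carrier} {μ : ℂ}
    (hv : V.act .H v = μ • v) :
    qtrace V (φ.smulRight v) = qpow r (-(((r - 1 : ℕ) : ℂ) * μ)) * φ v := by
  have h1 : ∀ m : ℕ, (V.act .Kinv ^ m) v = qpow r (-(m * μ)) • v := by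
    intro m
    induction m with
    | zero => simp [qpow_zero]
    | succ m ih =>
      rw [pow_succ', Module.End.mul_apply, ih, map_smul,
        V.act_relations.kinv_eigen (V.act_K_of_weight hv), smul_smul, ← qpow_add]
      congr 2; push_cast; ring
  have h2 : V.ρ (UqH.gen r .Kinv ^ (r - 1)) * φ.smulRight v =
      φ.smulRight ((V.act .Kinv ^ (r - 1)) v) := by
    ext u; simp [map_pow]
  rw [qtrace_apply, h2, h1, LinearMap.trace_smulRight, map_smul, smul_eq_mul]

variable [hr : Fact (2 ≤ r)]

/-- The average of a map `φ ⊗ v` of rank one, evaluated on a vector `w` that is killed by `F` and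
lies `r - 1` steps below the weight of `v`. -/
theorem average_smulRight_apply {φ : U.carrier →ₗ[ℂ] ℂ} {μ : ℂ} (hφ : IsWeightForm μ φ)
    (v : V.carrier) {w : U.carrier} (hF : U.act .F w = 0)
    (hH : U.act .H w = (μ - 2 * ((r - 1 : ℕ) : ℂ)) • w) :
    average U V (φ.smulRight v) w =
      (qpow r (-(((r - 1 : ℕ) : ℂ) * μ)) * φ ((U.act .E ^ (r - 1)) w)) •
        (V.act .F ^ (r - 1)) v := by
  rw [average_apply_of_act_F_eq_zero hF hH, LinearMap.smulRight_apply, map_smul, smul_smul]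
  · congr 2
    have hs : ((r - 1 : ℕ) : ℂ) = r - 1 := by
      rw [Nat.cast_sub (by have := hr.out; omega), Nat.cast_one]
    rw [show -(((r - 1 : ℕ) : ℂ) * (μ - 2 * ((r - 1 : ℕ) : ℂ)) +
      ((r - 1 : ℕ) : ℂ) * (((r - 1 : ℕ) : ℂ) - 1)) = ((r - 1 : ℕ) : ℂ) * r +
        -(((r - 1 : ℕ) : ℂ) * μ) by rw [hs]; ring, qpow_add, qpow_natCast_mul, qpow_self hr.out,
      ← mul_assoc, ← mul_pow]
    simp
  · intro j hj
    rw [LinearMap.smulRight_apply, hφ.eq_zero (U.act_relations.h_e_pow hH j), zero_smul]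
    intro h
    have h1 : (j : ℂ) = ((r - 1 : ℕ) : ℂ) := by linear_combination h / 2
    have h2 : j = r - 1 := by exact_mod_cast h1
    omega

/-! ### Averaged modules are projective -/

/-- A module is projective if its identity is an average of a weight preserving map. -/
theorem isProjective_of_average {P : WeightModule r} {θ : Module.End ℂ P.carrier}
    (hθ : PreservesWeight θ) (h : average P P θ = 1) : IsProjective P := by
  intro M N g f hg
  obtain ⟨s, hs, hgs⟩ := exists_preservesWeight_lift g f.1 (hom_preservesWeight f) hg
  refine ⟨averageHom (hs.comp hθ), Subtype.ext ?_⟩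
  change g.1 ∘ₗ average P M (s ∘ₗ θ) = f.1
  rw [← average_hom_comp, ← LinearMap.comp_assoc, hgs, average_hom_comp, h]
  rfl

theorem IsAveraged.isProjective {P : WeightModule r} (h : IsAveraged P) : IsProjective P := by
  obtain ⟨θ, hθ, h1⟩ := h
  exact isProjective_of_average hθ h1

theorem IsAveraged.tensor {P : WeightModule r} (h : IsAveraged P) (W : WeightModule r) :
    IsAveraged (P.tensor W) := by
  obtain ⟨θ, hθ, h1⟩ := h
  refine ⟨tensorLeft W θ, hθ.tensorLeft, ?_⟩
  rw [average_tensorLeft, h1]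
  exact tensor_ext fun v w => rfl

/-! ### The trace on averaged modules -/

/-- The trace of an endomorphism does not depend on the weight preserving map whose average is the
identity, and it takes `average η` to the quantum trace of `η`. -/
theorem qtrace_comp_average_of_eq_one {P : WeightModule r} {θ η : Module.End ℂ P.carrier}
    (hθ : PreservesWeight θ) (h : average P P θ = 1) (hη : PreservesWeight η) :
    qtrace P (θ * average P P η) = qtrace P η := by
  have := qtrace_comp_average hθ hη
  rw [h] at this
  exact this

/-- The linear form `f ↦ qtrace (θ f)` with `average θ = 1` is cyclic; for `U = V` and `f = id` this
shows that it does not depend on `θ`. -/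
theorem qtrace_average_cyclic {U V : WeightModule r} {θ : Module.End ℂ U.carrier}
    {η : Module.End ℂ V.carrier} (hθ : PreservesWeight θ) (h : average U U θ = 1)
    (hη : PreservesWeight η) (h' : average V V η = 1) (f : Hom U V) (g : Hom V U) :
    qtrace U (θ ∘ₗ g.1 ∘ₗ f.1) = qtrace V (η ∘ₗ f.1 ∘ₗ g.1) := by
  have h1 : g.1 ∘ₗ f.1 = average U U (g.1 ∘ₗ η ∘ₗ f.1) := by
    rw [average_hom_comp, average_comp_hom, h']; rfl
  have hw : PreservesWeight (g.1 ∘ₗ η ∘ₗ f.1) :=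
    (hom_preservesWeight g).comp (hη.comp (hom_preservesWeight f))
  rw [h1, ← Module.End.mul_eq_comp, qtrace_comp_average_of_eq_one hθ h hw]
  rw [← LinearMap.comp_assoc, qtrace_comp_hom, ← LinearMap.comp_assoc]
  exact (qtrace_comp_hom (compHom f g) η).symm

/-! ### Highest weight modules -/

theorem qnum_eq_zero_iff {r : ℕ} (hr : 2 ≤ r) {z : ℂ} : qnum r z = 0 ↔ ∃ m : ℤ, z = m * r := by
  have h0 : (r : ℂ) ≠ 0 := by exact_mod_cast (by omega : r ≠ 0)
  have hpi : (Real.pi : ℂ) ≠ 0 := by exact_mod_cast Real.pi_ne_zero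
  constructor
  · intro h
    rw [qnum, div_eq_zero_iff, or_iff_left (qpow_one_sub_ne_zero hr), sub_eq_zero] at h
    have h1 : qpow r (2 * z) = 1 := by
      rw [two_mul, qpow_add]; nth_rewrite 1 [h]; rw [← qpow_add, neg_add_cancel, qpow_zero]
    rw [qpow, Complex.exp_eq_one_iff] at h1
    obtain ⟨m, hm⟩ := h1
    refine ⟨m, ?_⟩
    have h2 : (2 * Real.pi * Complex.I) * z = (2 * Real.pi * Complex.I) * (m * r) := by
      field_simp at hm
      linear_combination (2 * Real.pi * Complex.I) * hm
    exact mul_left_cancel₀ (by simp [hpi]) h2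
  · rintro ⟨m, rfl⟩
    have := qnum_int_mul_self_add hr m 0
    rw [add_zero, qnum_zero, mul_zero] at this
    exact this

theorem qnum_natCast_ne_zero {r : ℕ} (hr : 2 ≤ r) {k : ℕ} (h0 : 0 < k) (hk : k < r) :
    qnum r k ≠ 0 := by
  intro h
  obtain ⟨m, hm⟩ := (qnum_eq_zero_iff hr).mp h
  have h1 : (k : ℤ) = m * r := by exact_mod_cast hm
  have h2 : (r : ℤ) ∣ k := ⟨m, by rw [h1, mul_comm]⟩
  have := Int.le_of_dvd (by omega) h2
  omega

section OfWeights

variable {r : ℕ} {ι : Type} [DecidableEq ι] [Finite ι] {wt : ι → ℂ} {e f : Module.End ℂ (ι → ℂ)}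
  (he : ∀ j, LinearMap.mulLeft ℂ wt (e (Pi.single j 1)) = (wt j + 2) • e (Pi.single j 1))
  (hf : ∀ j, LinearMap.mulLeft ℂ wt (f (Pi.single j 1)) = (wt j - 2) • f (Pi.single j 1))
  (hef : ∀ j, e (f (Pi.single j 1)) - f (e (Pi.single j 1)) =
    qnum r (wt j) • Pi.single j (1 : ℂ))
  (her : e ^ r = 0) (hfr : f ^ r = 0)

theorem act_ofWeights_E : (ofWeights r wt e f he hf hef her hfr).act .E = e :=
  UqH.lift_gen (relations_of_weights he hf hef her hfr) _

theorem act_ofWeights_F : (ofWeights r wt e f he hf hef her hfr).act .F = f :=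
  UqH.lift_gen (relations_of_weights he hf hef her hfr) _

theorem act_ofWeights_K : (ofWeights r wt e f he hf hef her hfr).act .K =
    LinearMap.mulLeft ℂ fun j => qpow r (wt j) :=
  UqH.lift_gen (relations_of_weights he hf hef her hfr) _

theorem act_ofWeights_Kinv : (ofWeights r wt e f he hf hef her hfr).act .Kinv =
    LinearMap.mulLeft ℂ fun j => qpow r (-wt j) :=
  UqH.lift_gen (relations_of_weights he hf hef her hfr) _

theorem act_ofWeights_H : (ofWeights r wt e f he hf hef her hfr).act .H = LinearMap.mulLeft ℂ wt :=
  UqH.lift_gen (relations_of_weights he hf hef her hfr) _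

end OfWeights

section HighestWeight

variable {r : ℕ} [hr : Fact (2 ≤ r)] {n : ℕ} {hn : n ≤ r} {l : ℂ}
  {h : qnum r n * qnum r (l + 1 - n) = 0}

variable (hn h) in
/-- The vector `v_k` of a highest weight module (zero for `n ≤ k`). -/
def hwVec (k : ℕ) : (highestWeight r n hn l h).carrier := chainVec (ι := Fin n) id k

variable (hn h) in
/-- The `k`-th coordinate on a highest weight module. -/
def hwCoord (k : Fin n) : (highestWeight r n hn l h).carrier →ₗ[ℂ] ℂ :=
  LinearMap.proj (R := ℂ) (φ := fun _ : Fin n => ℂ) k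

theorem hwVec_of_le {k : ℕ} (hk : n ≤ k) : hwVec hn h k = 0 := chainVec_of_le _ hk

theorem hwCoord_hwVec (k : Fin n) (m : ℕ) :
    hwCoord hn h k (hwVec hn h m) = if (k : ℕ) = m then 1 else 0 := by
  change chainVec (ι := Fin n) id m k = _
  by_cases hm : m < n
  · rw [chainVec_of_lt _ hm, Pi.single_apply]
    simp [Fin.ext_iff]
  · rw [chainVec_of_le _ (by omega), if_neg (by omega)]; rfl

theorem hw_ext {M : Type*} [AddCommGroup M] [Module ℂ M]
    {f g : (highestWeight r n hn l h).carrier →ₗ[ℂ] M}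
    (hfg : ∀ k, k < n → f (hwVec hn h k) = g (hwVec hn h k)) : f = g := by
  refine (Pi.basisFun ℂ (Fin n)).ext (f₁ := f) (f₂ := g) fun j => ?_
  have := hfg j j.2
  rw [hwVec, chainVec_coe] at this
  rw [Pi.basisFun_apply]
  exact this

theorem hw_expand (u : (highestWeight r n hn l h).carrier) :
    u = ∑ k : Fin n, hwCoord hn h k u • hwVec hn h k := by
  refine LinearMap.congr_fun (f := LinearMap.id)
    (g := ∑ k : Fin n, (hwCoord hn h k).smulRight (hwVec hn h k)) ?_ u |>.trans ?_
  · refine hw_ext fun k hk => ?_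
    rw [LinearMap.sum_apply, Finset.sum_eq_single (⟨k, hk⟩ : Fin n)]
    · simp [hwCoord_hwVec]
    · intro b _ hb
      have : (b : ℕ) ≠ k := fun h => hb (Fin.ext h)
      simp [hwCoord_hwVec, this]
    · simp
  · simp [LinearMap.sum_apply]

theorem hw_E {k : ℕ} (hk : k < n) : (highestWeight r n hn l h).act .E (hwVec hn h k) =
    (qnum r k * qnum r (l + 1 - k)) • hwVec hn h (k - 1) := by
  have h1 : (highestWeight r n hn l h).act .E = opOfBasis fun k : Fin n =>
    (qnum r (k : ℕ) * qnum r (l + 1 - (k : ℕ))) • chainVec id ((k : ℕ) - 1) := by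
    unfold highestWeight
    apply act_ofWeights_E
  rw [h1]
  exact opOfBasis_chainVec _ _ hk

theorem hw_F (k : ℕ) : (highestWeight r n hn l h).act .F (hwVec hn h k) = hwVec hn h (k + 1) := by
  have h1 : (highestWeight r n hn l h).act .F =
    opOfBasis fun k : Fin n => chainVec (ι := Fin n) id ((k : ℕ) + 1) := by
    unfold highestWeight
    apply act_ofWeights_F
  by_cases hk : k < n
  · rw [h1]
    exact opOfBasis_chainVec _ _ hk
  · rw [hwVec_of_le (by omega), hwVec_of_le (by omega), map_zero]

theorem hw_H (k : ℕ) : (highestWeight r n hn l h).act .H (hwVec hn h k) =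
    (l - 2 * k) • hwVec hn h k := by
  have h1 : (highestWeight r n hn l h).act .H =
    LinearMap.mulLeft ℂ fun k : Fin n => l - 2 * (k : ℕ) := by
    unfold highestWeight
    apply act_ofWeights_H
  by_cases hk : k < n
  · have h2 : hwVec hn h k = (Pi.single (⟨k, hk⟩ : Fin n) 1 : Fin n → ℂ) := chainVec_of_lt _ hk
    rw [h1, h2]
    exact mulLeft_single _ _
  · rw [hwVec_of_le (by omega), map_zero, smul_zero]

theorem hw_F_pow (m k : ℕ) : ((highestWeight r n hn l h).act .F ^ m) (hwVec hn h k) =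
    hwVec hn h (k + m) := by
  induction m generalizing k with
  | zero => rfl
  | succ m ih => rw [pow_succ, Module.End.mul_apply, hw_F, ih]; congr 1; ring

/-- An endomorphism of a highest weight module is a scalar. -/
theorem hw_end_scalar (hn0 : 0 < n)
    (f : Hom (highestWeight r n hn l h) (highestWeight r n hn l h)) :
    ∃ c : ℂ, f = c • idHom _ := by
  refine ⟨hwCoord hn h ⟨0, hn0⟩ (f.1 (hwVec hn h 0)), Subtype.ext ?_⟩
  set c := hwCoord hn h ⟨0, hn0⟩ (f.1 (hwVec hn h 0)) with hc
  have h0 : f.1 (hwVec hn h 0) = c • hwVec hn h 0 := by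
    have hw := hom_act f .H (hwVec hn h 0)
    rw [hw_H, map_smul, Nat.cast_zero, mul_zero, sub_zero] at hw
    rw [hw_expand (f.1 (hwVec hn h 0)), Finset.sum_eq_single (⟨0, hn0⟩ : Fin n)]
    · intro b _ hb
      have hb0 : (b : ℕ) ≠ 0 := fun h => hb (Fin.ext h)
      have h1 : hwCoord hn h b ∘ₗ (highestWeight r n hn l h).act .H =
          (l - 2 * (b : ℕ)) • hwCoord hn h b := by
        refine hw_ext fun k hk => ?_
        rw [LinearMap.comp_apply, hw_H, map_smul, LinearMap.smul_apply, hwCoord_hwVec]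
        split_ifs with hbk
        · rw [hbk]
        · simp
      have h2 := LinearMap.congr_fun h1 (f.1 (hwVec hn h 0))
      rw [LinearMap.comp_apply, ← hw, map_smul, LinearMap.smul_apply, smul_eq_mul,
        smul_eq_mul, sub_mul] at h2
      have h3 : (2 * ((b : ℕ) : ℂ)) * hwCoord hn h b (f.1 (hwVec hn h 0)) = 0 := by
        linear_combination h2
      have h4 : (2 * ((b : ℕ) : ℂ)) ≠ 0 := by
        have : ((b : ℕ) : ℂ) ≠ 0 := by exact_mod_cast hb0
        simpa using this
      rw [(mul_eq_zero.mp h3).resolve_left h4, zero_smul]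
    · simp
  refine hw_ext fun k _ => ?_
  have h1 : f.1 (hwVec hn h k) = ((highestWeight r n hn l h).act .F ^ k) (f.1 (hwVec hn h 0)) := by
    rw [← map_pow, ← f.2, map_pow, hw_F_pow, zero_add]
  rw [h1, h0, map_smul, hw_F_pow, zero_add]
  rfl

end HighestWeight

/-! ### The identity of `V₀` as an average -/

variable {r : ℕ}

variable [hr : Fact (2 ≤ r)]

variable (r) in
/-- The scalar by which `E ^ (r-1) F ^ (r-1)` acts on a highest weight vector of weight `μ`. -/
def kappa (μ : ℂ) : ℂ :=
  ∏ j ∈ Finset.range (r - 1), qnum r (j + 1) * qnum r (μ + 1 - (j + 1))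

variable (r) in
/-- The module `V₀` as a highest weight module. -/
abbrev steinberg : WeightModule r :=
  highestWeight r r le_rfl (0 + r - 1) (by rw [qnum_self hr.out, zero_mul])

variable (r) in
/-- The basis vector `v_k` of `V₀`. -/
abbrev stVec (k : ℕ) : (steinberg r).carrier :=
  hwVec le_rfl (by rw [qnum_self hr.out, zero_mul]) k

variable (r) in
/-- The `k`-th coordinate on `V₀`. -/
abbrev stCoord (k : Fin r) : (steinberg r).carrier →ₗ[ℂ] ℂ :=
  hwCoord le_rfl (by rw [qnum_self hr.out, zero_mul]) k

theorem qnum_sub_self {r : ℕ} (hr : 2 ≤ r) (z : ℂ) : qnum r (r - z) = qnum r z := by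
  have := qnum_int_mul_self_add hr 1 (-z)
  rw [Int.cast_one, one_mul, ← sub_eq_add_neg, qnum_neg] at this
  rw [this]; simp

theorem kappa_steinberg_ne_zero : kappa r (0 + r - 1) ≠ 0 := by
  refine Finset.prod_ne_zero_iff.mpr fun j hj => ?_
  have hj' : j < r - 1 := Finset.mem_range.mp hj
  have h1 : qnum r ((j : ℂ) + 1) ≠ 0 := by
    have := qnum_natCast_ne_zero hr.out (k := j + 1) (by omega) (by omega)
    rwa [Nat.cast_add, Nat.cast_one] at this
  refine mul_ne_zero h1 ?_
  rw [show (0 + r - 1 + 1 - (j + 1) : ℂ) = r - (j + 1) by ring, qnum_sub_self hr.out]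
  exact h1

/-- The projection of `V₀` to its highest weight line averages to a nonzero scalar. -/
theorem average_steinberg :
    IsWeightForm (0 + r - 1 : ℂ) (stCoord r ⟨0, by have := hr.out; omega⟩) ∧
    average (steinberg r) (steinberg r)
        ((stCoord r ⟨0, by have := hr.out; omega⟩).smulRight (stVec r 0)) =
      (qpow r (-(((r - 1 : ℕ) : ℂ) * (0 + r - 1))) * kappa r (0 + r - 1)) •
        (1 : Module.End ℂ (steinberg r).carrier) := by
  have h2 := hr.out
  set φ := stCoord r ⟨0, by omega⟩ with hφ
  have hw : IsWeightForm (0 + r - 1 : ℂ) φ := by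
    have h1 : φ ∘ₗ (steinberg r).act .H = (0 + r - 1 : ℂ) • φ := by
      refine hw_ext fun k hk => ?_
      rw [LinearMap.comp_apply, hw_H, map_smul, LinearMap.smul_apply, hφ, hwCoord_hwVec]
      split_ifs with h
      · rw [← h]; simp
      · simp
    exact fun v => LinearMap.congr_fun h1 v
  have hH0 : (steinberg r).act .H (stVec r 0) = (0 + r - 1 : ℂ) • stVec r 0 := by
    rw [hw_H]; simp
  refine ⟨hw, ?_⟩
  obtain ⟨c, hc⟩ := hw_end_scalar (by omega) (averageHom (hw.preservesWeight hH0))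
  have hc' : average (steinberg r) (steinberg r) (φ.smulRight (stVec r 0)) =
      c • (1 : Module.End ℂ (steinberg r).carrier) := congrArg Subtype.val hc
  rw [hc']
  congr 1
  have hlow : ((steinberg r).act .F ^ (r - 1)) (stVec r 0) = stVec r (r - 1) := by
    rw [hw_F_pow, Nat.zero_add]
  have hE0 : (steinberg r).act .E (stVec r 0) = 0 := by
    rw [hw_E (by omega), Nat.cast_zero, qnum_zero, zero_mul, zero_smul]
  have h3 := average_smulRight_apply (U := steinberg r) (V := steinberg r) hw (stVec r 0)
    (w := stVec r (r - 1)) (by rw [hw_F, hwVec_of_le (by omega)]) (by rw [hw_H])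
  have h4 := (steinberg r).act_relations.e_pow_f_pow_highest h2
    ((steinberg r).act_K_of_weight hH0) hE0 (r - 1)
  rw [hlow] at h4
  rw [hlow, hc', h4, map_smul, hφ, hwCoord_hwVec, if_pos rfl, smul_eq_mul, mul_one] at h3
  have h5 := congrArg (stCoord r ⟨r - 1, by omega⟩) h3
  rw [LinearMap.smul_apply, Module.End.one_apply, map_smul, map_smul, hwCoord_hwVec, if_pos rfl,
    smul_eq_mul, smul_eq_mul, mul_one, mul_one] at h5
  exact h5

theorem isAveraged_steinberg : IsAveraged (steinberg r) := by
  have hH0 : (steinberg r).act .H (stVec r 0) = (0 + r - 1 : ℂ) • stVec r 0 := by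
    rw [hw_H]; simp
  obtain ⟨h1, h2⟩ := average_steinberg (r := r)
  refine ⟨_, (h1.preservesWeight hH0).smul
    (qpow r (-(((r - 1 : ℕ) : ℂ) * (0 + r - 1))) * kappa r (0 + r - 1))⁻¹, ?_⟩
  rw [map_smul, h2, smul_smul, inv_mul_cancel₀ (mul_ne_zero (qpow_ne_zero _ _)
    kappa_steinberg_ne_zero), one_smul]

/-! ### The invariant pairing on `V₀` -/

/-- The coefficients of the invariant pairing on `V₀`:
`v_k ⊗ v_{r-1-k} ↦ (-1) ^ k q ^ (-k (r-k))`. -/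
def pairingCoeff (r k : ℕ) : ℂ := (-1) ^ k * qpow r (-(k * (r - k)))

theorem pairingCoeff_succ (r k : ℕ) :
    pairingCoeff r (k + 1) = -qpow r (-(r - 1 - 2 * k)) * pairingCoeff r k := by
  rw [pairingCoeff, pairingCoeff, show -(((k + 1 : ℕ) : ℂ) * (r - ((k + 1 : ℕ) : ℂ))) =
    -(r - 1 - 2 * k) + -(k * (r - k)) by push_cast; ring, qpow_add, pow_succ]
  ring

variable (r) in
/-- The invariant pairing `V₀ ⊗ V₀ → ℂ`. -/
def stPairing : ((steinberg r).tensor (steinberg r)).carrier →ₗ[ℂ] ℂ :=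
  TensorProduct.lift (∑ k : Fin r, pairingCoeff r k • (stCoord r k).smulRight (stCoord r k.rev))

theorem stPairing_tmul {a b : ℕ} (ha : a < r) :
    stPairing r (tmul (stVec r a) (stVec r b)) =
      if a + b = r - 1 then pairingCoeff r a else 0 := by
  have h1 : stPairing r (tmul (stVec r a) (stVec r b)) =
      (∑ k : Fin r, pairingCoeff r k • (stCoord r k).smulRight (stCoord r k.rev))
        (stVec r a) (stVec r b) := TensorProduct.lift.tmul _ _
  rw [h1, LinearMap.sum_apply, LinearMap.sum_apply, Finset.sum_eq_single (⟨a, ha⟩ : Fin r)]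
  · simp only [LinearMap.smul_apply, LinearMap.smulRight_apply, hwCoord_hwVec, Fin.val_rev]
    by_cases h : a + b = r - 1
    · rw [if_pos trivial, if_pos (by omega), if_pos h]; simp
    · rw [if_pos trivial, if_neg (by omega), if_neg h]; simp
  · intro k _ hk
    have : (k : ℕ) ≠ a := fun h => hk (Fin.ext h)
    simp [hwCoord_hwVec, this]
  · simp

theorem tmul_smul_left {V W : WeightModule r} (c : ℂ) (v : V.carrier) (w : W.carrier) :
    tmul (c • v) w = c • tmul v w := rfl

theorem tmul_smul_right {V W : WeightModule r} (c : ℂ) (v : V.carrier) (w : W.carrier) :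
    tmul v (c • w) = c • tmul v w := TensorProduct.tmul_smul c v w

theorem tmul_zero_left {V W : WeightModule r} (w : W.carrier) :
    tmul (0 : V.carrier) w = 0 := TensorProduct.zero_tmul _ w

theorem st_tensor_ext {f g : ((steinberg r).tensor (steinberg r)).carrier →ₗ[ℂ] ℂ}
    (h : ∀ a b, a < r → b < r →
      f (tmul (stVec r a) (stVec r b)) = g (tmul (stVec r a) (stVec r b))) : f = g := by
  refine TensorProduct.ext (LinearMap.ext fun v => LinearMap.congr_fun
    (f := (TensorProduct.mk ℂ _ _).compr₂ f) (g := (TensorProduct.mk ℂ _ _).compr₂ g) ?_ v)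
  exact hw_ext fun a ha => hw_ext fun b hb => h a b ha hb

theorem stPairing_E : stPairing r ∘ₗ ((steinberg r).tensor (steinberg r)).act .E = 0 := by
  have h2 := hr.out
  refine st_tensor_ext fun a b ha hb => ?_
  rw [LinearMap.comp_apply, LinearMap.zero_apply, act_tensor_E, hw_E ha, hw_E hb,
    (steinberg r).act_K_of_weight (hw_H b), tmul_smul_left, tmul_smul_right, tmul_smul_right,
    map_add, map_smul, map_smul, map_smul, stPairing_tmul ha, stPairing_tmul (by omega)]
  rcases a with _ | a
  · rcases b with _ | b
    · simp [qnum_zero]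
    · rw [if_neg (by omega), Nat.cast_zero, qnum_zero]; simp
  · rcases b with _ | b
    · rw [if_neg (by omega : ¬ (a + 1 - 1 + 0 = r - 1)), Nat.cast_zero, qnum_zero]; simp
    · simp only [Nat.add_sub_cancel]
      by_cases h : a + 1 + b = r - 1
      · rw [if_pos h, if_pos (by omega), pairingCoeff_succ]
        have hc : (r : ℂ) = a + b + 2 := by exact_mod_cast (by omega : r = a + b + 2)
        have e1 : qnum r (((b + 1 : ℕ) : ℂ)) = qnum r (((a + 1 : ℕ) : ℂ)) := by
          rw [← qnum_sub_self h2]; congr 1; rw [hc]; push_cast; ring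
        have e2 : qnum r (0 + r - 1 + 1 - ((b + 1 : ℕ) : ℂ)) = qnum r (((b + 1 : ℕ) : ℂ)) := by
          rw [← qnum_sub_self h2]; congr 1; push_cast; ring
        have e3 : qnum r (0 + r - 1 + 1 - ((a + 1 : ℕ) : ℂ)) = qnum r (((a + 1 : ℕ) : ℂ)) := by
          rw [← qnum_sub_self h2 ((a + 1 : ℕ) : ℂ)]; congr 1; push_cast; ring
        rw [e2, e3, e1, show (0 + r - 1 - 2 * ((b + 1 : ℕ) : ℂ)) = -(r - 1 - 2 * a) by
          rw [hc]; push_cast; ring]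
        simp only [smul_eq_mul]
        ring
      · rw [if_neg h, if_neg (by omega)]; simp

theorem stPairing_F : stPairing r ∘ₗ ((steinberg r).tensor (steinberg r)).act .F = 0 := by
  have h2 := hr.out
  refine st_tensor_ext fun a b ha hb => ?_
  rw [LinearMap.comp_apply, LinearMap.zero_apply, act_tensor_F, hw_F, hw_F,
    (steinberg r).act_relations.kinv_eigen ((steinberg r).act_K_of_weight (hw_H a)),
    tmul_smul_left, map_add, map_smul, stPairing_tmul ha]
  by_cases ha' : a + 1 < r
  · rw [stPairing_tmul ha']
    by_cases h : a + 1 + b = r - 1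
    · rw [if_pos (by omega), if_pos h, pairingCoeff_succ, smul_eq_mul, zero_add]
      ring
    · rw [if_neg (by omega), if_neg h]; simp
  · rw [hwVec_of_le (by omega : r ≤ a + 1), tmul_zero_left, map_zero, if_neg (by omega)]; simp

theorem stPairing_H : stPairing r ∘ₗ ((steinberg r).tensor (steinberg r)).act .H = 0 := by
  have h2 := hr.out
  refine st_tensor_ext fun a b ha hb => ?_
  rw [LinearMap.comp_apply, LinearMap.zero_apply, act_tensor_H, hw_H, hw_H, tmul_smul_left,
    tmul_smul_right, ← add_smul, map_smul, stPairing_tmul ha]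
  split_ifs with h
  · have hc : (r : ℂ) = a + b + 1 := by exact_mod_cast (by omega : r = a + b + 1)
    rw [hc, show ((0 + (a + b + 1) - 1 - 2 * a + (0 + (a + b + 1) - 1 - 2 * b)) : ℂ) = 0 by ring,
      zero_smul]
  · simp

/-- A linear form on a weight module that is invariant, and nonzero at some vector, gives a
surjection from the tensor product with any module onto that module. -/
theorem exists_surjection_of_invariant_form {Z : WeightModule r} (p : Z.carrier →ₗ[ℂ] ℂ)
    (hE : p ∘ₗ Z.act .E = 0) (hF : p ∘ₗ Z.act .F = 0) (hH : p ∘ₗ Z.act .H = 0)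
    {z : Z.carrier} (hz : p z ≠ 0) (V : WeightModule r) :
    ∃ g : Hom (Z.tensor V) V, Function.Surjective g.1 := by
  have hK : ∀ u, p (Z.act .K u) = p u := by
    obtain ⟨ι, b, wt, hb⟩ := Z.exists_weight_basis
    refine fun u => LinearMap.congr_fun (f := p ∘ₗ Z.act .K) (g := p) (b.ext fun j => ?_) u
    have h1 := LinearMap.congr_fun hH (b j)
    rw [LinearMap.comp_apply, (hb j).1, map_smul, LinearMap.zero_apply, smul_eq_mul] at h1
    rw [LinearMap.comp_apply, (hb j).2, map_smul]
    rcases mul_eq_zero.mp h1 with h | h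
    · rw [h, qpow_zero, one_smul]
    · rw [h, smul_zero]
  have hK' : ∀ u, p (Z.act .Kinv u) = p u := fun u => by
    rw [← hK (Z.act .Kinv u), k_kinv_apply]
  let g : (Z.tensor V).carrier →ₗ[ℂ] V.carrier :=
    TensorProduct.lift (LinearMap.lsmul ℂ V.carrier ∘ₗ p)
  have hg : ∀ u v, g (tmul u v) = p u • v := fun u v => TensorProduct.lift.tmul _ _
  have hE' := fun u => LinearMap.congr_fun hE u
  have hF' := fun u => LinearMap.congr_fun hF u
  have hH' := fun u => LinearMap.congr_fun hH u
  simp only [LinearMap.comp_apply, LinearMap.zero_apply] at hE' hF' hH'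
  refine ⟨⟨g, mem_hom_of_generators ?_ ?_ ?_⟩, fun v => ⟨tmul ((p z)⁻¹ • z) v, ?_⟩⟩
  · refine fun x => LinearMap.congr_fun (f := g ∘ₗ (Z.tensor V).act .E) (g := V.act .E ∘ₗ g)
      (tensor_ext fun u v => ?_) x
    simp only [LinearMap.comp_apply, act_tensor_E, map_add, hg, hE', zero_smul, add_zero, map_smul]
  · refine fun x => LinearMap.congr_fun (f := g ∘ₗ (Z.tensor V).act .F) (g := V.act .F ∘ₗ g)
      (tensor_ext fun u v => ?_) x
    simp only [LinearMap.comp_apply, act_tensor_F, map_add, hg, hF', zero_smul, add_zero, map_smul,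
      hK']
  · refine fun x => LinearMap.congr_fun (f := g ∘ₗ (Z.tensor V).act .H) (g := V.act .H ∘ₗ g)
      (tensor_ext fun u v => ?_) x
    simp only [LinearMap.comp_apply, act_tensor_H, map_add, hg, hH', zero_smul, zero_add, map_smul]
  · change g _ = v
    rw [hg, map_smul, smul_eq_mul, inv_mul_cancel₀ hz, one_smul]

/-- Every weight module is a quotient of some `(V₀ ⊗ V₀) ⊗ V`, as `V₀` is self-dual. -/
theorem exists_surjection_from_steinberg (V : WeightModule r) :
    ∃ g : Hom (((steinberg r).tensor (steinberg r)).tensor V) V, Function.Surjective g.1 := by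
  refine exists_surjection_of_invariant_form (stPairing r) stPairing_E stPairing_F stPairing_H
    (z := tmul (stVec r 0) (stVec r (r - 1))) ?_ V
  rw [stPairing_tmul (by have := hr.out; omega), if_pos (by omega), pairingCoeff]
  simp [qpow_ne_zero]

/-- A weight module is projective exactly if its identity is an average. -/
theorem isProjective_iff_isAveraged {V : WeightModule r} : IsProjective V ↔ IsAveraged V := by
  refine ⟨fun h => ?_, IsAveraged.isProjective⟩
  obtain ⟨g, hg⟩ := exists_surjection_from_steinberg V
  exact h.isAveraged_of_surjective ((isAveraged_steinberg.tensor _).tensor _) g hg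

/-! ### The normalized modified trace -/

variable {r : ℕ} [hr : Fact (2 ≤ r)]

variable (r) in
/-- The normalized modified trace: `f ↦ c * qtrace (θ f)` for a weight preserving `θ` whose average
is the identity, where the constant `c` is fixed by the value on `V₀`. -/
def modTrace : TraceFamily r := fun V hV =>
  ((-1) ^ (r - 1) * kappa r (0 + r - 1)) • (qtrace V ∘ₗ
    LinearMap.mulLeft ℂ (isProjective_iff_isAveraged.mp hV).choose ∘ₗ (Hom V V).subtype)

theorem modTrace_apply {V : WeightModule r} (hV : IsProjective V) {θ : Module.End ℂ V.carrier}
    (hθ : PreservesWeight θ) (h : average V V θ = 1) (f : Hom V V) :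
    modTrace r V hV f = (-1) ^ (r - 1) * kappa r (0 + r - 1) * qtrace V (θ * f.1) := by
  have hc := (isProjective_iff_isAveraged.mp hV).choose_spec
  have h1 := qtrace_average_cyclic hc.1 hc.2 hθ h (idHom V) f
  have h2 : modTrace r V hV f = (-1) ^ (r - 1) * kappa r (0 + r - 1) *
    qtrace V ((isProjective_iff_isAveraged.mp hV).choose * f.1) := rfl
  rw [h2]
  exact congrArg _ h1

theorem modTrace_averageHom {V : WeightModule r} (hV : IsProjective V)
    {η : Module.End ℂ V.carrier} (hη : PreservesWeight η) :
    modTrace r V hV (averageHom hη) =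
      (-1) ^ (r - 1) * kappa r (0 + r - 1) * qtrace V η := by
  obtain ⟨θ, hθ, h⟩ := isProjective_iff_isAveraged.mp hV
  rw [modTrace_apply hV hθ h]
  congr 1
  exact qtrace_comp_average_of_eq_one hθ h hη

theorem isModifiedTrace_modTrace : IsModifiedTrace r (modTrace r) where
  cyclic := by
    intro U V hU hV f g
    obtain ⟨θ, hθ, h⟩ := isProjective_iff_isAveraged.mp hU
    obtain ⟨η, hη, h'⟩ := isProjective_iff_isAveraged.mp hV
    rw [modTrace_apply hU hθ h, modTrace_apply hV hη h']
    exact congrArg _ (qtrace_average_cyclic hθ h hη h' f g)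
  partial_trace := by
    intro U W hU hUW f
    obtain ⟨θ, hθ, h⟩ := isProjective_iff_isAveraged.mp hU
    have h1 : average (U.tensor W) (U.tensor W) (tensorLeft W θ) = 1 := by
      rw [average_tensorLeft, h]
      exact tensor_ext fun v w => rfl
    rw [modTrace_apply hUW hθ.tensorLeft h1, modTrace_apply hU hθ h, qtrace_tensorLeft_comp]

theorem isNormalizedModifiedTrace_modTrace : IsNormalizedModifiedTrace r (modTrace r) := by
  refine ⟨isModifiedTrace_modTrace, (isAveraged_steinberg (r := r)).isProjective, fun c => ?_⟩
  change modTrace r (steinberg r) isAveraged_steinberg.isProjective (c • idHom (steinberg r)) = _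
  obtain ⟨h1, h2⟩ := average_steinberg (r := r)
  have hH0 : (steinberg r).act .H (stVec r 0) = (0 + r - 1 : ℂ) • stVec r 0 := by
    rw [hw_H]; simp
  have h3 := modTrace_averageHom (isAveraged_steinberg (r := r)).isProjective
    (h1.preservesWeight hH0)
  have h4 : averageHom (h1.preservesWeight hH0) =
      (qpow r (-(((r - 1 : ℕ) : ℂ) * (0 + r - 1))) * kappa r (0 + r - 1)) •
        idHom (steinberg r) := Subtype.ext h2
  rw [h4, map_smul, qtrace_smulRight _ hH0, hwCoord_hwVec, if_pos rfl, mul_one, smul_eq_mul] at h3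
  have h5 := qpow_ne_zero r (-(((r - 1 : ℕ) : ℂ) * (0 + r - 1)))
  have h6 := kappa_steinberg_ne_zero (r := r)
  rw [map_smul, smul_eq_mul, mul_comm c]
  congr 1
  apply mul_left_cancel₀ (mul_ne_zero h5 h6)
  rw [h3]; ring

/-- A modified trace is determined by its values on scalar endomorphisms of `V₀`: every projective
module is a retract of some `(V₀ ⊗ V₀) ⊗ V`, where partial traces lead back to `V₀`. -/
theorem eq_of_isNormalizedModifiedTrace {t t' : TraceFamily r}
    (h : IsNormalizedModifiedTrace r t) (h' : IsNormalizedModifiedTrace r t') : t = t' := by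
  obtain ⟨ht, h0, hn⟩ := h
  obtain ⟨ht', _, hn'⟩ := h'
  funext V hV
  refine LinearMap.ext fun f => ?_
  let Z := steinberg r
  have hZ : IsAveraged Z := isAveraged_steinberg
  have hP : IsProjective Z := hZ.isProjective
  have hPP := (hZ.tensor Z).isProjective
  have hQ := ((hZ.tensor Z).tensor V).isProjective
  obtain ⟨p, hp⟩ := exists_surjection_from_steinberg V
  obtain ⟨s, hs⟩ := hV.exists_section p hp
  have h1 : compHom p (compHom s f) = f := by
    refine Subtype.ext (LinearMap.ext fun v => ?_)
    exact LinearMap.congr_fun (congrArg Subtype.val hs) (f.1 v)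
  obtain ⟨c, hc⟩ := hw_end_scalar (by have := hr.out; omega)
    (partialTrace Z Z (partialTrace (Z.tensor Z) V (compHom (compHom s f) p)))
  have key : ∀ u : TraceFamily r, IsModifiedTrace r u →
      u V hV f = u Z hP (c • idHom Z) := by
    intro u hu
    rw [← hc, ← hu.partial_trace Z Z hP hPP, ← hu.partial_trace (Z.tensor Z) V hPP hQ,
      hu.cyclic _ _ hQ hV, h1]
  rw [key t ht, key t' ht']
  exact (hn c).trans (hn' c).symm

theorem existsUnique_isNormalizedModifiedTrace :
    ∃! t : TraceFamily r, IsNormalizedModifiedTrace r t :=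
  ⟨modTrace r, isNormalizedModifiedTrace_modTrace, fun _ h =>
    eq_of_isNormalizedModifiedTrace h isNormalizedModifiedTrace_modTrace⟩

theorem modifiedDim_eq_modTrace {V : WeightModule r} (hV : IsProjective V) :
    modifiedDim V = modTrace r V hV (idHom V) := by
  have h : IsProjective V ∧ ∃ t, IsNormalizedModifiedTrace r t :=
    ⟨hV, _, isNormalizedModifiedTrace_modTrace⟩
  rw [modifiedDim, dif_pos h,
    eq_of_isNormalizedModifiedTrace h.2.choose_spec isNormalizedModifiedTrace_modTrace]

/-- Tensoring with `W` multiplies the modified dimension by the quantum dimension of `W`. -/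
theorem modifiedDim_tensor {P : WeightModule r} (hP : IsProjective P) (W : WeightModule r) :
    modifiedDim (P.tensor W) = qtrace W 1 * modifiedDim P := by
  have hPW := ((isProjective_iff_isAveraged.mp hP).tensor W).isProjective
  rw [modifiedDim_eq_modTrace hPW, modifiedDim_eq_modTrace hP,
    isModifiedTrace_modTrace.partial_trace P W hP hPW, ← smul_eq_mul, ← map_smul]
  congr 1
  refine Subtype.ext ?_
  have h1 : (idHom (P.tensor W)).1 = TensorProduct.map (1 : Module.End ℂ P.carrier)
    (1 : Module.End ℂ W.carrier) := TensorProduct.map_id.symm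
  change partialTraceLin P W (idHom (P.tensor W)).1 = _
  rw [h1, partialTraceLin_map]
  rfl

/-! ### The deformable modules -/

section DeformedModule

variable {r : ℕ} [hr : Fact (2 ≤ r)] {i : ℕ} (hi : i + 2 ≤ r) (l : ℤ) (ε : ℂ)

/-- The basis vector `w^H_{i - 2 k}` of the module `X_ε`. -/
def xH (k : ℕ) : (deformed r i hi l ε).carrier := wH r i k

/-- The basis vector `w^S_{i - 2 k}` of the module `X_ε`. -/
def xS (k : ℕ) : (deformed r i hi l ε).carrier := wS r i k

/-- The basis vector `w^L_{-i - 2 - 2 k}` of the module `X_ε`. -/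
def xL (k : ℕ) : (deformed r i hi l ε).carrier := wL r i k

/-- The basis vector `w^R_{i + 2 + 2 k}` of the module `X_ε`. -/
def xR (k : ℕ) : (deformed r i hi l ε).carrier := wR r i k

/-- The coordinates on the module `X_ε`. -/
def xCoord (j : DefIndex r i) : (deformed r i hi l ε).carrier →ₗ[ℂ] ℂ :=
  LinearMap.proj (R := ℂ) (φ := fun _ : DefIndex r i => ℂ) j

/-- The index of the basis vector `w^H_i`, which generates the module `X_ε`. -/
abbrev idxH (r i : ℕ) : DefIndex r i := .inl (.inl 0)

/-- The index of the basis vector `w^S_i`. -/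
abbrev idxS (r i : ℕ) : DefIndex r i := .inl (.inr 0)

/-- The index of the basis vector `w^R_{2r-2-i}` of highest weight. -/
abbrev idxTop : DefIndex r i := .inr (.inr ⟨r - 2 - i, by omega⟩)

/-- The scalar `[1 + i] [ε]`. -/
abbrev defScalar (r i : ℕ) (ε : ℂ) : ℂ := qnum r (1 + i) * qnum r ε

theorem act_deformed_E : (deformed r i hi l ε).act .E = opOfBasis (defE r i l ε) := by
  unfold deformed
  apply act_ofWeights_E

theorem act_deformed_F : (deformed r i hi l ε).act .F = opOfBasis (defF r i ε) := by
  unfold deformed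
  apply act_ofWeights_F

theorem act_deformed_K : (deformed r i hi l ε).act .K =
    LinearMap.mulLeft ℂ fun j => qpow r (defWeight r i l ε j) := by
  unfold deformed
  apply act_ofWeights_K

theorem act_deformed_Kinv : (deformed r i hi l ε).act .Kinv =
    LinearMap.mulLeft ℂ fun j => qpow r (-defWeight r i l ε j) := by
  unfold deformed
  apply act_ofWeights_Kinv

theorem act_deformed_H : (deformed r i hi l ε).act .H =
    LinearMap.mulLeft ℂ (defWeight r i l ε) := by
  unfold deformed
  apply act_ofWeights_H

theorem isWeightForm_xCoord (j : DefIndex r i) :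
    IsWeightForm (defWeight r i l ε j) (xCoord hi l ε j) := by
  intro v
  rw [act_deformed_H]
  rfl

theorem act_H_xH (k : ℕ) : (deformed r i hi l ε).act .H (xH hi l ε k) =
    ((i - 2 * k) + l * r + ε : ℂ) • xH hi l ε k := by
  rw [act_deformed_H]; exact weight_H k

theorem act_H_xS (k : ℕ) : (deformed r i hi l ε).act .H (xS hi l ε k) =
    ((i - 2 * k) + l * r + ε : ℂ) • xS hi l ε k := by
  rw [act_deformed_H]; exact weight_S k

theorem act_H_xL (k : ℕ) : (deformed r i hi l ε).act .H (xL hi l ε k) =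
    ((-i - 2 - 2 * k) + l * r + ε : ℂ) • xL hi l ε k := by
  rw [act_deformed_H]; exact weight_L k

theorem act_H_xR (k : ℕ) : (deformed r i hi l ε).act .H (xR hi l ε k) =
    ((i + 2 + 2 * k) + l * r + ε : ℂ) • xR hi l ε k := by
  rw [act_deformed_H]; exact weight_R k

theorem act_E_xH_zero : (deformed r i hi l ε).act .E (xH hi l ε 0) =
    (-1 : ℂ) ^ l • xR hi l ε 0 := by
  rw [act_deformed_E]; exact defE_H_zero

theorem act_E_xS_zero : (deformed r i hi l ε).act .E (xS hi l ε 0) =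
    (-2 * (-1) ^ l * defScalar r i ε) • xR hi l ε 0 := by
  rw [act_deformed_E]
  refine defE_S_zero.trans ?_
  rw [neg_one_zpow_succ]
  congr 1; ring

theorem act_E_xL_zero : (deformed r i hi l ε).act .E (xL hi l ε 0) =
    (-1 : ℂ) ^ l • (xS hi l ε i + (2 * defScalar r i ε) • xH hi l ε i) := by
  rw [act_deformed_E]
  refine (defE_L_zero hi).trans ?_
  rw [smul_add, smul_smul, add_comm, add_comm (i : ℂ)]
  congr 2; ring

theorem act_E_xL_succ {k : ℕ} (hk : k + 1 < r - 1 - i) :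
    (deformed r i hi l ε).act .E (xL hi l ε (k + 1)) =
    (-(-1) ^ l * qnum r (1 + i + (k + 1)) * qnum r (k + 1 - ε)) • xL hi l ε k := by
  rw [act_deformed_E, ← neg_one_zpow_succ]; exact defE_L_succ hk

theorem act_E_xR (k : ℕ) : (deformed r i hi l ε).act .E (xR hi l ε k) =
    (-1 : ℂ) ^ l • xR hi l ε (k + 1) := by
  rw [act_deformed_E]; exact defE_R k

theorem act_F_xH {k : ℕ} (hk : k < i) :
    (deformed r i hi l ε).act .F (xH hi l ε k) = xH hi l ε (k + 1) := by
  rw [act_deformed_F]; exact defF_H hk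

theorem act_F_xH_last : (deformed r i hi l ε).act .F (xH hi l ε i) = xL hi l ε 0 := by
  rw [act_deformed_F]; exact defF_H_last

theorem act_F_xS {k : ℕ} (hk : k < i) :
    (deformed r i hi l ε).act .F (xS hi l ε k) = xS hi l ε (k + 1) := by
  rw [act_deformed_F]; exact defF_S hk

theorem act_F_xS_last : (deformed r i hi l ε).act .F (xS hi l ε i) =
    (-defScalar r i ε) • xL hi l ε 0 := by
  rw [act_deformed_F]; exact defF_S_last

theorem act_F_xL (k : ℕ) :
    (deformed r i hi l ε).act .F (xL hi l ε k) = xL hi l ε (k + 1) := by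
  rw [act_deformed_F]; exact defF_L k

theorem act_F_xR_zero : (deformed r i hi l ε).act .F (xR hi l ε 0) =
    xS hi l ε 0 + defScalar r i ε • xH hi l ε 0 := by
  rw [act_deformed_F]; exact defF_R_zero hi

theorem act_F_xR_succ {k : ℕ} (hk : k + 1 < r - 1 - i) :
    (deformed r i hi l ε).act .F (xR hi l ε (k + 1)) =
    (-(qnum r (1 + i + (k + 1)) * qnum r (k + 1 + ε))) • xR hi l ε k := by
  rw [act_deformed_F]; exact defF_R_succ hk

theorem act_F_pow_xH {m : ℕ} (hm : m ≤ i) :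
    ((deformed r i hi l ε).act .F ^ m) (xH hi l ε 0) = xH hi l ε m := by
  induction m with
  | zero => rfl
  | succ m ih => rw [pow_succ', Module.End.mul_apply, ih (by omega), act_F_xH _ _ _ (by omega)]

theorem act_F_pow_xS {m : ℕ} (hm : m ≤ i) :
    ((deformed r i hi l ε).act .F ^ m) (xS hi l ε 0) = xS hi l ε m := by
  induction m with
  | zero => rfl
  | succ m ih => rw [pow_succ', Module.End.mul_apply, ih (by omega), act_F_xS _ _ _ (by omega)]

theorem act_F_pow_xL (m k : ℕ) :
    ((deformed r i hi l ε).act .F ^ m) (xL hi l ε k) = xL hi l ε (k + m) := by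
  induction m with
  | zero => rfl
  | succ m ih => rw [pow_succ', Module.End.mul_apply, ih, act_F_xL]; rfl

/-- The vector `w^L_{i+2-2r}` of lowest weight. -/
abbrev xBot : (deformed r i hi l ε).carrier := xL hi l ε (r - 2 - i)

theorem act_F_pow_xH_bot :
    ((deformed r i hi l ε).act .F ^ (r - 1)) (xH hi l ε 0) = xBot hi l ε := by
  rw [show r - 1 = (r - 2 - i) + (1 + i) by omega, pow_add, pow_add _ 1 i, Module.End.mul_apply,
    Module.End.mul_apply, act_F_pow_xH _ _ _ le_rfl, pow_one, act_F_xH_last, act_F_pow_xL, zero_add]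

theorem act_F_pow_xS_bot :
    ((deformed r i hi l ε).act .F ^ (r - 1)) (xS hi l ε 0) =
      (-defScalar r i ε) • xBot hi l ε := by
  rw [show r - 1 = (r - 2 - i) + (1 + i) by omega, pow_add, pow_add _ 1 i, Module.End.mul_apply,
    Module.End.mul_apply, act_F_pow_xS _ _ _ le_rfl, pow_one, act_F_xS_last, map_smul,
    act_F_pow_xL, zero_add]

theorem xCoord_idxH_xH : xCoord hi l ε (idxH r i) (xH hi l ε 0) = 1 := by
  change wH r i 0 (idxH r i) = 1
  rw [wH, chainVec_of_lt _ (by omega)]; exact Pi.single_eq_same _ _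

theorem xCoord_idxS_xS : xCoord hi l ε (idxS r i) (xS hi l ε 0) = 1 := by
  change wS r i 0 (idxS r i) = 1
  rw [wS, chainVec_of_lt _ (by omega)]; exact Pi.single_eq_same _ _

theorem xCoord_idxH_xS : xCoord hi l ε (idxH r i) (xS hi l ε 0) = 0 := by
  change wS r i 0 (idxH r i) = 0
  rw [wS, chainVec_of_lt _ (by omega)]; exact Pi.single_eq_of_ne (by simp) _

theorem xCoord_idxS_xH : xCoord hi l ε (idxS r i) (xH hi l ε 0) = 0 := by
  change wH r i 0 (idxS r i) = 0
  rw [wH, chainVec_of_lt _ (by omega)]; exact Pi.single_eq_of_ne (by simp) _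

/-- The vector `w^R_{2r-2-i}` of highest weight. -/
abbrev xTop : (deformed r i hi l ε).carrier := xR hi l ε (r - 2 - i)

theorem xCoord_idxTop_xTop : xCoord hi l ε (idxTop hi) (xTop hi l ε) = 1 := by
  change wR r i (r - 2 - i) (idxTop hi) = 1
  rw [wR, chainVec_of_lt _ (by omega)]; exact Pi.single_eq_same _ _

theorem xBot_ne_zero : xBot hi l ε ≠ 0 := by
  intro h
  have h1 : wL r i (r - 2 - i) (.inr (.inl ⟨r - 2 - i, by omega⟩)) = 0 := congrFun h _
  rw [wL, chainVec_of_lt _ (by omega)] at h1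
  exact one_ne_zero ((Pi.single_eq_same _ _).symm.trans h1)

/-! ### Endomorphisms of `X_ε` -/

/-- The vector `w^H_i` generates the module. -/
theorem eq_top_of_xH_mem {N : Submodule ℂ (deformed r i hi l ε).carrier}
    (hE : ∀ v ∈ N, (deformed r i hi l ε).act .E v ∈ N)
    (hF : ∀ v ∈ N, (deformed r i hi l ε).act .F v ∈ N) (h : xH hi l ε 0 ∈ N) : N = ⊤ := by
  have hFm : ∀ v ∈ N, ∀ m, ((deformed r i hi l ε).act .F ^ m) v ∈ N := by
    intro v hv m
    induction m with
    | zero => exact hv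
    | succ m ih => rw [pow_succ', Module.End.mul_apply]; exact hF _ ih
  have hs : (-1 : ℂ) ^ l ≠ 0 := zpow_ne_zero _ (by norm_num)
  have hR : ∀ k, xR hi l ε k ∈ N := by
    intro k
    induction k with
    | zero =>
      have := hE _ h
      rw [act_E_xH_zero] at this
      exact (N.smul_mem_iff hs).mp this
    | succ k ih =>
      have := hE _ ih
      rw [act_E_xR] at this
      exact (N.smul_mem_iff hs).mp this
  have hS0 : xS hi l ε 0 ∈ N := by
    have := hF _ (hR 0)
    rw [act_F_xR_zero] at this
    exact (N.add_mem_iff_left (N.smul_mem _ h)).mp this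
  have hL0 : xL hi l ε 0 ∈ N := by
    have := hF _ (hFm _ h i)
    rwa [act_F_pow_xH _ _ _ le_rfl, act_F_xH_last] at this
  have hb : ∀ j : DefIndex r i, (Pi.single j 1 : DefIndex r i → ℂ) ∈
      (show Submodule ℂ (DefIndex r i → ℂ) from N) := by
    refine def_cases (l := l) (ε := ε) (p := fun v _ => v ∈
      (show Submodule ℂ (DefIndex r i → ℂ) from N)) ?_ ?_ ?_ ?_
    · intro k hk
      have := hFm _ h k
      rwa [act_F_pow_xH _ _ _ hk] at this
    · intro k hk
      have := hFm _ hS0 k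
      rwa [act_F_pow_xS _ _ _ hk] at this
    · intro k _
      have := hFm _ hL0 k
      rwa [act_F_pow_xL, zero_add] at this
    · intro k _
      exact hR k
  have h1 : (show Submodule ℂ (DefIndex r i → ℂ) from N) = ⊤ := by
    rw [eq_top_iff, ← (Pi.basisFun ℂ (DefIndex r i)).span_eq, Submodule.span_le]
    rintro _ ⟨j, rfl⟩
    rw [Pi.basisFun_apply]
    exact hb j
  exact h1

variable {hi l ε}

/-- A homomorphism from `X_ε` is determined by its value on the generator `w^H_i`. -/
theorem deformed_hom_ext {M : WeightModule r} {f g : Hom (deformed r i hi l ε) M}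
    (h : f.1 (xH hi l ε 0) = g.1 (xH hi l ε 0)) : f = g := by
  have h1 : LinearMap.eqLocus f.1 g.1 = ⊤ := by
    refine eq_top_of_xH_mem hi l ε (fun v hv => ?_) (fun v hv => ?_) h
    · rw [LinearMap.mem_eqLocus] at *
      rw [hom_act, hom_act, hv]
    · rw [LinearMap.mem_eqLocus] at *
      rw [hom_act, hom_act, hv]
  refine Subtype.ext (LinearMap.ext fun v => ?_)
  have : v ∈ LinearMap.eqLocus f.1 g.1 := by rw [h1]; trivial
  exact this

/-- The weight space of the generator is spanned by `w^H_i` and `w^S_i`. -/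
theorem eq_of_weight {v : (deformed r i hi l ε).carrier}
    (hv : (deformed r i hi l ε).act .H v = ((i : ℂ) + l * r + ε) • v) :
    v = xCoord hi l ε (idxH r i) v • xH hi l ε 0 + xCoord hi l ε (idxS r i) v • xS hi l ε 0 := by
  have h0 : ∀ j, defWeight r i l ε j ≠ i + l * r + ε → xCoord hi l ε j v = 0 := fun j hj =>
    (isWeightForm_xCoord hi l ε j).eq_zero hv (Ne.symm hj)
  have hval : ∀ (j : DefIndex r i) (z : ℂ), defWeight r i l ε j = z + l * r + ε → z ≠ i →
      xCoord hi l ε j v = 0 := by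
    intro j z hz hzi
    refine h0 j fun h => hzi ?_
    rw [hz] at h
    linear_combination h
  funext j
  change xCoord hi l ε j v = xCoord hi l ε j (_ + _)
  have hH : ∀ j, xCoord hi l ε j (xH hi l ε 0) = if j = idxH r i then 1 else 0 := by
    intro j
    change wH r i 0 j = _
    rw [wH, chainVec_of_lt _ (by omega), Pi.single_apply]; rfl
  have hS : ∀ j, xCoord hi l ε j (xS hi l ε 0) = if j = idxS r i then 1 else 0 := by
    intro j
    change wS r i 0 j = _
    rw [wS, chainVec_of_lt _ (by omega), Pi.single_apply]; rfl
  rw [map_add, map_smul, map_smul, hH, hS]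
  by_cases h1 : j = idxH r i
  · subst h1; simp
  by_cases h2 : j = idxS r i
  · subst h2; simp
  rw [if_neg h1, if_neg h2, smul_zero, smul_zero, add_zero]
  rcases j with (k | k) | (k | k)
  · refine hval _ _ rfl fun h => h1 ?_
    have h3 : ((k : ℕ) : ℂ) = 0 := by linear_combination -h / 2
    have h4 : (k : ℕ) = 0 := by exact_mod_cast h3
    rw [show k = 0 from Fin.ext h4]
  · refine hval _ _ rfl fun h => h2 ?_
    have h3 : ((k : ℕ) : ℂ) = 0 := by linear_combination -h / 2
    have h4 : (k : ℕ) = 0 := by exact_mod_cast h3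
    rw [show k = 0 from Fin.ext h4]
  · refine hval _ _ rfl fun h => ?_
    have h3 : ((i + 1 + k : ℕ) : ℂ) = 0 := by push_cast; linear_combination -h / 2
    have h4 : i + 1 + (k : ℕ) = 0 := by exact_mod_cast h3
    omega
  · refine hval _ _ rfl fun h => ?_
    have h3 : ((1 + k : ℕ) : ℂ) = 0 := by push_cast; linear_combination h / 2
    have h4 : 1 + (k : ℕ) = 0 := by exact_mod_cast h3
    omega

/-- The coefficient of `w^H_i` in the image of the generator under an endomorphism. -/
def endA (f : Hom (deformed r i hi l ε) (deformed r i hi l ε)) : ℂ :=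
  xCoord hi l ε (idxH r i) (f.1 (xH hi l ε 0))

/-- The coefficient of `w^S_i` in the image of the generator under an endomorphism. -/
def endB (f : Hom (deformed r i hi l ε) (deformed r i hi l ε)) : ℂ :=
  xCoord hi l ε (idxS r i) (f.1 (xH hi l ε 0))

theorem deformed_end_apply (f : Hom (deformed r i hi l ε) (deformed r i hi l ε)) :
    f.1 (xH hi l ε 0) = endA f • xH hi l ε 0 + endB f • xS hi l ε 0 := by
  refine eq_of_weight ?_
  rw [← hom_act, act_H_xH, map_smul]
  simp

theorem deformed_end_ext {f g : Hom (deformed r i hi l ε) (deformed r i hi l ε)}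
    (hA : endA f = endA g) (hB : endB f = endB g) : f = g :=
  deformed_hom_ext (by rw [deformed_end_apply, deformed_end_apply, hA, hB])

/-- Endomorphisms act on the lowest weight vector by a scalar. -/
theorem deformed_end_bot (f : Hom (deformed r i hi l ε) (deformed r i hi l ε)) :
    f.1 (xBot hi l ε) = (endA f - defScalar r i ε * endB f) • xBot hi l ε := by
  rw [← act_F_pow_xH_bot, hom_act_pow, deformed_end_apply, map_add, map_smul, map_smul,
    act_F_pow_xH_bot, act_F_pow_xS_bot]
  module

/-- Endomorphisms act by a scalar on `w^S_i + [1 + i] [ε] w^H_i`, which is `F E w^H_i` up to sign. -/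
theorem deformed_end_FE (f : Hom (deformed r i hi l ε) (deformed r i hi l ε)) :
    f.1 (xS hi l ε 0 + defScalar r i ε • xH hi l ε 0) =
      (endA f - 2 * defScalar r i ε * endB f) •
        (xS hi l ε 0 + defScalar r i ε • xH hi l ε 0) := by
  have h1 : xS hi l ε 0 + defScalar r i ε • xH hi l ε 0 = (-1 : ℂ) ^ l •
      (deformed r i hi l ε).act .F ((deformed r i hi l ε).act .E (xH hi l ε 0)) := by
    rw [act_E_xH_zero, map_smul, smul_smul, neg_one_zpow_mul_self, one_smul, act_F_xR_zero]
  rw [h1, map_smul, hom_act, hom_act, deformed_end_apply, map_add, map_smul, map_smul,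
    act_E_xS_zero, act_E_xH_zero]
  simp only [map_add, map_smul, act_F_xR_zero]
  module

end DeformedModule

/-! ### Averages of projections to highest weight vectors -/

section HighestWeightVectors

theorem average_smulRight_apply_eq_zero {r : ℕ} {U V : WeightModule r} {φ : U.carrier →ₗ[ℂ] ℂ}
    (v : V.carrier) {w : U.carrier} {ν : ℂ} (hF : U.act .F w = 0) (hH : U.act .H w = ν • w)
    (h0 : ∀ j, φ ((U.act .E ^ j) w) = 0) : average U V (φ.smulRight v) w = 0 := by
  rw [average_apply_of_act_F_eq_zero hF hH, LinearMap.smulRight_apply, h0, zero_smul, map_zero,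
    smul_zero]
  intro j _
  rw [LinearMap.smulRight_apply, h0, zero_smul]

variable {r : ℕ} [hr : Fact (2 ≤ r)] {V : WeightModule r}

/-- The average of the projection to a highest weight vector `v` acts on `F ^ (r-1) v` by a
scalar. -/
theorem average_highest_apply {μ : ℂ} {v : V.carrier} (hE : V.act .E v = 0)
    (hH : V.act .H v = μ • v) {φ : V.carrier →ₗ[ℂ] ℂ} (hφ : IsWeightForm μ φ) (hv : φ v = 1) :
    average V V (φ.smulRight v) ((V.act .F ^ (r - 1)) v) =
      (qpow r (-(((r - 1 : ℕ) : ℂ) * μ)) * kappa r μ) • (V.act .F ^ (r - 1)) v := by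
  have hF : V.act .F ((V.act .F ^ (r - 1)) v) = 0 := by
    rw [← Module.End.mul_apply, ← pow_succ', Nat.sub_add_cancel (by have := hr.out; omega),
      V.act_relations.f_pow, LinearMap.zero_apply]
  rw [average_smulRight_apply hφ v hF (V.act_relations.h_f_pow hH _),
    V.act_relations.e_pow_f_pow_highest hr.out (V.act_K_of_weight hH) hE, map_smul, hv, smul_eq_mul,
    mul_one]
  rfl

theorem kappa_ne_zero {μ : ℂ} (h : ∀ m : ℤ, μ ≠ m) : kappa r μ ≠ 0 := by
  refine Finset.prod_ne_zero_iff.mpr fun j hj => ?_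
  have hj' : j < r - 1 := Finset.mem_range.mp hj
  have h1 := qnum_natCast_ne_zero hr.out (k := j + 1) (by omega) (by omega)
  rw [Nat.cast_add, Nat.cast_one] at h1
  refine mul_ne_zero h1 fun h2 => ?_
  obtain ⟨m, hm⟩ := (qnum_eq_zero_iff hr.out).mp h2
  refine h (m * r + j) ?_
  push_cast
  linear_combination hm

end HighestWeightVectors

section DeformedTrace

/-- The weight of the highest weight vector `w^R_{2r-2-i}`. -/
abbrev topWeight (r i : ℕ) (l : ℤ) (ε : ℂ) : ℂ :=
  (i + 2 + 2 * ((r - 2 - i : ℕ) : ℂ)) + l * r + ε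

theorem topWeight_eq {r i : ℕ} (hi : i + 2 ≤ r) (l : ℤ) (ε : ℂ) :
    topWeight r i l ε = (2 * r - 2 - i : ℂ) + l * r + ε := by
  rw [topWeight, Nat.cast_sub (by omega), Nat.cast_sub (by omega)]
  push_cast; ring

variable {r : ℕ} [hr : Fact (2 ≤ r)] {i : ℕ} (hi : i + 2 ≤ r) (l : ℤ) (ε : ℂ)

/-- The highest weight vector `w^S_i + 2 [1 + i] [ε] w^H_i`. -/
abbrev xSec : (deformed r i hi l ε).carrier := xS hi l ε 0 + (2 * defScalar r i ε) • xH hi l ε 0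

theorem act_E_xSec : (deformed r i hi l ε).act .E (xSec hi l ε) = 0 := by
  rw [xSec, map_add, map_smul, act_E_xS_zero, act_E_xH_zero]
  module

theorem act_H_xSec :
    (deformed r i hi l ε).act .H (xSec hi l ε) = ((i : ℂ) + l * r + ε) • xSec hi l ε := by
  rw [xSec, map_add, map_smul, act_H_xS, act_H_xH]
  simp only [Nat.cast_zero, mul_zero, sub_zero]
  module

theorem act_F_pow_xSec : ((deformed r i hi l ε).act .F ^ (r - 1)) (xSec hi l ε) =
    defScalar r i ε • xBot hi l ε := by
  rw [xSec, map_add, map_smul, act_F_pow_xS_bot, act_F_pow_xH_bot]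
  module

theorem act_E_xTop : (deformed r i hi l ε).act .E (xTop hi l ε) = 0 := by
  rw [xTop, act_E_xR]
  have : xR hi l ε (r - 2 - i + 1) = 0 := wR_of_le (by omega)
  rw [this, smul_zero]

theorem act_H_xTop : (deformed r i hi l ε).act .H (xTop hi l ε) =
    topWeight r i l ε • xTop hi l ε := act_H_xR hi l ε _

theorem act_F_pow_xR (k : ℕ) (hk : k < r - 1 - i) : ∃ c : ℂ,
    ((deformed r i hi l ε).act .F ^ (k + 1)) (xR hi l ε k) =
      c • (xS hi l ε 0 + defScalar r i ε • xH hi l ε 0) := by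
  induction k with
  | zero => exact ⟨1, by rw [zero_add, pow_one, act_F_xR_zero, one_smul]⟩
  | succ k ih =>
    obtain ⟨c, hc⟩ := ih (by omega)
    exact ⟨_, by rw [pow_succ, Module.End.mul_apply, act_F_xR_succ _ _ _ hk, map_smul, hc,
      smul_smul]⟩

theorem act_F_pow_xTop : ∃ c : ℂ, ((deformed r i hi l ε).act .F ^ (r - 1)) (xTop hi l ε) =
    c • ((deformed r i hi l ε).act .F ^ i) (xS hi l ε 0 + defScalar r i ε • xH hi l ε 0) := by
  obtain ⟨c, hc⟩ := act_F_pow_xR hi l ε (r - 2 - i) (by omega)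
  exact ⟨c, by rw [show r - 1 = i + (r - 2 - i + 1) by omega, pow_add, Module.End.mul_apply, hc,
    map_smul]⟩

/-- The vector `w^S_i + [1 + i] [ε] w^H_i` spans an eigenline of `E ^ m F ^ m`. -/
theorem act_E_pow_F_pow_mid (m : ℕ) : ∃ c : ℂ,
    ((deformed r i hi l ε).act .E ^ m) (((deformed r i hi l ε).act .F ^ m)
      (xS hi l ε 0 + defScalar r i ε • xH hi l ε 0)) =
      c • (xS hi l ε 0 + defScalar r i ε • xH hi l ε 0) := by
  set u := xS hi l ε 0 + defScalar r i ε • xH hi l ε 0 with hu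
  have hEu : (deformed r i hi l ε).act .E u =
      (-(-1) ^ l * defScalar r i ε) • xR hi l ε 0 := by
    rw [hu, map_add, map_smul, act_E_xS_zero, act_E_xH_zero]
    module
  have hFR : (deformed r i hi l ε).act .F (xR hi l ε 0) = u := act_F_xR_zero hi l ε
  have hHu : (deformed r i hi l ε).act .H u = ((i : ℂ) + l * r + ε) • u := by
    rw [hu, map_add, map_smul, act_H_xS, act_H_xH]
    simp only [Nat.cast_zero, mul_zero, sub_zero]
    module
  have R := (deformed r i hi l ε).act_relations
  induction m with
  | zero => exact ⟨1, by simp⟩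
  | succ m ih =>
    obtain ⟨c, hc⟩ := ih
    have h1 := R.e_f_pow_apply hr.out ((deformed r i hi l ε).act_K_of_weight hHu) m
    rw [hEu, map_smul, pow_succ ((deformed r i hi l ε).act .F) m,
      Module.End.mul_apply _ _ (xR hi l ε 0), hFR, ← add_smul, ← pow_succ] at h1
    exact ⟨_, by rw [pow_succ ((deformed r i hi l ε).act .E), Module.End.mul_apply, h1, map_smul,
      hc, smul_smul]⟩

/-- The linear form on the weight space of `w^H_i` that vanishes on `w^S_i + [1 + i] [ε] w^H_i` and takes
the value `1` on `w^S_i + 2 [1 + i] [ε] w^H_i`. -/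
def secForm : (deformed r i hi l ε).carrier →ₗ[ℂ] ℂ :=
  (defScalar r i ε)⁻¹ • xCoord hi l ε (idxH r i) - xCoord hi l ε (idxS r i)

theorem isWeightForm_idxH :
    IsWeightForm ((i : ℂ) + l * r + ε) (xCoord hi l ε (idxH r i)) := by
  have := isWeightForm_xCoord hi l ε (idxH r i)
  simpa [defWeight] using this

theorem isWeightForm_idxS :
    IsWeightForm ((i : ℂ) + l * r + ε) (xCoord hi l ε (idxS r i)) := by
  have := isWeightForm_xCoord hi l ε (idxS r i)
  simpa [defWeight] using this

theorem isWeightForm_secForm : IsWeightForm ((i : ℂ) + l * r + ε) (secForm hi l ε) := by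
  intro v
  rw [secForm, LinearMap.sub_apply, LinearMap.smul_apply, isWeightForm_idxH, isWeightForm_idxS,
    LinearMap.sub_apply, LinearMap.smul_apply, smul_eq_mul, smul_eq_mul]
  ring

theorem isWeightForm_idxTop :
    IsWeightForm (topWeight r i l ε) (xCoord hi l ε (idxTop hi)) :=
  isWeightForm_xCoord hi l ε (idxTop hi)

/-- The weight preserving projection to the highest weight vector `w^R_{2r-2-i}`. -/
def topMap : Module.End ℂ (deformed r i hi l ε).carrier :=
  (xCoord hi l ε (idxTop hi)).smulRight (xTop hi l ε)

theorem preservesWeight_topMap : PreservesWeight (topMap hi l ε) :=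
  (isWeightForm_idxTop hi l ε).preservesWeight (act_H_xTop hi l ε)

/-- A weight preserving projection to the highest weight vector `w^S_i + 2 [1 + i] [ε] w^H_i`. -/
def secMap : Module.End ℂ (deformed r i hi l ε).carrier :=
  (secForm hi l ε).smulRight (xSec hi l ε)

theorem preservesWeight_secMap : PreservesWeight (secMap hi l ε) :=
  (isWeightForm_secForm hi l ε).preservesWeight (act_H_xSec hi l ε)

/-- The nilpotent weight preserving map `w^S_i ↦ w^H_i`. -/
def nilMap : Module.End ℂ (deformed r i hi l ε).carrier :=
  (xCoord hi l ε (idxS r i)).smulRight (xH hi l ε 0)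

theorem act_H_xH_zero : (deformed r i hi l ε).act .H (xH hi l ε 0) =
    ((i : ℂ) + l * r + ε) • xH hi l ε 0 := by
  rw [act_H_xH]; simp

theorem preservesWeight_nilMap : PreservesWeight (nilMap hi l ε) :=
  (isWeightForm_idxS hi l ε).preservesWeight (act_H_xH_zero hi l ε)

theorem act_F_xBot : (deformed r i hi l ε).act .F (xBot hi l ε) = 0 := by
  rw [xBot, act_F_xL]
  exact wL_of_le (by omega)

theorem act_H_xBot : (deformed r i hi l ε).act .H (xBot hi l ε) =
    ((i : ℂ) + l * r + ε - 2 * ((r - 1 : ℕ) : ℂ)) • xBot hi l ε := by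
  rw [xBot, act_H_xL]
  congr 1
  have h1 : ((r - 1 : ℕ) : ℂ) = r - 1 := by rw [Nat.cast_sub (by omega)]; simp
  have h2 : ((r - 2 - i : ℕ) : ℂ) = r - 2 - i := by
    rw [Nat.cast_sub (by omega), Nat.cast_sub (by omega)]; simp
  rw [h1, h2]; ring

/-- The average of the projection to the top vector kills the lowest weight vector `w`, since no
`E ^ j w` has the weight of the top vector. -/
theorem average_topMap_bot :
    endA (averageHom (preservesWeight_topMap hi l ε)) =
      defScalar r i ε * endB (averageHom (preservesWeight_topMap hi l ε)) := by
  have h1 := deformed_end_bot (averageHom (preservesWeight_topMap hi l ε))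
  have h2 : average (deformed r i hi l ε) (deformed r i hi l ε) (topMap hi l ε)
      (xBot hi l ε) = 0 := by
    refine average_smulRight_apply_eq_zero _ (act_F_xBot hi l ε) (act_H_xBot hi l ε) fun j => ?_
    by_cases hj : j < r
    · refine (isWeightForm_idxTop hi l ε).eq_zero
        ((deformed r i hi l ε).act_relations.h_e_pow (act_H_xBot hi l ε) j) fun h => ?_
      rw [topWeight_eq hi, Nat.cast_sub (by omega)] at h
      have h3 : ((i + j : ℕ) : ℂ) = ((2 * (r - 1) : ℕ) : ℂ) := by
        rw [Nat.cast_mul, Nat.cast_sub (by omega)]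
        push_cast
        linear_combination h / 2
      have h4 : i + j = 2 * (r - 1) := by exact_mod_cast h3
      omega
    · rw [show j = (j - r) + r by omega, pow_add, (deformed r i hi l ε).act_relations.e_pow,
        mul_zero, LinearMap.zero_apply, map_zero]
  have h3 := h1.symm.trans h2
  exact sub_eq_zero.mp ((smul_eq_zero.mp h3).resolve_right (xBot_ne_zero hi l ε))

end DeformedTrace
section DeformedProjective

theorem defScalar_ne_zero {r : ℕ} (hr : 2 ≤ r) {i : ℕ} (hi : i + 2 ≤ r) {ε : ℂ}
    (hε : ∀ m : ℤ, ε ≠ m) : defScalar r i ε ≠ 0 := by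
  have h1 := qnum_natCast_ne_zero hr (k := 1 + i) (by omega) (by omega)
  rw [Nat.cast_add, Nat.cast_one] at h1
  refine mul_ne_zero h1 fun h2 => ?_
  obtain ⟨m, hm⟩ := (qnum_eq_zero_iff hr).mp h2
  exact hε (m * r) (by rw [hm]; push_cast; rfl)

variable {r : ℕ} [hr : Fact (2 ≤ r)] {i : ℕ} (hi : i + 2 ≤ r) (l : ℤ) (ε : ℂ)

theorem act_F_pow_xTop_ne_zero (h : kappa r (topWeight r i l ε) ≠ 0) :
    ((deformed r i hi l ε).act .F ^ (r - 1)) (xTop hi l ε) ≠ 0 := by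
  intro h0
  have h1 := (deformed r i hi l ε).act_relations.e_pow_f_pow_highest hr.out
    ((deformed r i hi l ε).act_K_of_weight (act_H_xTop hi l ε)) (act_E_xTop hi l ε) (r - 1)
  rw [h0, map_zero] at h1
  have h2 := congrArg (xCoord hi l ε (idxTop hi)) h1
  rw [map_zero, map_smul, xCoord_idxTop_xTop, smul_eq_mul, mul_one] at h2
  exact h h2.symm

theorem deformed_end_F_pow_xTop (f : Hom (deformed r i hi l ε) (deformed r i hi l ε)) :
    f.1 (((deformed r i hi l ε).act .F ^ (r - 1)) (xTop hi l ε)) =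
      (endA f - 2 * defScalar r i ε * endB f) •
        ((deformed r i hi l ε).act .F ^ (r - 1)) (xTop hi l ε) := by
  obtain ⟨c, hc⟩ := act_F_pow_xTop hi l ε
  rw [hc, map_smul, hom_act_pow, deformed_end_FE, map_smul, smul_comm]

/-- The scalar by which the average of `topMap` acts on `F ^ (r-1)` of the top vector. -/
theorem average_topMap_top (h : kappa r (topWeight r i l ε) ≠ 0) :
    endA (averageHom (preservesWeight_topMap hi l ε)) -
      2 * defScalar r i ε * endB (averageHom (preservesWeight_topMap hi l ε)) =
      qpow r (-(((r - 1 : ℕ) : ℂ) * topWeight r i l ε)) * kappa r (topWeight r i l ε) := by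
  have h1 := average_highest_apply (act_E_xTop hi l ε) (act_H_xTop hi l ε)
    (isWeightForm_idxTop hi l ε) (xCoord_idxTop_xTop hi l ε)
  have h2 := (deformed_end_F_pow_xTop hi l ε
    (averageHom (preservesWeight_topMap hi l ε))).symm.trans h1
  exact smul_left_injective ℂ (act_F_pow_xTop_ne_zero hi l ε h) h2

theorem secForm_xSec (he : defScalar r i ε ≠ 0) : secForm hi l ε (xSec hi l ε) = 1 := by
  simp only [secForm, xSec, LinearMap.sub_apply, LinearMap.smul_apply, map_add, map_smul,
    xCoord_idxH_xH, xCoord_idxH_xS, xCoord_idxS_xH, xCoord_idxS_xS, smul_eq_mul]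
  linear_combination 2 * inv_mul_cancel₀ he

theorem secForm_mid (he : defScalar r i ε ≠ 0) :
    secForm hi l ε (xS hi l ε 0 + defScalar r i ε • xH hi l ε 0) = 0 := by
  simp only [secForm, LinearMap.sub_apply, LinearMap.smul_apply, map_add, map_smul,
    xCoord_idxH_xH, xCoord_idxH_xS, xCoord_idxS_xH, xCoord_idxS_xS, smul_eq_mul]
  linear_combination inv_mul_cancel₀ he

/-- The scalar by which the average of `secMap` acts on the lowest weight vector, which is
proportional to `F ^ (r-1)` of `w^S_i + 2 [1 + i] [ε] w^H_i`. -/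
theorem average_secMap_bot (he : defScalar r i ε ≠ 0) :
    endA (averageHom (preservesWeight_secMap hi l ε)) -
      defScalar r i ε * endB (averageHom (preservesWeight_secMap hi l ε)) =
      qpow r (-(((r - 1 : ℕ) : ℂ) * (i + l * r + ε))) * kappa r (i + l * r + ε) := by
  have h1 := average_highest_apply (act_E_xSec hi l ε) (act_H_xSec hi l ε)
    (isWeightForm_secForm hi l ε) (secForm_xSec hi l ε he)
  rw [act_F_pow_xSec, map_smul, smul_comm] at h1
  have h2 := smul_right_injective _ he h1
  have h3 := (deformed_end_bot (averageHom (preservesWeight_secMap hi l ε))).symm.trans h2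
  exact smul_left_injective ℂ (xBot_ne_zero hi l ε) h3

/-- The average of `secMap` kills `F ^ (r-1)` of the top vector: the powers of `E` take that vector
to the weight space of `w^H_i` only along the kernel of `secForm`. -/
theorem average_secMap_top (he : defScalar r i ε ≠ 0)
    (h : kappa r (topWeight r i l ε) ≠ 0) :
    endA (averageHom (preservesWeight_secMap hi l ε)) =
      2 * defScalar r i ε * endB (averageHom (preservesWeight_secMap hi l ε)) := by
  have h1 := deformed_end_F_pow_xTop hi l ε (averageHom (preservesWeight_secMap hi l ε))
  have R := (deformed r i hi l ε).act_relations
  set w := ((deformed r i hi l ε).act .F ^ (r - 1)) (xTop hi l ε) with hw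
  have hF : (deformed r i hi l ε).act .F w = 0 := by
    rw [hw, ← Module.End.mul_apply, ← pow_succ', Nat.sub_add_cancel (by omega), R.f_pow,
      LinearMap.zero_apply]
  have hH := R.h_f_pow (act_H_xTop hi l ε) (r - 1)
  rw [← hw] at hH
  have h2 : average (deformed r i hi l ε) (deformed r i hi l ε) (secMap hi l ε) w = 0 := by
    refine average_smulRight_apply_eq_zero _ hF hH fun j => ?_
    by_cases hj : j = i
    · obtain ⟨c, hc⟩ := act_F_pow_xTop hi l ε
      obtain ⟨d, hd⟩ := act_E_pow_F_pow_mid hi l ε i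
      rw [hw, hj, hc, map_smul, hd, map_smul, map_smul, secForm_mid hi l ε he, smul_zero, smul_zero]
    · refine (isWeightForm_secForm hi l ε).eq_zero (R.h_e_pow hH j) fun h => hj ?_
      rw [topWeight_eq hi, Nat.cast_sub (by omega)] at h
      have h3 : (j : ℂ) = i := by
        push_cast at h
        linear_combination h / 2
      exact_mod_cast h3
  have h3 := h1.symm.trans h2
  exact sub_eq_zero.mp ((smul_eq_zero.mp h3).resolve_right (act_F_pow_xTop_ne_zero hi l ε h))

theorem endA_idHom : endA (idHom (deformed r i hi l ε)) = 1 := xCoord_idxH_xH hi l ε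

theorem endB_idHom : endB (idHom (deformed r i hi l ε)) = 0 := xCoord_idxS_xH hi l ε

variable {hi l ε} in
theorem endA_combination (c d : ℂ) (f g : Hom (deformed r i hi l ε) (deformed r i hi l ε)) :
    endA (c • f + d • g) = c * endA f + d * endA g := by
  simp [endA]

variable {hi l ε} in
theorem endB_combination (c d : ℂ) (f g : Hom (deformed r i hi l ε) (deformed r i hi l ε)) :
    endB (c • f + d • g) = c * endB f + d * endB g := by
  simp [endB]

/-- For generic `ε` the identity of `X_ε` is a combination of two averages, one for each of the two
typical summands of `X_ε`. -/
theorem deformed_generic_identity (he : defScalar r i ε ≠ 0)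
    (h1 : kappa r (topWeight r i l ε) ≠ 0) (h2 : kappa r (i + l * r + ε) ≠ 0) :
    (qpow r (-(((r - 1 : ℕ) : ℂ) * topWeight r i l ε)) * kappa r (topWeight r i l ε))⁻¹ •
        averageHom (preservesWeight_topMap hi l ε) +
      (qpow r (-(((r - 1 : ℕ) : ℂ) * (i + l * r + ε))) * kappa r (i + l * r + ε))⁻¹ •
        averageHom (preservesWeight_secMap hi l ε) = idHom (deformed r i hi l ε) := by
  have e1 := average_topMap_top hi l ε h1
  have e2 := average_topMap_bot hi l ε
  have e3 := average_secMap_bot hi l ε he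
  have e4 := average_secMap_top hi l ε he h1
  have n1 := mul_ne_zero (qpow_ne_zero r (-(((r - 1 : ℕ) : ℂ) * topWeight r i l ε))) h1
  have n2 := mul_ne_zero (qpow_ne_zero r (-(((r - 1 : ℕ) : ℂ) * (i + l * r + ε)))) h2
  set c₁ := qpow r (-(((r - 1 : ℕ) : ℂ) * topWeight r i l ε)) * kappa r (topWeight r i l ε)
  set c₂ := qpow r (-(((r - 1 : ℕ) : ℂ) * (i + l * r + ε))) * kappa r (i + l * r + ε)
  refine deformed_end_ext ?_ ?_
  · rw [endA_combination, endA_idHom]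
    have e5 : endA (averageHom (preservesWeight_topMap hi l ε)) = -c₁ := by
      linear_combination 2 * e2 - e1
    have e6 : endA (averageHom (preservesWeight_secMap hi l ε)) = 2 * c₂ := by
      linear_combination 2 * e3 - e4
    rw [e5, e6]
    field_simp
    ring
  · rw [endB_combination, endB_idHom]
    apply mul_left_cancel₀ he
    have e5 : defScalar r i ε * endB (averageHom (preservesWeight_topMap hi l ε)) = -c₁ := by
      linear_combination e2 - e1
    have e6 : defScalar r i ε * endB (averageHom (preservesWeight_secMap hi l ε)) = c₂ := by
      linear_combination e3 - e4
    rw [mul_add, mul_left_comm, e5, mul_left_comm, e6]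
    field_simp
    ring


/-! ### Projectivity and modified dimension for generic parameters -/

variable {ε} in
theorem kappa_topWeight_ne_zero (hε : ∀ m : ℤ, ε ≠ m) : kappa r (topWeight r i l ε) ≠ 0 := by
  refine kappa_ne_zero fun m hm => hε (m - (i + 2 + 2 * ((r - 2 - i : ℕ) : ℤ)) - l * r) ?_
  push_cast
  rw [← hm, topWeight]
  ring

variable {ε} in
theorem kappa_secWeight_ne_zero (hε : ∀ m : ℤ, ε ≠ m) : kappa r (i + l * r + ε) ≠ 0 := by
  refine kappa_ne_zero fun m hm => hε (m - i - l * r) ?_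
  push_cast
  rw [← hm]
  ring

variable {ε} in
theorem isAveraged_deformed_generic (hε : ∀ m : ℤ, ε ≠ m) : IsAveraged (deformed r i hi l ε) := by
  have h := congrArg Subtype.val (deformed_generic_identity hi l ε (defScalar_ne_zero hr.out hi hε)
    (kappa_topWeight_ne_zero l hε) (kappa_secWeight_ne_zero l hε))
  set c₁ := (qpow r (-(((r - 1 : ℕ) : ℂ) * topWeight r i l ε)) * kappa r (topWeight r i l ε))⁻¹
  set c₂ := (qpow r (-(((r - 1 : ℕ) : ℂ) * (i + l * r + ε))) * kappa r (i + l * r + ε))⁻¹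
  refine ⟨c₁ • topMap hi l ε + c₂ • secMap hi l ε,
    ((preservesWeight_topMap hi l ε).smul _).add ((preservesWeight_secMap hi l ε).smul _), ?_⟩
  rw [map_add, map_smul, map_smul]
  exact h

variable {ε} in
/-- For generic `ε` the modified dimension is a sum of two terms, one for each typical summand of
`X_ε`. -/
theorem modifiedDim_deformed_generic (hε : ∀ m : ℤ, ε ≠ m) :
    modifiedDim (deformed r i hi l ε) = (-1) ^ (r - 1) * kappa r (0 + r - 1) *
      ((kappa r (topWeight r i l ε))⁻¹ + (kappa r (i + l * r + ε))⁻¹) := by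
  have he := defScalar_ne_zero hr.out hi hε
  have n1 := kappa_topWeight_ne_zero (r := r) (i := i) l hε
  have n2 := kappa_secWeight_ne_zero (r := r) (i := i) l hε
  rw [modifiedDim_eq_modTrace (isAveraged_deformed_generic hi l hε).isProjective,
    ← deformed_generic_identity hi l ε he n1 n2, map_add, map_smul, map_smul,
    modTrace_averageHom, modTrace_averageHom, topMap, secMap,
    qtrace_smulRight _ (act_H_xTop hi l ε), qtrace_smulRight _ (act_H_xSec hi l ε),
    secForm_xSec hi l ε he, xCoord_idxTop_xTop]
  have q1 := qpow_ne_zero r (-(((r - 1 : ℕ) : ℂ) * topWeight r i l ε))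
  have q2 := qpow_ne_zero r (-(((r - 1 : ℕ) : ℂ) * (i + l * r + ε)))
  generalize qpow r (-(((r - 1 : ℕ) : ℂ) * topWeight r i l ε)) = x1 at *
  generalize qpow r (-(((r - 1 : ℕ) : ℂ) * (i + l * r + ε))) = x2 at *
  generalize kappa r (topWeight r i l ε) = y1 at *
  generalize kappa r (i + l * r + ε) = y2 at *
  rw [smul_eq_mul, smul_eq_mul]
  field_simp

/-! ### Projectivity at `ε = 0` -/

/-- The scalar by which the average of `nilMap` acts on the lowest weight vector. -/
theorem average_nilMap_bot :
    endA (averageHom (preservesWeight_nilMap hi l ε)) -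
      defScalar r i ε * endB (averageHom (preservesWeight_nilMap hi l ε)) =
      qpow r (-(((r - 1 : ℕ) : ℂ) * (i + l * r + ε))) * xCoord hi l ε (idxS r i)
        (((deformed r i hi l ε).act .E ^ (r - 1)) (xBot hi l ε)) := by
  have h1 := average_smulRight_apply (V := deformed r i hi l ε) (isWeightForm_idxS hi l ε)
    (xH hi l ε 0) (act_F_xBot hi l ε) (act_H_xBot hi l ε)
  rw [act_F_pow_xH_bot] at h1
  have h3 := (deformed_end_bot (averageHom (preservesWeight_nilMap hi l ε))).symm.trans h1
  exact smul_left_injective ℂ (xBot_ne_zero hi l ε) h3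

theorem act_E_pow_xL_zero {k : ℕ} (hk : k < r - 1 - i) : ∃ c : ℂ, c ≠ 0 ∧
    ((deformed r i hi l 0).act .E ^ k) (xL hi l 0 k) = c • xL hi l 0 0 := by
  induction k with
  | zero => exact ⟨1, one_ne_zero, by simp⟩
  | succ k ih =>
    obtain ⟨c, hc, h⟩ := ih (by omega)
    refine ⟨-(-1) ^ l * qnum r (1 + i + (k + 1)) * qnum r (k + 1 - 0) * c, ?_, ?_⟩
    · have h1 := qnum_natCast_ne_zero hr.out (k := 1 + i + (k + 1)) (by omega) (by omega)
      have h2 := qnum_natCast_ne_zero hr.out (k := k + 1) (by omega) (by omega)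
      push_cast at h1 h2
      rw [sub_zero]
      exact mul_ne_zero (mul_ne_zero (mul_ne_zero
        (neg_ne_zero.mpr (zpow_ne_zero _ (by norm_num))) h1) h2) hc
    · rw [pow_succ, Module.End.mul_apply, act_E_xL_succ _ _ _ hk, map_smul, h, smul_smul]

/-- At `ε = 0` the vector `E ^ (r-1) w^L_{i+2-2r}` has a nonzero component along `w^S_i`. -/
theorem xCoord_act_E_pow_xBot_ne_zero : xCoord hi l 0 (idxS r i)
    (((deformed r i hi l 0).act .E ^ (r - 1)) (xBot hi l 0)) ≠ 0 := by
  obtain ⟨c, hc, h⟩ := act_E_pow_xL_zero hi l (k := r - 2 - i) (by omega)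
  have R := (deformed r i hi l 0).act_relations
  have h1 : xS hi l 0 i + (2 * defScalar r i 0) • xH hi l 0 i =
      ((deformed r i hi l 0).act .F ^ i) (xSec hi l 0) := by
    rw [xSec, map_add, map_smul, act_F_pow_xS _ _ _ le_rfl, act_F_pow_xH _ _ _ le_rfl]
  have h2 := R.e_pow_f_pow_highest hr.out
    ((deformed r i hi l 0).act_K_of_weight (act_H_xSec hi l 0)) (act_E_xSec hi l 0) i
  rw [show r - 1 = i + 1 + (r - 2 - i) by omega, pow_add, Module.End.mul_apply, h, map_smul,
    pow_succ, Module.End.mul_apply, act_E_xL_zero, h1, map_smul, map_smul, h2, map_smul, map_smul,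
    xSec, map_add, map_smul, xCoord_idxS_xS, xCoord_idxS_xH]
  simp only [smul_eq_mul, mul_zero, add_zero, mul_one]
  refine mul_ne_zero hc (mul_ne_zero (zpow_ne_zero _ (by norm_num))
    (Finset.prod_ne_zero_iff.mpr fun j hj => ?_))
  have hj' : j < i := Finset.mem_range.mp hj
  have h3 := qnum_natCast_ne_zero hr.out (k := j + 1) (by omega) (by omega)
  have h4 := qnum_natCast_ne_zero hr.out (k := i - j) (by omega) (by omega)
  rw [Nat.cast_add, Nat.cast_one] at h3
  rw [Nat.cast_sub hj'.le] at h4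
  rw [show (i + l * r + 1 - (j + 1) : ℂ) = l * r + (i - j) by ring,
    qnum_int_mul_self_add hr.out]
  exact mul_ne_zero h3 (mul_ne_zero (zpow_ne_zero _ (by norm_num)) h4)

theorem endA_average_nilMap_ne_zero :
    endA (averageHom (preservesWeight_nilMap hi l 0)) ≠ 0 := by
  have h1 := average_nilMap_bot hi l 0
  rw [defScalar, qnum_zero, mul_zero, zero_mul, sub_zero] at h1
  rw [h1]
  exact mul_ne_zero (qpow_ne_zero _ _) (xCoord_act_E_pow_xBot_ne_zero hi l)

/-- At `ε = 0` the average of `nilMap` is an automorphism, so that the identity is an average too. -/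
theorem isAveraged_deformed_zero : IsAveraged (deformed r i hi l 0) := by
  have ha := endA_average_nilMap_ne_zero hi l
  set D := averageHom (preservesWeight_nilMap hi l 0) with hD
  set a := endA D with haD
  have h1 := deformed_end_apply D
  have h2 := deformed_end_FE D
  rw [defScalar, qnum_zero, mul_zero, zero_smul, add_zero, mul_zero, zero_mul, sub_zero] at h2
  -- `D` is `a` times a unipotent, so its inverse is `(2 a - D) / a ^ 2`.
  let g : Hom (deformed r i hi l 0) (deformed r i hi l 0) :=
    (a ^ 2)⁻¹ • ((2 * a) • idHom _ - D)
  have h3 : compHom D g = idHom _ := by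
    refine deformed_hom_ext ?_
    have hg : g.1 (xH hi l 0 0) = (a ^ 2)⁻¹ • ((2 * a) • xH hi l 0 0 - D.1 (xH hi l 0 0)) := rfl
    change D.1 (g.1 (xH hi l 0 0)) = xH hi l 0 0
    rw [hg, h1, map_smul, map_sub, map_smul, map_add, map_smul, map_smul, h1, h2, ← haD]
    rw [show (2 * a) • (a • xH hi l 0 0 + endB D • xS hi l 0 0) -
      (a • (a • xH hi l 0 0 + endB D • xS hi l 0 0) + endB D • a • xS hi l 0 0) =
      a ^ 2 • xH hi l 0 0 by module, smul_smul, inv_mul_cancel₀ (pow_ne_zero 2 ha), one_smul]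
  refine ⟨nilMap hi l 0 ∘ₗ g.1, (preservesWeight_nilMap hi l 0).comp (hom_preservesWeight g), ?_⟩
  rw [average_comp_hom]
  exact congrArg Subtype.val h3

end DeformedProjective
/-! ### Continuity of the modified dimension at `ε = 0` -/

@[fun_prop]
theorem continuous_qpow (r : ℕ) : Continuous (qpow r) := by
  unfold qpow; fun_prop

@[fun_prop]
theorem continuous_qnum (r : ℕ) : Continuous (qnum r) := by
  unfold qnum
  exact Continuous.div_const (by fun_prop) _

/-- Continuous dependence of a linear operator on a complex parameter, through its matrix. -/
def ContinuousFamily {ι : Type} [Fintype ι] [DecidableEq ι] (A : ℂ → Module.End ℂ (ι → ℂ)) : Prop :=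
  Continuous fun ε => LinearMap.toMatrix' (A ε)

section ContinuousFamily

variable {ι : Type} [Fintype ι] [DecidableEq ι] {A B : ℂ → Module.End ℂ (ι → ℂ)}

theorem ContinuousFamily.mul (hA : ContinuousFamily A) (hB : ContinuousFamily B) :
    ContinuousFamily fun ε => A ε * B ε := by
  unfold ContinuousFamily at *
  simp only [LinearMap.toMatrix'_mul]
  exact hA.matrix_mul hB

theorem ContinuousFamily.sub (hA : ContinuousFamily A) (hB : ContinuousFamily B) :
    ContinuousFamily fun ε => A ε - B ε := by
  unfold ContinuousFamily at *
  simp only [map_sub]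
  exact Continuous.sub hA hB

theorem continuousFamily_const (A : Module.End ℂ (ι → ℂ)) : ContinuousFamily fun _ => A :=
  continuous_const

theorem ContinuousFamily.apply (hA : ContinuousFamily A) (v : ι → ℂ) (j : ι) :
    Continuous fun ε => A ε v j := by
  have h : ∀ ε, A ε v = (LinearMap.toMatrix' (A ε)).mulVec v := fun ε =>
    (LinearMap.toMatrix'_mulVec _ _).symm
  simp only [h]
  exact (continuous_apply j).comp (Continuous.matrix_mulVec hA continuous_const)

theorem continuousFamily_of_single (h : ∀ j k, Continuous fun ε => A ε (Pi.single j 1) k) :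
    ContinuousFamily A := by
  refine continuous_matrix fun k j => (h j k).congr fun ε => ?_
  rw [LinearMap.toMatrix'_apply]

theorem continuousFamily_opOfBasis {g : ℂ → ι → ι → ℂ} (h : ∀ j k, Continuous fun ε => g ε j k) :
    ContinuousFamily fun ε => opOfBasis (g ε) := by
  refine continuousFamily_of_single fun j k => ?_
  simp only [opOfBasis_single]
  exact h j k

theorem continuousFamily_mulLeft {w : ℂ → ι → ℂ} (h : ∀ j, Continuous fun ε => w ε j) :
    ContinuousFamily fun ε => LinearMap.mulLeft ℂ (w ε) := by
  refine continuousFamily_of_single fun j k => ?_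
  simp only [LinearMap.mulLeft_apply, Pi.mul_apply]
  exact (h k).mul continuous_const

end ContinuousFamily

theorem continuous_defE (r i : ℕ) (l : ℤ) (j k : DefIndex r i) :
    Continuous fun ε => defE r i l ε j k := by
  rcases j with (⟨_ | j, hj⟩ | ⟨_ | j, hj⟩) | (⟨_ | j, hj⟩ | j) <;>
    simp only [defE, Pi.add_apply, Pi.smul_apply, smul_eq_mul] <;> fun_prop

theorem continuous_defF (r i : ℕ) (j k : DefIndex r i) :
    Continuous fun ε => defF r i ε j k := by
  rcases j with (j | j) | (j | ⟨_ | j, hj⟩) <;> simp only [defF] <;> try split_ifs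
  all_goals try simp only [Pi.add_apply, Pi.smul_apply, smul_eq_mul]
  all_goals fun_prop

theorem continuous_defWeight (r i : ℕ) (l : ℤ) (j : DefIndex r i) :
    Continuous fun ε => defWeight r i l ε j := by
  rcases j with (j | j) | (j | j) <;> simp only [defWeight] <;> fun_prop

section DeformedContinuity

variable {r : ℕ} [hr : Fact (2 ≤ r)] {i : ℕ} (hi : i + 2 ≤ r) (l : ℤ)

theorem continuousFamily_act (g : Gen) : ContinuousFamily (ι := DefIndex r i) fun ε =>
    (deformed r i hi l ε).act g := by
  cases g
  · simp only [act_deformed_E]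
    exact continuousFamily_opOfBasis (continuous_defE r i l)
  · simp only [act_deformed_F]
    exact continuousFamily_opOfBasis (continuous_defF r i)
  · simp only [act_deformed_K]
    exact continuousFamily_mulLeft fun j => (continuous_qpow r).comp (continuous_defWeight r i l j)
  · simp only [act_deformed_Kinv]
    exact continuousFamily_mulLeft fun j =>
      (continuous_qpow r).comp (continuous_defWeight r i l j).neg
  · simp only [act_deformed_H]
    exact continuousFamily_mulLeft (continuous_defWeight r i l)

theorem continuousFamily_average {θ : ℂ → Module.End ℂ (DefIndex r i → ℂ)}
    (hθ : ContinuousFamily θ) : ContinuousFamily (ι := DefIndex r i) fun ε =>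
      average (deformed r i hi l ε) (deformed r i hi l ε) (θ ε) := by
  have c := continuousFamily_act hi l
  have hE : ∀ m, ContinuousFamily (ι := DefIndex r i) fun ε =>
      (adE (deformed r i hi l ε) (deformed r i hi l ε) ^ m) (θ ε) := by
    intro m
    induction m with
    | zero => exact hθ
    | succ m ih =>
      simp only [pow_succ']
      exact ((c .E).mul (ih.mul (c .Kinv))).sub (ih.mul ((c .E).mul (c .Kinv)))
  have hF : ∀ m, ContinuousFamily (ι := DefIndex r i) fun ε =>
      (adF (deformed r i hi l ε) (deformed r i hi l ε) ^ m)
        ((adE (deformed r i hi l ε) (deformed r i hi l ε) ^ (r - 1)) (θ ε)) := by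
    intro m
    induction m with
    | zero => exact hE _
    | succ m ih =>
      simp only [pow_succ', Module.End.mul_apply]
      exact ((c .F).mul ih).sub ((c .Kinv).mul (ih.mul ((c .K).mul (c .F))))
  exact hF _

theorem continuousFamily_average_topMap : ContinuousFamily (ι := DefIndex r i) fun ε =>
    average (deformed r i hi l ε) (deformed r i hi l ε) (topMap hi l ε) :=
  continuousFamily_average hi l (θ := fun _ => (LinearMap.proj (R := ℂ)
    (φ := fun _ : DefIndex r i => ℂ) (idxTop hi)).smulRight (wR r i (r - 2 - i)))
    (continuousFamily_const _)

theorem continuousFamily_average_nilMap : ContinuousFamily (ι := DefIndex r i) fun ε =>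
    average (deformed r i hi l ε) (deformed r i hi l ε) (nilMap hi l ε) :=
  continuousFamily_average hi l (θ := fun _ => (LinearMap.proj (R := ℂ)
    (φ := fun _ : DefIndex r i => ℂ) (idxS r i)).smulRight (wH r i 0))
    (continuousFamily_const _)

theorem continuous_endA_topMap :
    Continuous fun ε => endA (averageHom (preservesWeight_topMap hi l ε)) :=
  (continuousFamily_average_topMap hi l).apply (wH r i 0) (idxH r i)

theorem continuous_endB_topMap :
    Continuous fun ε => endB (averageHom (preservesWeight_topMap hi l ε)) :=
  (continuousFamily_average_topMap hi l).apply (wH r i 0) (idxS r i)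

theorem continuous_endA_nilMap :
    Continuous fun ε => endA (averageHom (preservesWeight_nilMap hi l ε)) :=
  (continuousFamily_average_nilMap hi l).apply (wH r i 0) (idxH r i)

theorem continuous_endB_nilMap :
    Continuous fun ε => endB (averageHom (preservesWeight_nilMap hi l ε)) :=
  (continuousFamily_average_nilMap hi l).apply (wH r i 0) (idxS r i)

theorem modTrace_topMap {ε : ℂ} (h : IsProjective (deformed r i hi l ε)) :
    modTrace r _ h (averageHom (preservesWeight_topMap hi l ε)) =
      (-1) ^ (r - 1) * kappa r (0 + r - 1) *
        qpow r (-(((r - 1 : ℕ) : ℂ) * topWeight r i l ε)) := by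
  rw [modTrace_averageHom, topMap, qtrace_smulRight _ (act_H_xTop hi l ε), xCoord_idxTop_xTop,
    mul_one]

theorem modTrace_nilMap {ε : ℂ} (h : IsProjective (deformed r i hi l ε)) :
    modTrace r _ h (averageHom (preservesWeight_nilMap hi l ε)) = 0 := by
  rw [modTrace_averageHom, nilMap, qtrace_smulRight _ (act_H_xH_zero hi l ε), xCoord_idxS_xH,
    mul_zero, mul_zero]

/-- A linear equation for the modified dimension of `X_ε` with coefficients that are continuous in
`ε`: eliminate the coefficient of `w^S_i` from the averages of `topMap` and `nilMap`. -/
theorem modifiedDim_deformed_equation {ε : ℂ} (h : IsProjective (deformed r i hi l ε)) :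
    (endB (averageHom (preservesWeight_nilMap hi l ε)) *
        endA (averageHom (preservesWeight_topMap hi l ε)) -
      endB (averageHom (preservesWeight_topMap hi l ε)) *
        endA (averageHom (preservesWeight_nilMap hi l ε))) *
      modifiedDim (deformed r i hi l ε) =
    endB (averageHom (preservesWeight_nilMap hi l ε)) * ((-1) ^ (r - 1) * kappa r (0 + r - 1) *
        qpow r (-(((r - 1 : ℕ) : ℂ) * topWeight r i l ε))) := by
  set D := averageHom (preservesWeight_nilMap hi l ε) with hD
  set D₁ := averageHom (preservesWeight_topMap hi l ε) with hD₁
  have h1 : endB D • D₁ + (-endB D₁) • D =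
      (endB D * endA D₁ - endB D₁ * endA D) • idHom (deformed r i hi l ε) +
        (0 : ℂ) • idHom (deformed r i hi l ε) := by
    refine deformed_end_ext ?_ ?_
    · rw [endA_combination, endA_combination, endA_idHom]; ring
    · rw [endB_combination, endB_combination, endB_idHom]; ring
  have h2 := congrArg (modTrace r _ h) h1
  rw [zero_smul, add_zero, map_add, map_smul, map_smul, map_smul, hD, hD₁, modTrace_topMap,
    modTrace_nilMap, ← modifiedDim_eq_modTrace, smul_zero, add_zero, smul_eq_mul, smul_eq_mul] at h2
  exact h2.symm

/-- The coefficient of the modified dimension in `modifiedDim_deformed_equation` does not vanish at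
`ε = 0`: there the average of `nilMap` is an automorphism, and the average of `topMap` is a nonzero
nilpotent endomorphism, as its modified trace is not zero. -/
theorem modifiedDim_deformed_det_ne_zero :
    endB (averageHom (preservesWeight_nilMap hi l 0)) *
        endA (averageHom (preservesWeight_topMap hi l 0)) -
      endB (averageHom (preservesWeight_topMap hi l 0)) *
        endA (averageHom (preservesWeight_nilMap hi l 0)) ≠ 0 := by
  have h1 := average_topMap_bot hi l 0
  rw [defScalar, qnum_zero, mul_zero, zero_mul] at h1
  rw [h1, mul_zero, zero_sub]
  refine neg_ne_zero.mpr (mul_ne_zero (fun h2 => ?_) (endA_average_nilMap_ne_zero hi l))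
  have h3 : averageHom (preservesWeight_topMap hi l 0) = 0 :=
    deformed_end_ext (h1.trans (map_zero (xCoord hi l 0 (idxH r i))).symm)
      (h2.trans (map_zero (xCoord hi l 0 (idxS r i))).symm)
  have h4 := modTrace_topMap hi l (isAveraged_deformed_zero hi l).isProjective
  rw [h3, map_zero] at h4
  exact mul_ne_zero (mul_ne_zero (pow_ne_zero _ (by norm_num)) kappa_steinberg_ne_zero)
    (qpow_ne_zero _ _) h4.symm

theorem ne_intCast_of_norm_lt_one {ε : ℂ} (h0 : ε ≠ 0) (h : ‖ε‖ < 1) (m : ℤ) : ε ≠ m := by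
  rintro rfl
  rw [Complex.norm_intCast] at h
  have h1 : |m| < 1 := by exact_mod_cast h
  rw [Int.abs_lt_one_iff] at h1
  exact h0 (by simp [h1])

theorem eventually_ne_intCast : ∀ᶠ ε : ℂ in nhdsWithin 0 {0}ᶜ, ∀ m : ℤ, ε ≠ m := by
  have h1 : ∀ᶠ ε : ℂ in nhdsWithin 0 {0}ᶜ, ‖ε‖ < 1 := by
    filter_upwards [nhdsWithin_le_nhds (Metric.ball_mem_nhds (0 : ℂ) one_pos)] with ε hε
    simpa using hε
  filter_upwards [h1, self_mem_nhdsWithin] with ε h2 h3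
  exact ne_intCast_of_norm_lt_one h3 h2

/-- The modified dimension of `X_ε` is continuous at `ε = 0`. -/
theorem tendsto_modifiedDim_deformed :
    Filter.Tendsto (fun ε => modifiedDim (deformed r i hi l ε)) (nhdsWithin 0 {0}ᶜ)
      (nhds (modifiedDim (deformed r i hi l 0))) := by
  set u : ℂ → ℂ := fun ε => endB (averageHom (preservesWeight_nilMap hi l ε)) *
    ((-1) ^ (r - 1) * kappa r (0 + r - 1) *
      qpow r (-(((r - 1 : ℕ) : ℂ) * topWeight r i l ε))) with hu
  set w : ℂ → ℂ := fun ε => endB (averageHom (preservesWeight_nilMap hi l ε)) *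
        endA (averageHom (preservesWeight_topMap hi l ε)) -
      endB (averageHom (preservesWeight_topMap hi l ε)) *
        endA (averageHom (preservesWeight_nilMap hi l ε)) with hw
  have cu : Continuous u := by
    refine (continuous_endB_nilMap hi l).mul (continuous_const.mul ?_)
    unfold topWeight
    fun_prop
  have cw : Continuous w :=
    ((continuous_endB_nilMap hi l).mul (continuous_endA_topMap hi l)).sub
      ((continuous_endB_topMap hi l).mul (continuous_endA_nilMap hi l))
  have w0 : w 0 ≠ 0 := modifiedDim_deformed_det_ne_zero hi l
  have h0 : modifiedDim (deformed r i hi l 0) = u 0 / w 0 := by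
    rw [eq_div_iff w0, mul_comm]
    exact modifiedDim_deformed_equation hi l (isAveraged_deformed_zero hi l).isProjective
  rw [h0]
  refine Filter.Tendsto.congr' ?_
    ((cu.continuousAt.div cw.continuousAt w0).tendsto.mono_left nhdsWithin_le_nhds)
  filter_upwards [eventually_ne_intCast,
    nhdsWithin_le_nhds (cw.continuousAt.eventually_ne w0)] with ε hε hwε
  rw [Pi.div_apply, div_eq_iff hwε, mul_comm]
  exact (modifiedDim_deformed_equation hi l (isAveraged_deformed_generic hi l hε).isProjective).symm

end DeformedContinuity
end WeightModule

/-! ### The closed form of the modified dimension -/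

/-- The product `[z] [z - 1] ⋯ [z - n + 1]`. -/
def qdesc (r n : ℕ) (z : ℂ) : ℂ := ∏ j ∈ Finset.range n, qnum r (z - j)

theorem qdesc_succ (r n : ℕ) (z : ℂ) : qdesc r (n + 1) z = qdesc r n z * qnum r (z - n) :=
  Finset.prod_range_succ _ _

theorem qdesc_succ' (r n : ℕ) (z : ℂ) : qdesc r (n + 1) z = qnum r z * qdesc r n (z - 1) := by
  rw [qdesc, Finset.prod_range_succ', Nat.cast_zero, sub_zero, mul_comm, qdesc]
  congr 1
  refine Finset.prod_congr rfl fun j _ => ?_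
  congr 1; push_cast; ring

/-- The product of `r` consecutive quantum numbers is antiperiodic. -/
theorem qdesc_add_one {r : ℕ} (hr : 2 ≤ r) (z : ℂ) : qdesc r r (z + 1) = -qdesc r r z := by
  obtain ⟨n, rfl⟩ : ∃ n, r = n + 1 := ⟨r - 1, by omega⟩
  rw [qdesc_succ', qdesc_succ, add_sub_cancel_right]
  have h := qnum_int_mul_self_add hr 1 (z - n)
  rw [Int.cast_one, one_mul, show ((n + 1 : ℕ) : ℂ) + (z - n) = z + 1 by push_cast; ring,
    zpow_one] at h
  rw [h]; ring

theorem qdesc_add_intCast {r : ℕ} (hr : 2 ≤ r) (z : ℂ) (m : ℤ) :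
    qdesc r r (z + m) = (-1) ^ m * qdesc r r z := by
  induction m using Int.induction_on with
  | zero => simp
  | succ m ih =>
    rw [show z + ((m + 1 : ℤ) : ℂ) = z + (m : ℤ) + 1 by push_cast; ring, qdesc_add_one hr, ih,
      neg_one_zpow_succ]
    ring
  | pred m ih =>
    have h := qdesc_add_one hr (z + ((-m - 1 : ℤ) : ℂ))
    rw [show z + ((-m - 1 : ℤ) : ℂ) + 1 = z + ((-m : ℤ) : ℂ) by push_cast; ring, ih] at h
    have h2 : (-1 : ℂ) ^ (-(m : ℤ)) = -(-1) ^ (-(m : ℤ) - 1) := by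
      rw [← neg_one_zpow_succ, sub_add_cancel]
    rw [h2] at h
    linear_combination h

theorem qnum_add_add_qnum_sub (r : ℕ) (z c : ℂ) :
    qnum r (z + c) + qnum r (z - c) = qnum r z * (qpow r c + qpow r (-c)) := by
  have h := qpow_ne_zero r c
  have h' := qpow_ne_zero r z
  simp only [qnum, sub_eq_add_neg, neg_add, neg_neg, qpow_add, qpow_neg]
  ring

theorem neg_one_zpow_eq_of_sub_even {a b c : ℤ} (h : a = b + 2 * c) :
    (-1 : ℂ) ^ a = (-1) ^ b := by
  rw [h, zpow_add₀ (by norm_num), zpow_mul]; simp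

namespace WeightModule

section ClosedForm

theorem kappa_eq {r : ℕ} (μ : ℂ) :
    kappa r μ = (∏ j ∈ Finset.range (r - 1), qnum r (j + 1)) * qdesc r (r - 1) μ := by
  rw [kappa, Finset.prod_mul_distrib, qdesc]
  congr 1
  refine Finset.prod_congr rfl fun j _ => ?_
  congr 1; ring

variable {r : ℕ} [hr : Fact (2 ≤ r)]

theorem qdesc_mul_qnum (z : ℂ) : qnum r z * qdesc r (r - 1) (z - 1) = qdesc r r z := by
  have h := qdesc_succ' r (r - 1) z
  rw [Nat.sub_add_cancel (by have := hr.out; omega)] at h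
  exact h.symm

theorem qdesc_neg_one_ne_zero : qdesc r (r - 1) (-1) ≠ 0 := by
  refine Finset.prod_ne_zero_iff.mpr fun j hj => ?_
  have hj' : j < r - 1 := Finset.mem_range.mp hj
  have h1 := qnum_natCast_ne_zero hr.out (k := j + 1) (by omega) (by omega)
  rw [Nat.cast_add, Nat.cast_one] at h1
  rw [show (-1 - j : ℂ) = -(j + 1) by ring, qnum_neg]
  exact neg_ne_zero.mpr h1

theorem qdesc_sub_one : qdesc r (r - 1) (0 + r - 1) = (-1) ^ (r - 1) * qdesc r (r - 1) (-1) := by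
  rw [qdesc, qdesc, ← Finset.card_range (r - 1), ← Finset.prod_const, Finset.card_range,
    ← Finset.prod_mul_distrib]
  refine Finset.prod_congr rfl fun j _ => ?_
  have := qnum_int_mul_self_add hr.out 1 (-1 - j)
  rw [Int.cast_one, one_mul, zpow_one] at this
  rw [← this]; congr 1; ring

variable {i : ℕ} (hi : i + 2 ≤ r) (l : ℤ)

/-- The closed form for generic `ε`: the two terms of `modifiedDim_deformed_generic` have the same
denominator because `qdesc r r` is antiperiodic, and their numerators are `[ε + i + 1]` and
`[ε - i - 1]` up to a common sign. -/
theorem modifiedDim_deformed_eq {ε : ℂ} (hε : ∀ m : ℤ, ε ≠ m) :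
    modifiedDim (deformed r i hi l ε) = (-1 : ℂ) ^ (l * ((r : ℤ) - 1) + i + 1) *
        (qpow r (i + 1) + qpow r (-(i : ℂ) - 1)) *
      (qdesc r (r - 1) (-1) / qdesc r (r - 1) (ε - 1)) := by
  have n1 := kappa_topWeight_ne_zero (r := r) (i := i) l hε
  have n2 := kappa_secWeight_ne_zero (r := r) (i := i) l hε
  have n0 := kappa_steinberg_ne_zero (r := r)
  rw [modifiedDim_deformed_generic hi l hε]
  rw [kappa_eq] at n0 n1 n2 ⊢
  rw [kappa_eq, kappa_eq]
  obtain ⟨nf, n1⟩ := mul_ne_zero_iff.mp n1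
  have n2 := (mul_ne_zero_iff.mp n2).2
  generalize (∏ j ∈ Finset.range (r - 1), qnum r (j + 1)) = c at *
  have hq : ∀ m : ℤ, qnum r (ε + m) ≠ 0 := fun m h => by
    obtain ⟨k, hk⟩ := (qnum_eq_zero_iff hr.out).mp h
    exact hε (k * r - m) (by push_cast; linear_combination hk)
  have e : ∀ m : ℤ, qnum r (ε + m) * qdesc r (r - 1) (ε + m - 1) =
      (-1) ^ m * qdesc r r ε := fun m => by
    rw [qdesc_mul_qnum, qdesc_add_intCast hr.out]
  have t1 := e (2 * r - 1 - i + l * r)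
  have t2 := e (i + 1 + l * r)
  have s1 : ((-1 : ℂ)) ^ (2 * r - 1 - i + l * r : ℤ) =
      (-1) ^ (l * ((r : ℤ) - 1) + i + 1) * (-1) ^ l := by
    rw [← zpow_add₀ (by norm_num)]
    exact neg_one_zpow_eq_of_sub_even (c := r - 1 - i) (by ring)
  have s2 : ((-1 : ℂ)) ^ (i + 1 + l * r : ℤ) =
      (-1) ^ (l * ((r : ℤ) - 1) + i + 1) * (-1) ^ l := by
    rw [← zpow_add₀ (by norm_num)]
    congr 1; ring
  have w1 : ε + ((2 * r - 1 - i + l * r : ℤ) : ℂ) = (l + 2 : ℤ) * r + (ε - (i + 1)) := by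
    push_cast; ring
  have w2 : ε + ((i + 1 + l * r : ℤ) : ℂ) = (l : ℤ) * r + (ε + (i + 1)) := by
    push_cast; ring
  rw [show ε + ((2 * r - 1 - i + l * r : ℤ) : ℂ) - 1 = topWeight r i l ε by
    rw [topWeight_eq hi]; push_cast; ring, w1, qnum_int_mul_self_add hr.out, s1,
    neg_one_zpow_eq_of_sub_even (show l + 2 = l + 2 * 1 by ring)] at t1
  rw [show ε + ((i + 1 + l * r : ℤ) : ℂ) - 1 = i + l * r + ε by push_cast; ring, w2,
    qnum_int_mul_self_add hr.out, s2] at t2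
  have sl : (-1 : ℂ) ^ l ≠ 0 := zpow_ne_zero _ (by norm_num)
  have hsum := qnum_add_add_qnum_sub r ε (i + 1)
  rw [neg_add, ← sub_eq_add_neg] at hsum
  have h0 := qdesc_mul_qnum (r := r) ε
  have hsgn : ((-1 : ℂ) ^ (r - 1)) * (-1) ^ (r - 1) = 1 := by rw [← mul_pow]; simp
  have hs2 := neg_one_zpow_mul_self (l * ((r : ℤ) - 1) + i + 1)
  have hε0 := hq 0
  rw [Int.cast_zero, add_zero] at hε0
  have P0 : qdesc r (r - 1) (ε - 1) ≠ 0 := by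
    refine Finset.prod_ne_zero_iff.mpr fun j _ => ?_
    have := hq (-1 - j)
    rwa [show ε + ((-1 - j : ℤ) : ℂ) = ε - 1 - j by push_cast; ring] at this
  rw [qdesc_sub_one]
  generalize (-1 : ℂ) ^ (l * ((r : ℤ) - 1) + i + 1) = s at *
  generalize (-1 : ℂ) ^ (r - 1) = x at *
  generalize (-1 : ℂ) ^ l = y at *
  generalize qpow r (i + 1) + qpow r (-(i : ℂ) - 1) = Q at *
  generalize qdesc r (r - 1) (topWeight r i l ε) = K₁ at *
  generalize qdesc r (r - 1) (i + l * r + ε) = K₂ at *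
  generalize qdesc r (r - 1) (ε - 1) = P at *
  generalize qdesc r (r - 1) (-1) = D at *
  generalize qnum r (ε + (i + 1)) = b at *
  generalize qnum r (ε - (i + 1)) = a at *
  generalize qnum r ε = z at *
  have u1 : a * K₁ = s * (z * P) := mul_left_cancel₀ sl (by rw [h0]; linear_combination t1)
  have u2 : b * K₂ = s * (z * P) := mul_left_cancel₀ sl (by rw [h0]; linear_combination t2)
  have s0 : s ≠ 0 := left_ne_zero_of_mul_eq_one hs2
  have n3 : s * (z * P) ≠ 0 := mul_ne_zero s0 (mul_ne_zero hε0 P0)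
  have v1 : K₁⁻¹ = a * (s * (z * P))⁻¹ := by
    have a0 : a ≠ 0 := left_ne_zero_of_mul (u1 ▸ n3)
    rw [← u1]; field_simp
  have v2 : K₂⁻¹ = b * (s * (z * P))⁻¹ := by
    have b0 : b ≠ 0 := left_ne_zero_of_mul (u2 ▸ n3)
    rw [← u2]; field_simp
  have si : s⁻¹ = s := inv_eq_of_mul_eq_one_right hs2
  calc x * (c * (x * D)) * ((c * K₁)⁻¹ + (c * K₂)⁻¹)
      = (x * x) * (c * c⁻¹) * D * (b + a) * (s⁻¹ * (z⁻¹ * P⁻¹)) := by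
        rw [mul_inv, mul_inv, v1, v2, mul_inv, mul_inv]; ring
    _ = s * Q * (D / P) := by
        rw [hsgn, mul_inv_cancel₀ nf, hsum, si]; field_simp

/-- The modified dimension of `X_0`, as the limit of the modified dimensions of `X_ε`. -/
theorem modifiedDim_deformed_zero : modifiedDim (deformed r i hi l 0) =
    (-1 : ℂ) ^ (l * ((r : ℤ) - 1) + i + 1) * (qpow r (i + 1) + qpow r (-(i : ℂ) - 1)) := by
  refine tendsto_nhds_unique (tendsto_modifiedDim_deformed hi l) ?_
  have h0 : qdesc r (r - 1) (0 - 1) ≠ 0 := by rw [zero_sub]; exact qdesc_neg_one_ne_zero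
  have hc : Continuous fun ε => qdesc r (r - 1) (ε - 1) := by
    unfold qdesc; fun_prop
  have h1 := (((continuousAt_const (y := qdesc r (r - 1) (-1))).div hc.continuousAt h0).const_mul
    ((-1 : ℂ) ^ (l * ((r : ℤ) - 1) + i + 1) * (qpow r (i + 1) + qpow r (-(i : ℂ) - 1)))).tendsto
  rw [Pi.div_apply, zero_sub, div_self qdesc_neg_one_ne_zero, mul_one] at h1
  refine (h1.mono_left nhdsWithin_le_nhds).congr' ?_
  filter_upwards [eventually_ne_intCast] with ε hε
  rw [modifiedDim_deformed_eq hi l hε]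
  rfl

end ClosedForm
/-! ### The projective cover of `S_i` -/

section ProjectiveCover

variable {r : ℕ} [hr : Fact (2 ≤ r)] {i : ℕ} (hi : i + 2 ≤ r)

theorem act_E_xH_succ (l : ℤ) {k : ℕ} (hk : k < i) :
    (deformed r i hi l 0).act .E (xH hi l 0 (k + 1)) =
      ((-1) ^ l * (qnum r (k + 1) * qnum r (i - k))) • xH hi l 0 k +
        (-1 : ℂ) ^ l • xS hi l 0 k := by
  rw [act_deformed_E]
  refine (defE_H_succ hk).trans ?_
  rw [show (1 + i - (k + 1) + 0 : ℂ) = i - k by ring, show (1 + i - (k + 1) : ℂ) = i - k by ring,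
    sub_zero]
  congr 2
  ring

theorem exists_act_E_xS_succ (l : ℤ) {k : ℕ} (hk : k < i) : ∃ c : ℂ,
    (deformed r i hi l 0).act .E (xS hi l 0 (k + 1)) = c • xS hi l 0 k := by
  rw [act_deformed_E]
  have h := defE_S_succ (r := r) (l := l) (ε := 0) hk
  rw [qnum_zero, zero_pow two_ne_zero, mul_zero, zero_smul, add_zero] at h
  exact ⟨_, h⟩

/-- A linear map on `X_ε` is determined by its values on the basis vectors. -/
theorem deformed_ext {l : ℤ} {ε : ℂ} {M : Type*} [AddCommGroup M] [Module ℂ M]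
    {f g : (deformed r i hi l ε).carrier →ₗ[ℂ] M}
    (hH : ∀ k ≤ i, f (xH hi l ε k) = g (xH hi l ε k))
    (hS : ∀ k ≤ i, f (xS hi l ε k) = g (xS hi l ε k))
    (hL : ∀ k < r - 1 - i, f (xL hi l ε k) = g (xL hi l ε k))
    (hR : ∀ k < r - 1 - i, f (xR hi l ε k) = g (xR hi l ε k)) : f = g := by
  refine (Pi.basisFun ℂ (DefIndex r i)).ext (f₁ := f) (f₂ := g) fun j => ?_
  rw [Pi.basisFun_apply]
  exact def_cases (l := l) (ε := ε) (p := fun v _ => f v = g v) hH hS hL hR j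

theorem simple_condition (r i : ℕ) :
    qnum r ((i + 1 : ℕ) : ℂ) * qnum r (i + 1 - ((i + 1 : ℕ) : ℂ)) = 0 := by
  push_cast; rw [sub_self, qnum_zero, mul_zero]

variable (i) in
/-- The simple module `S_i` as a highest weight module. -/
abbrev simpleHW (h : i + 1 ≤ r) : WeightModule r :=
  highestWeight r (i + 1) h i (simple_condition r i)

variable (i) in
/-- The vector `v_k` of the simple module `S_i`. -/
abbrev simpleVec (h : i + 1 ≤ r) (k : ℕ) : (simpleHW i h).carrier :=
  hwVec h (simple_condition r i) k

/-- The linear map `P_i → S_i` that takes `w^H_{i-2k}` to `v_k` and kills the other basis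
vectors. -/
def coverMap (h : i + 1 ≤ r) : (deformed r i hi 0 0).carrier →ₗ[ℂ] (simpleHW i h).carrier :=
  (Pi.basisFun ℂ (DefIndex r i)).constr ℂ fun
    | .inl (.inl k) => simpleVec i h k
    | _ => 0

variable (h : i + 1 ≤ r)

theorem coverMap_single (j : DefIndex r i) : coverMap hi h (Pi.single j 1 : DefIndex r i → ℂ) =
    match j with
    | .inl (.inl k) => simpleVec i h k
    | _ => 0 := by
  have := (Pi.basisFun ℂ (DefIndex r i)).constr_basis ℂ (fun j => match j with
    | .inl (.inl k) => simpleVec i h k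
    | _ => 0) j
  rw [Pi.basisFun_apply] at this
  exact this

theorem coverMap_xH {k : ℕ} (hk : k ≤ i) :
    coverMap hi h (xH hi 0 0 k) = simpleVec i h k := by
  rw [xH, wH, chainVec_of_lt _ (by omega)]
  exact coverMap_single hi h _

theorem coverMap_xS (k : ℕ) : coverMap hi h (xS hi 0 0 k) = 0 := by
  rw [xS, wS]
  by_cases hk : k < i + 1
  · rw [chainVec_of_lt _ hk]
    exact coverMap_single hi h _
  · rw [chainVec_of_le _ (by omega)]
    exact map_zero _

theorem coverMap_xL (k : ℕ) : coverMap hi h (xL hi 0 0 k) = 0 := by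
  rw [xL, wL]
  by_cases hk : k < r - 1 - i
  · rw [chainVec_of_lt _ hk]
    exact coverMap_single hi h _
  · rw [chainVec_of_le _ (by omega)]
    exact map_zero _

theorem coverMap_xR (k : ℕ) : coverMap hi h (xR hi 0 0 k) = 0 := by
  rw [xR, wR]
  by_cases hk : k < r - 1 - i
  · rw [chainVec_of_lt _ hk]
    exact coverMap_single hi h _
  · rw [chainVec_of_le _ (by omega)]
    exact map_zero _

theorem coverMap_E (v : (deformed r i hi 0 0).carrier) :
    coverMap hi h ((deformed r i hi 0 0).act .E v) =
      (simpleHW i h).act .E (coverMap hi h v) := by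
  refine LinearMap.congr_fun (f := coverMap hi h ∘ₗ (deformed r i hi 0 0).act .E)
    (g := (simpleHW i h).act .E ∘ₗ coverMap hi h) (deformed_ext hi ?_ ?_ ?_ ?_) v
  · rintro (_ | k) hk
    · rw [LinearMap.comp_apply, LinearMap.comp_apply, act_E_xH_zero, map_smul, coverMap_xR,
        smul_zero, coverMap_xH _ _ hk]
      refine (Eq.trans (hw_E (by omega)) ?_).symm
      rw [Nat.cast_zero, qnum_zero, zero_mul, zero_smul]
    · rw [LinearMap.comp_apply, LinearMap.comp_apply, act_E_xH_succ _ _ hk, map_add, map_smul,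
        map_smul, coverMap_xS, smul_zero, add_zero, coverMap_xH _ _ hk,
        coverMap_xH _ _ (by omega)]
      refine (Eq.trans (hw_E (by omega)) ?_).symm
      rw [Nat.add_sub_cancel, zpow_zero, one_mul]
      congr 3 <;> push_cast <;> ring
  · rintro (_ | k) hk
    · rw [LinearMap.comp_apply, LinearMap.comp_apply, act_E_xS_zero, map_smul, coverMap_xR,
        smul_zero, coverMap_xS, map_zero]
    · obtain ⟨c, hc⟩ := exists_act_E_xS_succ hi 0 hk
      rw [LinearMap.comp_apply, LinearMap.comp_apply, hc, map_smul, coverMap_xS,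
        smul_zero, coverMap_xS, map_zero]
  · rintro (_ | k) hk
    · rw [LinearMap.comp_apply, LinearMap.comp_apply, act_E_xL_zero, defScalar, qnum_zero, mul_zero,
        mul_zero, zero_smul, add_zero, map_smul, coverMap_xS, coverMap_xL, map_zero, smul_zero]
    · rw [LinearMap.comp_apply, LinearMap.comp_apply, act_E_xL_succ _ _ _ hk, map_smul,
        coverMap_xL, coverMap_xL, map_zero, smul_zero]
  · intro k _
    rw [LinearMap.comp_apply, LinearMap.comp_apply, act_E_xR, map_smul, coverMap_xR, coverMap_xR,
      map_zero, smul_zero]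

theorem coverMap_F (v : (deformed r i hi 0 0).carrier) :
    coverMap hi h ((deformed r i hi 0 0).act .F v) =
      (simpleHW i h).act .F (coverMap hi h v) := by
  refine LinearMap.congr_fun (f := coverMap hi h ∘ₗ (deformed r i hi 0 0).act .F)
    (g := (simpleHW i h).act .F ∘ₗ coverMap hi h) (deformed_ext hi ?_ ?_ ?_ ?_) v
  · intro k hk
    rw [LinearMap.comp_apply, LinearMap.comp_apply, coverMap_xH _ _ hk]
    refine Eq.trans ?_ (hw_F k).symm
    rcases hk.lt_or_eq with hk' | rfl
    · rw [act_F_xH _ _ _ hk', coverMap_xH _ _ hk']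
    · rw [act_F_xH_last, coverMap_xL]
      exact (hwVec_of_le le_rfl).symm
  · intro k hk
    rw [LinearMap.comp_apply, LinearMap.comp_apply, coverMap_xS, map_zero]
    rcases hk.lt_or_eq with hk' | rfl
    · rw [act_F_xS _ _ _ hk', coverMap_xS]
    · rw [act_F_xS_last, map_smul, coverMap_xL, smul_zero]
  · intro k _
    rw [LinearMap.comp_apply, LinearMap.comp_apply, act_F_xL, coverMap_xL, coverMap_xL, map_zero]
  · rintro (_ | k) hk
    · rw [LinearMap.comp_apply, LinearMap.comp_apply, act_F_xR_zero, defScalar, qnum_zero, mul_zero,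
        zero_smul, add_zero, coverMap_xS, coverMap_xR, map_zero]
    · rw [LinearMap.comp_apply, LinearMap.comp_apply, act_F_xR_succ _ _ _ hk, map_smul, coverMap_xR,
        coverMap_xR, map_zero, smul_zero]

theorem coverMap_H (v : (deformed r i hi 0 0).carrier) :
    coverMap hi h ((deformed r i hi 0 0).act .H v) =
      (simpleHW i h).act .H (coverMap hi h v) := by
  refine LinearMap.congr_fun (f := coverMap hi h ∘ₗ (deformed r i hi 0 0).act .H)
    (g := (simpleHW i h).act .H ∘ₗ coverMap hi h) (deformed_ext hi ?_ ?_ ?_ ?_) v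
  · intro k hk
    rw [LinearMap.comp_apply, LinearMap.comp_apply, act_H_xH, map_smul, coverMap_xH _ _ hk]
    refine Eq.trans ?_ (hw_H k).symm
    rw [Int.cast_zero, zero_mul, add_zero, add_zero]
  · intro k _
    rw [LinearMap.comp_apply, LinearMap.comp_apply, act_H_xS, map_smul, coverMap_xS, map_zero,
      smul_zero]
  · intro k _
    rw [LinearMap.comp_apply, LinearMap.comp_apply, act_H_xL, map_smul, coverMap_xL, map_zero,
      smul_zero]
  · intro k _
    rw [LinearMap.comp_apply, LinearMap.comp_apply, act_H_xR, map_smul, coverMap_xR, map_zero,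
      smul_zero]

/-- The homomorphism `P_i → S_i` onto the head. -/
def coverHom : Hom (deformed r i hi 0 0) (simpleHW i h) :=
  ⟨coverMap hi h, mem_hom_of_generators (coverMap_E hi h) (coverMap_F hi h) (coverMap_H hi h)⟩

theorem coverHom_surjective : Function.Surjective (coverHom hi h).1 := by
  intro u
  refine ⟨∑ k : Fin (i + 1), hwCoord h (simple_condition r i) k u • xH hi 0 0 k, ?_⟩
  refine (map_sum (coverMap hi h) _ _).trans (Eq.trans ?_ (hw_expand u).symm)
  refine Finset.sum_congr rfl fun k _ => ?_
  rw [map_smul, coverMap_xH _ _ (by omega)]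

/-- The projection of `P_i` to `S_i` is a projective cover: a submodule that maps onto `S_i`
contains a vector of weight `i` of the form `w^H_i + c w^S_i`, hence also
`w^S_i = F E (w^H_i + c w^S_i)`, and so the generator `w^H_i`. -/
theorem isProjectiveCover_coverHom : IsProjectiveCover (coverHom hi h) := by
  refine ⟨(isAveraged_deformed_zero hi 0).isProjective, coverHom_surjective hi h, ?_⟩
  intro N hN hmap
  have hv : simpleVec i h 0 ∈ N.map (coverHom hi h).1 := by rw [hmap]; trivial
  obtain ⟨n, hn, hn0⟩ := hv
  obtain ⟨x, hx1, hx2⟩ := exists_weight_projection (deformed r i hi 0 0) i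
  set m : (deformed r i hi 0 0).carrier := (deformed r i hi 0 0).ρ x n with hm
  have hmN : m ∈ N := hN x n hn
  have hm1 : coverMap hi h m = simpleVec i h 0 := by
    refine ((coverHom hi h).2 x n).trans ?_
    rw [hn0]
    refine hx2 _ _ ((hw_H 0).trans ?_)
    rw [Nat.cast_zero, mul_zero, sub_zero]
  have hm2 : m = xCoord hi 0 0 (idxH r i) m • xH hi 0 0 0 +
      xCoord hi 0 0 (idxS r i) m • xS hi 0 0 0 := by
    refine eq_of_weight ((hx1 n).trans ?_)
    rw [Int.cast_zero, zero_mul, add_zero, add_zero]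
  generalize xCoord hi 0 0 (idxH r i) m = a at hm2
  generalize xCoord hi 0 0 (idxS r i) m = b at hm2
  have ha : a = 1 := by
    rw [hm2, map_add, map_smul, map_smul, coverMap_xS, smul_zero, add_zero,
      coverMap_xH _ _ (Nat.zero_le _)] at hm1
    have h1 := congrArg (hwCoord h (simple_condition r i) ⟨0, by omega⟩) hm1
    refine Eq.trans ?_ (h1.trans ((hwCoord_hwVec _ _).trans (if_pos rfl)))
    refine ((mul_one a).symm.trans ?_)
    rw [map_smul, hwCoord_hwVec, if_pos rfl, smul_eq_mul]
  have hS : xS hi 0 0 0 ∈ N := by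
    have h1 := hN (UqH.gen r .F) _ (hN (UqH.gen r .E) m hmN)
    have h2 : (deformed r i hi 0 0).act .F ((deformed r i hi 0 0).act .E m) = xS hi 0 0 0 := by
      rw [hm2, ha, map_add, map_smul, map_smul, act_E_xH_zero, act_E_xS_zero, defScalar, qnum_zero,
        mul_zero, mul_zero, zero_smul, smul_zero, add_zero, one_smul, zpow_zero, one_smul,
        act_F_xR_zero, defScalar, qnum_zero, mul_zero, zero_smul, add_zero]
    exact h2 ▸ h1
  refine eq_top_of_xH_mem hi 0 0 (fun v hv => hN _ v hv) (fun v hv => hN _ v hv) ?_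
  rw [hm2, ha, one_smul] at hmN
  exact (N.add_mem_iff_left (N.smul_mem _ hS)).mp hmN

/-! ### Tensoring with `ℂ^H_{l r}` -/

theorem character_condition (r : ℕ) [hr : Fact (2 ≤ r)] (l : ℤ) :
    qnum r (1 : ℕ) * qnum r (l * r + 1 - (1 : ℕ)) = 0 := by
  have := (qnum_eq_zero_iff hr.out (z := l * r)).mpr ⟨l, rfl⟩
  rw [Nat.cast_one, add_sub_cancel_right, this, mul_zero]

/-- The quantum dimension of `ℂ^H_{l r}`. -/
theorem qtrace_character_one (l : ℤ) :
    qtrace (character r l) 1 = (-1 : ℂ) ^ (l * ((r : ℤ) - 1)) := by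
  have hn : 1 ≤ r := by have := hr.out; omega
  have h0 := character_condition r l
  have h1 : (1 : Module.End ℂ (highestWeight r 1 hn (l * r) h0).carrier) =
      (hwCoord hn h0 0).smulRight (hwVec hn h0 0) := by
    refine hw_ext fun k hk => ?_
    obtain rfl : k = 0 := by omega
    rw [LinearMap.smulRight_apply, hwCoord_hwVec, if_pos (show ((0 : Fin 1) : ℕ) = 0 from rfl),
      one_smul]
    rfl
  have h2 : (highestWeight r 1 hn (l * r) h0).act .H (hwVec hn h0 0) =
      (l * r : ℂ) • hwVec hn h0 0 := by
    rw [hw_H, Nat.cast_zero, mul_zero, sub_zero]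
  change qtrace (highestWeight r 1 hn (l * r) h0) 1 = _
  rw [h1, qtrace_smulRight _ h2, hwCoord_hwVec, if_pos (show ((0 : Fin 1) : ℕ) = 0 from rfl),
    mul_one]
  have h3 : -(((r - 1 : ℕ) : ℂ) * (l * r)) = ((-(l * (r - 1)) : ℤ) : ℂ) * r := by
    rw [Nat.cast_sub hn]; push_cast; ring
  rw [h3, qpow_int_mul_self hr.out]
  exact neg_one_zpow_eq_of_sub_even (c := -(l * (r - 1))) (by ring)

variable (i) in
theorem modifiedDim_projP_tensor (l : ℤ) :
    modifiedDim ((projP r i hi).tensor (character r l)) =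
      (-1 : ℂ) ^ (l * ((r : ℤ) - 1) + i + 1) * (qpow r (i + 1) + qpow r (-(i : ℂ) - 1)) := by
  change modifiedDim ((deformed r i hi 0 0).tensor (character r l)) = _
  rw [modifiedDim_tensor (isAveraged_deformed_zero hi 0).isProjective, qtrace_character_one,
    modifiedDim_deformed_zero, ← mul_assoc, ← zpow_add₀ (by norm_num)]
  congr 2
  ring

end ProjectiveCover
end WeightModule

end Unrolled

end

theorem mainTheorem8 (r : ℕ) [Fact (2 ≤ r)] (i : ℕ) (hi : i + 2 ≤ r) (l : ℤ) :
    -- there is exactly one normalized modified trace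
    (∃! t : Unrolled.WeightModule.TraceFamily r,
      Unrolled.WeightModule.IsNormalizedModifiedTrace r t) ∧
    -- the modules whose modified dimensions occur are projective, and `P_i` covers `S_i`
    (∀ ε : ℝ, ε ∈ Set.Ioo (-(1 / 2) : ℝ) (1 / 2) →
      (Unrolled.WeightModule.deformed r i hi l (ε : ℂ)).IsProjective) ∧
    (∃ π : Unrolled.WeightModule.Hom (Unrolled.WeightModule.projP r i hi)
        (Unrolled.WeightModule.simple r i (by omega)),
      Unrolled.WeightModule.IsProjectiveCover π) ∧
    ((Unrolled.WeightModule.projP r i hi).tensor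
      (Unrolled.WeightModule.character r l)).IsProjective ∧
    -- the limit of the modified dimensions
    Filter.Tendsto
      (fun ε : ℝ => Unrolled.WeightModule.modifiedDim
        (Unrolled.WeightModule.deformed r i hi l (ε : ℂ)))
      (nhdsWithin 0 {0}ᶜ)
      (nhds (Unrolled.WeightModule.modifiedDim
        ((Unrolled.WeightModule.projP r i hi).tensor (Unrolled.WeightModule.character r l)))) ∧
    Unrolled.WeightModule.modifiedDim (Unrolled.WeightModule.deformed r i hi l 0) =
      Unrolled.WeightModule.modifiedDim
        ((Unrolled.WeightModule.projP r i hi).tensor (Unrolled.WeightModule.character r l)) ∧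
    Unrolled.WeightModule.modifiedDim
        ((Unrolled.WeightModule.projP r i hi).tensor (Unrolled.WeightModule.character r l)) =
      (-1 : ℂ) ^ (l * ((r : ℤ) - 1) + i + 1) *
        (Unrolled.qpow r (i + 1) + Unrolled.qpow r (-(i : ℂ) - 1)) := by
  have h0 := Unrolled.WeightModule.modifiedDim_deformed_zero (r := r) hi l
  have h1 := Unrolled.WeightModule.modifiedDim_projP_tensor (r := r) i hi l
  refine ⟨Unrolled.WeightModule.existsUnique_isNormalizedModifiedTrace, fun ε hε => ?_,
    ⟨_, Unrolled.WeightModule.isProjectiveCover_coverHom hi (by omega)⟩,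
    ((Unrolled.WeightModule.isAveraged_deformed_zero hi 0).tensor _).isProjective, ?_,
    h0.trans h1.symm, h1⟩
  · by_cases h : ε = 0
    · rw [h, Complex.ofReal_zero]
      exact (Unrolled.WeightModule.isAveraged_deformed_zero hi l).isProjective
    · refine (Unrolled.WeightModule.isAveraged_deformed_generic hi l
        (Unrolled.WeightModule.ne_intCast_of_norm_lt_one (by exact_mod_cast h) ?_)).isProjective
      rw [Complex.norm_real, Real.norm_eq_abs, abs_lt]
      exact ⟨by linarith [hε.1], by linarith [hε.2]⟩
  · rw [h1, ← h0]
    refine (Unrolled.WeightModule.tendsto_modifiedDim_deformed hi l).comp ?_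
    refine tendsto_nhdsWithin_iff.mpr ⟨?_, ?_⟩
    · have := Complex.continuous_ofReal.tendsto (0 : ℝ)
      rw [Complex.ofReal_zero] at this
      exact this.mono_left nhdsWithin_le_nhds
    · filter_upwards [self_mem_nhdsWithin] with ε hε
      exact fun h => hε (Complex.ofReal_eq_zero.mp h)
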